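/- **Proposition.** Let $a,b\in\mathbb R$ be such that $-1\le a<b\le 1$. Then there exist a weight function $\beta\in C^3([-1,1];(0,\infty))$ and positive constants $C_1,C_2$ (depending only on $a,b$) such that, for every $n\in\mathbb Z$, every real $p>0$, every $T>0$ and every complex-valued $$g\in C([0,T];L^2(-1,1))\cap L^2(0,T;H^1_0(-1,1)),$$ one has, with $\mathcal P_{n,p}g:=\partial_t g-\partial_x^2 g+(px+n)^2 g$ (in the sense of distributions on $(0,T)\times(-1,1)$) and $M:=C_2\max\{T+T^2;\,(|n|+p)T^2\}$, $$C_1\int_0^T\!\!\int_{-1}^1\Big(\frac{M}{t(T-t)}|\partial_x g|^2+\frac{M^3}{[t(T-t)]^3}|g|^2\Big)e^{-\frac{M\beta(x)}{t(T-t)}}\,dx\,dt$$ $$\le\int_0^T\!\!\int_{-1}^1|\mathcal P_{n,p}g|^2e^{-\frac{M\beta(x)}{t(T-t)}}\,dx\,dt+\int_0^T\!\!\int_a^b\frac{M^3}{[t(T-t)]^3}|g|^2e^{-\frac{M\beta(x)}{t(T-t)}}\,dx\,dt.$$ Here the integral of $|\mathcal P_{n,p}g|^2$ takes values in $[0,\infty]$;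 it is understood to be $+\infty$ if the distribution $\mathcal P_{n,p}g$ is not a locally integrable function on $(0,T)\times(-1,1)$. -/

import Mathlib

open MeasureTheory Set
open scoped ENNReal

noncomputable section

namespace HeatCarleman

/-- Lebesgue measure on the interval `(-1,1)`. -/
abbrev muI : Measure ℝ := volume.restrict (Ioo (-1 : ℝ) 1)

/-- The space `L²(-1,1;ℂ)`. -/
abbrev L2I : Type := Lp ℂ 2 muI

/-- The interval `(-1,1)` as an open set. -/
def openI : TopologicalSpace.Opens ℝ := ⟨Ioo (-1 : ℝ) 1, isOpen_Ioo⟩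

/-- The rectangle `(0,T) × (-1,1)` as an open set. -/
def openRect (T : ℝ) : TopologicalSpace.Opens (ℝ × ℝ) :=
  ⟨Ioo (0 : ℝ) T ×ˢ Ioo (-1 : ℝ) 1, isOpen_Ioo.prod isOpen_Ioo⟩

/-- The pairs of classes `(φ, φ')` with `φ` a smooth, compactly supported function on `(-1,1)`. -/
def testPairs : Set (L2I × L2I) :=
  {q | ∃ φ : TestFunction openI ℂ ⊤, (q.1 =ᵐ[muI] φ) ∧ (q.2 =ᵐ[muI] deriv φ)}

/-- `HasH10Deriv u v`: the function `u` belongs to `H¹₀(-1,1;ℂ)` (the closure of the smooth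
compactly supported functions for the `H¹` norm) and its weak derivative is `v`. -/
def HasH10Deriv (u v : L2I) : Prop := (u, v) ∈ closure testPairs

/-- `g` belongs to `L²(0,T;H¹₀(-1,1;ℂ))` and its weak derivative in space is `gx`. -/
structure MemL2H10 (T : ℝ) (g gx : ℝ → L2I) : Prop where
  memLp : MemLp g 2 (volume.restrict (Ioo 0 T))
  memLp_deriv : MemLp gx 2 (volume.restrict (Ioo 0 T))
  hasDeriv : ∀ᵐ t ∂(volume.restrict (Ioo 0 T)), HasH10Deriv (g t) (gx t)

/-- The locally integrable function `f` on `(0,T) × (-1,1)` represents the distribution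
`∂ₜ g - ∂ₓ² g + (p x + n)² g`; derivatives are moved to the (complex-valued) test functions. -/
structure IsParabolic (T : ℝ) (n : ℤ) (p : ℝ) (g : ℝ → L2I) (f : ℝ × ℝ → ℂ) : Prop where
  locallyIntegrableOn : LocallyIntegrableOn f (Ioo (0 : ℝ) T ×ˢ Ioo (-1 : ℝ) 1)
  weak : ∀ φ : TestFunction (openRect T) ℂ ⊤,
    ∫ t in Ioo (0 : ℝ) T, ∫ x in Ioo (-1 : ℝ) 1,
        g t x * (-deriv (fun s : ℝ => φ (s, x)) t - iteratedDeriv 2 (fun y : ℝ => φ (t, y)) x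
          + (((p * x + n) ^ 2 : ℝ) : ℂ) * φ (t, x))
      = ∫ t in Ioo (0 : ℝ) T, ∫ x in Ioo (-1 : ℝ) 1, f (t, x) * φ (t, x)

/-- The large parameter `M = C₂ max{T + T², (|n| + p) T²}`. -/
def carlemanM (C₂ T : ℝ) (n : ℤ) (p : ℝ) : ℝ :=
  C₂ * max (T + T ^ 2) ((|(n : ℝ)| + p) * T ^ 2)

/-- The weight `exp(-M β(x) / (t (T - t)))`. -/
def weight (β : ℝ → ℝ) (M T t x : ℝ) : ℝ := Real.exp (-(M * β x / (t * (T - t))))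

end HeatCarleman

end

/-! Put `s = M / (t (T - t))`, `V = (p x + n)²` and `z = exp (-s β / 2) g`. Conjugating the heat
operator with the weight gives `P1 + P2`, where `P1 = -∂ₓ² + (s' β / 2 - (s β' / 2)² + V)` is
symmetric in space and `P2 = ∂ₜ - s β' ∂ₓ - s β'' / 2` is skew-symmetric. Since `2 P1z P2z ≤ (P1z +
P2z)²`, it suffices to bound the cross product from below. Up to exact time and space derivatives it
equals `-2 s β'' zₓ² - (s³ β'² β'' / 2) z²` plus remainders. This is positive wherever `β` is
strictly concave and has no critical point, provided that the remainders are small compared with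
`s³`. They are, because `M` is a large multiple `C` of `T`, `T²` and `(|n| + p) T²`: then `s'` is at
most `s² / C`, `s''` at most `3 s³ / C²`, and `V' ≤ 2 (|n| + p)² ≤ 2 (s / C)²`. In the cross product
the potential enters the remainders only through `V'`, which is why `M` need only grow linearly in
`|n| + p`.

A weight decreasing at `-1` and increasing at `1`, as the sign of the boundary flux requires, must
have a critical point; it is placed in `(a,b)`. The defect of positivity there is carried by `K χ`
with `χ` a cutoff supported in `(a,b)`. Its `zₓ²` part is repaired by also testing the equation with
`K s χ z`; its `z²` part goes into the observation term. `pointwise_carleman` is the resulting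
algebraic inequality in divergence form.

On a strip `[t₀,t₁]` inside `(0,T)` everything is regular, and integration gives the estimate for
finite sine sums with boundary terms in time. For a weak solution whose right-hand side has finite
weighted norm, tensor test functions and density in `H¹₀` show that the sine coefficients solve
ordinary differential equations (`IsParabolic.coefficient_ode`). Truncating the series and smoothing
the coefficients in time then approximates `g`, `gₓ` and the right-hand side in `L²` of the strip
(`exists_sine_approx`), and the estimate passes to `g` (`weak_carleman`).

Finally the strip grows to `(0,T)`. The boundary terms carry a factor `s³ exp (-s m) = O(t (T -
t))`. At the right end only `‖g‖²` is needed, and it is bounded. At the left end `‖gₓ‖²` is needed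
as well, and `t₀` is chosen with `t₀ ‖gₓ(t₀)‖²` small; this is possible because `‖gₓ‖²` is
integrable while `1 / t` is not. -/

noncomputable section

namespace HeatCarleman

open Filter Topology

/-! ### The spatial weight and the cutoff -/

/-- A spatial weight `β` with its first four derivatives, and a cutoff `χ` supported in `(a,b)`
outside of which `β` is concave without critical point, with quantitative bounds on `[-1,1]`. -/
structure CarlemanWeight (a b : ℝ) where
  (β β1 β2 β3 β4 χ χ1 χ2 : ℝ → ℝ)
  (κ K B m : ℝ)
  hβ : ∀ x, HasDerivAt β (β1 x) x
  hβ1 : ∀ x, HasDerivAt β1 (β2 x) x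
  hβ2 : ∀ x, HasDerivAt β2 (β3 x) x
  hβ3 : ∀ x, HasDerivAt β3 (β4 x) x
  hβ4 : Continuous β4
  hχ : ∀ x, HasDerivAt χ (χ1 x) x
  hχ1 : ∀ x, HasDerivAt χ1 (χ2 x) x
  hχ2 : Continuous χ2
  κ_pos : 0 < κ
  K_nonneg : 0 ≤ K
  one_le_B : 1 ≤ B
  m_pos : 0 < m
  m_le : ∀ x ∈ Icc (-1 : ℝ) 1, m ≤ β x
  bound : ∀ x ∈ Icc (-1 : ℝ) 1, |β x| ≤ B ∧ |β1 x| ≤ B ∧ |β2 x| ≤ B ∧ |β3 x| ≤ B ∧ |β4 x| ≤ B ∧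
    |χ x| ≤ B ∧ |χ1 x| ≤ B ∧ |χ2 x| ≤ B
  concave : ∀ x ∈ Icc (-1 : ℝ) 1, κ - K * χ x ≤ -β2 x
  concave_sq : ∀ x ∈ Icc (-1 : ℝ) 1, κ - K * χ x ≤ -(β2 x * β1 x ^ 2)
  χ_nonneg : ∀ x, 0 ≤ χ x
  χ_zero : ∀ x ∉ Ioo a b, χ x = 0 ∧ χ1 x = 0 ∧ χ2 x = 0
  right : 0 ≤ β1 1
  left : β1 (-1) ≤ 0

/-- The two expressions are `β''` and `β'` for `β = 6 √(y² + e) - y² / 2`. As `β' = y (6 / √(y² + e)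
- 1)` and the root is at most `3`, the slope is at least `|y|` in size; the smallness of `e` keeps
the smoothed kink of `6 |y|` convex only near `y = 0`. -/
theorem sqrt_weight_facts {e r y : ℝ} (he : 0 < e) (hr : 0 < r) (her : e ≤ r ^ 3 / 12)
    (he1 : e ≤ 1) (hy : |y| ≤ 2) (hry : r ≤ |y|) :
    6 * e / √(y ^ 2 + e) ^ 3 - 1 ≤ -(1 / 2) ∧ r ^ 2 ≤ (6 * y / √(y ^ 2 + e) - y) ^ 2 := by
  have hpos : 0 < y ^ 2 + e := by positivity
  set w := √(y ^ 2 + e) with hw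
  have hw0 : 0 < w := Real.sqrt_pos.2 hpos
  have hw2 : w ^ 2 = y ^ 2 + e := Real.sq_sqrt hpos.le
  have hyy : |y| ^ 2 = y ^ 2 := sq_abs y
  have hrw : r ≤ w := by
    apply Real.le_sqrt_of_sq_le
    nlinarith [abs_nonneg y]
  have hw3 : w ≤ 3 := by nlinarith [abs_nonneg y]
  constructor
  · have h3 : r ^ 3 ≤ w ^ 3 := by gcongr
    have : 6 * e / w ^ 3 ≤ 1 / 2 := by
      rw [div_le_iff₀ (by positivity)]; linarith
    linarith
  · have h1 : 1 ≤ 6 / w - 1 := by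
      rw [le_sub_iff_add_le, le_div_iff₀ hw0]; linarith
    have h2 : (6 * y / w - y) = y * (6 / w - 1) := by ring
    rw [h2, mul_pow, ← hyy]
    have : (1:ℝ) ≤ (6 / w - 1) ^ 2 := by nlinarith
    nlinarith [sq_nonneg (|y|)]

/-- A smoothed `6 |x - c|` minus a small parabola has its only critical point on `[-1,1]` at the
midpoint `c` of `(a,b)`, is concave away from `c`, and has the outward slopes wanted at `±1`. -/
theorem exists_carlemanWeight {a b : ℝ} (ha : -1 ≤ a) (hab : a < b) (hb : b ≤ 1) :
    Nonempty (CarlemanWeight a b) := by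
  set c := (a + b) / 2 with hc
  set r := (b - a) / 8 with hr
  have hr0 : 0 < r := by rw [hr]; linarith
  have hr4 : r ≤ 1 / 4 := by rw [hr]; linarith
  -- Largest value for which `6 e / w³ ≤ 1 / 2` as soon as `w ≥ r`.
  set e := r ^ 3 / 12 with he
  have he0 : 0 < e := by positivity
  have he1 : e ≤ 1 := by
    have : r ^ 3 ≤ 1 ^ 3 := by gcongr; linarith
    rw [he]; linarith
  -- Equal to `1` where the concavity may fail, and supported in `|x - c| ≤ 2 r`, well inside
  -- `(a,b)`, whose half-length is `4 r`.
  let f : ContDiffBump c := ⟨r, 2 * r, hr0, by linarith⟩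
  let w : ℝ → ℝ := fun x => √((x - c) ^ 2 + e)
  have hp : ∀ x, 0 < (x - c) ^ 2 + e := fun x => by positivity
  have hw0 : ∀ x, 0 < w x := fun x => Real.sqrt_pos.2 (hp x)
  have hww : ∀ x, w x ^ 2 = (x - c) ^ 2 + e := fun x => Real.sq_sqrt (hp x).le
  have hwd : ∀ x, HasDerivAt w ((x - c) / w x) x := fun x => by
    have := ((((hasDerivAt_id x).sub_const c).pow 2).add_const e).sqrt (hp x).ne'
    refine this.congr_deriv ?_
    simp only [id]
    have : √((x - c) ^ 2 + e) ≠ 0 := (hw0 x).ne'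
    change _ = (x - c) / √((x - c) ^ 2 + e)
    norm_num
    field_simp
  let β : ℝ → ℝ := fun x => 6 * w x - (x - c) ^ 2 / 2
  let β1 : ℝ → ℝ := fun x => 6 * (x - c) / w x - (x - c)
  let β2 : ℝ → ℝ := fun x => 6 * e / w x ^ 3 - 1
  have hβ : ∀ x, HasDerivAt β (β1 x) x := fun x => by
    refine (((hwd x).const_mul 6).sub ((((hasDerivAt_id x).sub_const c).pow 2).div_const 2)).congr_deriv ?_
    simp [β1]; ring
  have hβ1 : ∀ x, HasDerivAt β1 (β2 x) x := fun x => by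
    refine (((((hasDerivAt_id x).sub_const c).const_mul 6).div (hwd x) (hw0 x).ne').sub
      ((hasDerivAt_id x).sub_const c)).congr_deriv ?_
    have h1 := (hw0 x).ne'
    have h2 := hww x
    simp only [β2, id]
    have h3 : e = w x ^ 2 - (x - c) ^ 2 := by linarith
    rw [h3]
    field_simp
  have hwC : ContDiff ℝ ⊤ w := by
    apply ContDiff.sqrt
    · fun_prop
    · exact fun x => (hp x).ne'
  have hβ2C : ContDiff ℝ ⊤ β2 := by
    apply ContDiff.sub _ contDiff_const
    exact contDiff_const.div (hwC.pow 3) (fun x => (pow_pos (hw0 x) 3).ne')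
  have hβ2C' : ContDiff ℝ (1 + 1 : ℕ∞) β2 := hβ2C.of_le le_top
  have hβ2 : ∀ x, HasDerivAt β2 (deriv β2 x) x := fun x =>
    (hβ2C'.differentiable (by norm_num) x).hasDerivAt
  have hd : ContDiff ℝ (1 : ℕ∞) (deriv β2) := by
    exact (contDiff_succ_iff_deriv.1 (by exact_mod_cast hβ2C')).2.2
  have hβ3 : ∀ x, HasDerivAt (deriv β2) (deriv (deriv β2) x) x := fun x =>
    (hd.differentiable (by norm_num) x).hasDerivAt
  have hβ4 : Continuous (deriv (deriv β2)) := hd.continuous_deriv (by norm_num)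
  have hfC : ContDiff ℝ (1 + 1 : ℕ∞) f := f.contDiff
  have hχ : ∀ x, HasDerivAt f (deriv f x) x := fun x =>
    (hfC.differentiable (by norm_num) x).hasDerivAt
  have hfd : ContDiff ℝ (1 : ℕ∞) (deriv f) := by
    exact (contDiff_succ_iff_deriv.1 (by exact_mod_cast hfC)).2.2
  have hχ1 : ∀ x, HasDerivAt (deriv f) (deriv (deriv f) x) x := fun x =>
    (hfd.differentiable (by norm_num) x).hasDerivAt
  have hχ2 : Continuous (deriv (deriv f)) := hfd.continuous_deriv (by norm_num)
  have cβ : Continuous β := continuous_iff_continuousAt.2 fun x => (hβ x).continuousAt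
  have cβ1 : Continuous β1 := continuous_iff_continuousAt.2 fun x => (hβ1 x).continuousAt
  have cχ : Continuous f := f.continuous
  have cχ1 : Continuous (deriv f) := continuous_iff_continuousAt.2 fun x => (hχ1 x).continuousAt
  have cβ2 := hβ2C.continuous
  have cβ3 : Continuous (deriv β2) := continuous_iff_continuousAt.2 fun x => (hβ3 x).continuousAt
  have hcpt : IsCompact (Icc (-1 : ℝ) 1) := isCompact_Icc
  obtain ⟨B, hB⟩ := hcpt.exists_bound_of_continuousOn (f := fun x => |β x| + |β1 x| + |β2 x| +
    |deriv β2 x| + |deriv (deriv β2) x| + |f x| + |deriv f x| + |deriv (deriv f) x| + 1)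
    (by fun_prop)
  have hB' : ∀ x ∈ Icc (-1 : ℝ) 1, |β x| + |β1 x| + |β2 x| +
    |deriv β2 x| + |deriv (deriv β2) x| + |f x| + |deriv f x| + |deriv (deriv f) x| + 1 ≤ B :=
    fun x hx => (le_abs_self _).trans (hB x hx)
  have hbd : ∀ x ∈ Icc (-1 : ℝ) 1, 1 ≤ B ∧ |β x| ≤ B ∧ |β1 x| ≤ B ∧ |β2 x| ≤ B ∧
      |deriv β2 x| ≤ B ∧ |deriv (deriv β2) x| ≤ B ∧
      |f x| ≤ B ∧ |deriv f x| ≤ B ∧ |deriv (deriv f) x| ≤ B := fun x hx => by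
    have := hB' x hx
    have h1 := abs_nonneg (β x)
    have h2 := abs_nonneg (β1 x)
    have h3 := abs_nonneg (β2 x)
    have h4 := abs_nonneg (deriv β2 x)
    have h5 := abs_nonneg (deriv (deriv β2) x)
    have h6 := abs_nonneg (f x)
    have h7 := abs_nonneg (deriv f x)
    have h8 := abs_nonneg (deriv (deriv f) x)
    refine ⟨?_, ?_, ?_, ?_, ?_, ?_, ?_, ?_, ?_⟩ <;> linarith
  have hB1 : 1 ≤ B := (hbd 0 (by simp)).1
  have hxc : ∀ x ∈ Icc (-1 : ℝ) 1, |x - c| ≤ 2 := fun x hx => by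
    rw [abs_le]; constructor <;> linarith [hx.1, hx.2]
  have hw3 : ∀ x ∈ Icc (-1 : ℝ) 1, w x ≤ 3 := fun x hx => by
    have h1 := hww x
    have h2 := (sq_abs (x - c))
    nlinarith [hxc x hx, abs_nonneg (x - c), hw0 x]
  have hwabs : ∀ x, |x - c| < w x := fun x => by
    have h1 := hww x
    have h2 := (sq_abs (x - c))
    nlinarith [abs_nonneg (x - c), hw0 x]
  have hsupp : ∀ x, x ∉ Ioo a b → x ∉ tsupport f := fun x hx h => by
    rw [f.tsupport_eq, Metric.mem_closedBall, Real.dist_eq, abs_le] at h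
    have hO : f.rOut = 2 * r := rfl
    rw [hO] at h
    exact hx ⟨by linarith [h.1], by linarith [h.2]⟩
  have hsupp1 : tsupport (deriv f) ⊆ tsupport f :=
    closure_minimal (support_deriv_subset) isClosed_closure
  have hsupp2 : tsupport (deriv (deriv f)) ⊆ tsupport (deriv f) :=
    closure_minimal (support_deriv_subset) isClosed_closure
  -- Where `|x - c| ≥ r` both quantities on the right are at least `r² / 2`. Where `|x - c| ≤ r` the
  -- cutoff is `1`, the left side reduces to `-B³`, and the crude bounds on `β'` and `β''` suffice.
  have key : ∀ x ∈ Icc (-1 : ℝ) 1, r ^ 2 / 2 - (r ^ 2 / 2 + B ^ 3) * f x ≤ -β2 x ∧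
      r ^ 2 / 2 - (r ^ 2 / 2 + B ^ 3) * f x ≤ -(β2 x * β1 x ^ 2) := fun x hx => by
    have hKpos : 0 ≤ r ^ 2 / 2 + B ^ 3 := by positivity
    rcases le_total r |x - c| with h | h
    · obtain ⟨k1, k2⟩ := sqrt_weight_facts he0 hr0 le_rfl he1 (hxc x hx) h
      have k1' : β2 x ≤ -(1 / 2) := k1
      have k2' : r ^ 2 ≤ β1 x ^ 2 := k2
      have hfn : 0 ≤ (r ^ 2 / 2 + B ^ 3) * f x := mul_nonneg hKpos f.nonneg
      constructor
      · nlinarith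
      · nlinarith
    · have hf1 : f x = 1 := f.one_of_mem_closedBall (by
        rw [Metric.mem_closedBall, Real.dist_eq]; exact h)
      rw [hf1]
      obtain ⟨-, -, h1, h2, -⟩ := hbd x hx
      have h3 : β1 x ^ 2 ≤ B ^ 2 := by rw [← sq_abs]; gcongr
      have h4 : β2 x ≤ B := (le_abs_self _).trans h2
      constructor
      · nlinarith [pow_le_pow_right₀ hB1 (show 1 ≤ 3 by norm_num)]
      · have : β2 x * β1 x ^ 2 ≤ B * B ^ 2 :=
          mul_le_mul h4 h3 (sq_nonneg _) (by linarith)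
        nlinarith
  obtain ⟨x₀, hx₀, hmin⟩ := hcpt.exists_isMinOn ⟨0, by simp⟩ cβ.continuousOn
  refine ⟨{ β := β, β1 := β1, β2 := β2, β3 := deriv β2, β4 := deriv (deriv β2), χ := f,
            χ1 := deriv f, χ2 := deriv (deriv f), κ := r ^ 2 / 2, K := r ^ 2 / 2 + B ^ 3, B := B,
            m := β x₀, hβ := hβ, hβ1 := hβ1, hβ2 := hβ2, hβ3 := hβ3, hβ4 := hβ4, hχ := hχ,
            hχ1 := hχ1, hχ2 := hχ2, κ_pos := by positivity, K_nonneg := by positivity,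
            one_le_B := hB1, m_pos := ?_, m_le := fun x hx => hmin hx,
            bound := fun x hx => (hbd x hx).2, concave := fun x hx => (key x hx).1,
            concave_sq := fun x hx => (key x hx).2, χ_nonneg := fun x => f.nonneg,
            χ_zero := fun x hx => ⟨image_eq_zero_of_notMem_tsupport (hsupp x hx),
              image_eq_zero_of_notMem_tsupport fun h => hsupp x hx (hsupp1 h),
              image_eq_zero_of_notMem_tsupport fun h => hsupp x hx (hsupp1 (hsupp2 h))⟩,
            right := ?_, left := ?_ }⟩
  · have h1 := hwabs x₀
    have h2 := hxc x₀ hx₀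
    have h3 := sq_abs (x₀ - c)
    change 0 < 6 * w x₀ - (x₀ - c) ^ 2 / 2
    nlinarith [abs_nonneg (x₀ - c)]
  · change 0 ≤ 6 * (1 - c) / w 1 - (1 - c)
    have h1 := hw3 1 (by simp)
    have h2 : 0 ≤ 1 - c := by rw [hc]; linarith
    rw [sub_nonneg, le_div_iff₀ (hw0 1)]
    nlinarith
  · change 6 * (-1 - c) / w (-1) - (-1 - c) ≤ 0
    have h1 := hw3 (-1) (by simp)
    have h2 : -1 - c ≤ 0 := by rw [hc]; linarith
    rw [sub_nonpos, div_le_iff₀ (hw0 (-1))]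
    nlinarith

/-! ### The pointwise inequality in divergence form -/

/-- Smallness of the lower order coefficient in the Carleman identity. -/
theorem lower_order_bound {s s1 s2 N C B β β1 β4 V1 : ℝ} (hC : 1 ≤ C) (hB : 1 ≤ B)
    (hs : C ≤ s) (h1 : |s1| ≤ s ^ 2 / C) (h2 : |s2| ≤ 3 * s ^ 3 / C ^ 2) (hN0 : 0 ≤ N)
    (hN : N ≤ s / C) (hV1 : |V1| ≤ 2 * N ^ 2) (hβ : |β| ≤ B) (hβ1 : |β1| ≤ B) (hβ4 : |β4| ≤ B) :
    -(6 * B ^ 2 / C * s ^ 3) ≤ s * β4 / 2 + s * s1 * β1 ^ 2 + s * β1 * V1 - s2 * β / 2 := by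
  have hs0 : 0 < s := by linarith
  have hC0 : 0 < C := by linarith
  have hC2 : C ≤ C ^ 2 := by nlinarith
  have hBB : B ≤ B ^ 2 := by nlinarith
  have hs2C : s ^ 3 / C ^ 2 ≤ s ^ 3 / C := by gcongr
  have a1 : |s * β4| ≤ B ^ 2 * (s ^ 3 / C) := by
    rw [abs_mul, abs_of_pos hs0]
    have : s ≤ s ^ 3 / C := by
      rw [le_div_iff₀ hC0]
      have : C ≤ s ^ 2 := by nlinarith
      nlinarith
    have h : |β4| ≤ B ^ 2 := hβ4.trans hBB
    calc s * |β4| ≤ (s ^ 3 / C) * B ^ 2 := by gcongr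
      _ = _ := by ring
  have a2 : |s * s1 * β1 ^ 2| ≤ B ^ 2 * (s ^ 3 / C) := by
    rw [abs_mul, abs_mul, abs_of_pos hs0, abs_pow]
    calc s * |s1| * |β1| ^ 2 ≤ s * (s ^ 2 / C) * B ^ 2 := by gcongr
      _ = _ := by ring
  have a3 : |s * β1 * V1| ≤ 2 * (B ^ 2 * (s ^ 3 / C)) := by
    rw [abs_mul, abs_mul, abs_of_pos hs0]
    calc s * |β1| * |V1| ≤ s * B * (2 * N ^ 2) := by gcongr
      _ ≤ s * B ^ 2 * (2 * (s / C) ^ 2) := by gcongr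
      _ = 2 * (B ^ 2 * (s ^ 3 / C ^ 2)) := by ring
      _ ≤ _ := by gcongr
  have a4 : |s2 * β| ≤ 3 * (B ^ 2 * (s ^ 3 / C)) := by
    rw [abs_mul]
    calc |s2| * |β| ≤ (3 * s ^ 3 / C ^ 2) * B ^ 2 := by
          gcongr
          exact hβ.trans hBB
      _ = 3 * (B ^ 2 * (s ^ 3 / C ^ 2)) := by ring
      _ ≤ _ := by gcongr
  have e : 6 * B ^ 2 / C * s ^ 3 = 6 * (B ^ 2 * (s ^ 3 / C)) := by ring
  have hpos : 0 ≤ B ^ 2 * (s ^ 3 / C) := by positivity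
  rw [e]
  linarith [neg_le_of_abs_le a1, neg_le_of_abs_le a2, neg_le_of_abs_le a3, le_of_abs_le a4]

/-- The coefficient of `z²` in the localized energy identity. -/
theorem local_coefficient_bound {s s1 B β β1 χ χ1 χ2 V : ℝ} (hB : 1 ≤ B)
    (hs : 1 ≤ s) (h1 : |s1| ≤ s ^ 2) (hV : 0 ≤ V) (hβ : |β| ≤ B)
    (hβ1 : |β1| ≤ B) (hχ0 : 0 ≤ χ) (hχ : |χ| ≤ B) (hχ1 : |χ1| ≤ B) (hχ2 : |χ2| ≤ B) :
    -(3 * B ^ 3 * s ^ 3) ≤ -s1 * χ / 2 - s * χ2 / 2 + s * (s * β1 / 2) * χ1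
      + s * χ * (s1 * β / 2 - (s * β1 / 2) ^ 2 + V) := by
  have hs0 : 0 < s := by linarith
  have hB0 : 0 < B := by linarith
  have p1 : s ≤ s ^ 3 := by nlinarith [mul_nonneg hs0.le (sub_nonneg.2 hs)]
  have p2 : s ^ 2 ≤ s ^ 3 := pow_le_pow_right₀ hs (by norm_num)
  have q1 : B ≤ B ^ 3 := le_self_pow₀ hB (by norm_num)
  have q2 : B ^ 2 ≤ B ^ 3 := pow_le_pow_right₀ hB (by norm_num)
  have a1 : |s1 * χ| ≤ B ^ 3 * s ^ 3 := by
    rw [abs_mul]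
    calc |s1| * |χ| ≤ s ^ 2 * B := by gcongr
      _ ≤ s ^ 3 * B ^ 3 := by gcongr
      _ = _ := by ring
  have a2 : |s * χ2| ≤ B ^ 3 * s ^ 3 := by
    rw [abs_mul, abs_of_pos hs0]
    calc s * |χ2| ≤ s ^ 3 * B := by gcongr
      _ ≤ s ^ 3 * B ^ 3 := by gcongr
      _ = _ := by ring
  have a3 : |s * (s * β1) * χ1| ≤ B ^ 3 * s ^ 3 := by
    rw [abs_mul, abs_mul, abs_mul, abs_of_pos hs0]
    calc s * (s * |β1|) * |χ1| ≤ s * (s * B) * B := by gcongr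
      _ = s ^ 2 * B ^ 2 := by ring
      _ ≤ s ^ 3 * B ^ 3 := by gcongr
      _ = _ := by ring
  have a4 : |s * χ * (s1 * β)| ≤ B ^ 3 * s ^ 3 := by
    rw [abs_mul, abs_mul, abs_mul, abs_of_pos hs0]
    calc s * |χ| * (|s1| * |β|) ≤ s * B * (s ^ 2 * B) := by gcongr
      _ = s ^ 3 * B ^ 2 := by ring
      _ ≤ s ^ 3 * B ^ 3 := by gcongr
      _ = _ := by ring
  have a5 : |s * χ * (s * β1) ^ 2| ≤ B ^ 3 * s ^ 3 := by
    rw [abs_mul, abs_mul, abs_pow, abs_mul, abs_of_pos hs0]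
    calc s * |χ| * (s * |β1|) ^ 2 ≤ s * B * (s * B) ^ 2 := by gcongr
      _ = _ := by ring
  have a6 : 0 ≤ s * χ * V := by positivity
  have hp : 0 ≤ B ^ 3 * s ^ 3 := by positivity
  linarith [le_of_abs_le a1, le_of_abs_le a2, neg_le_of_abs_le a3, neg_le_of_abs_le a4,
    le_of_abs_le a5]

/-- The squares of the symmetric and skew-symmetric parts are simply discarded. -/
theorem two_mul_mul_le_add_sq (x y : ℝ) : 2 * (x * y) ≤ (x + y) ^ 2 := by
  nlinarith [sq_nonneg x, sq_nonneg y]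

theorem young_sq {K : ℝ} (hK : 0 ≤ K) (x y : ℝ) :
    2 * K * (x * y) ≤ K * x ^ 2 + K * y ^ 2 := by
  nlinarith [mul_nonneg hK (sq_nonneg (x - y))]

/-- The value at a point of the parameters of the Carleman estimate: the large parameter `s` with
its time derivatives, and the potential. -/
structure ParamBounds (C N s s1 s2 V V1 : ℝ) : Prop where
  one_le : 1 ≤ C
  le_s : C ≤ s
  s1_le : |s1| ≤ s ^ 2 / C
  s2_le : |s2| ≤ 3 * s ^ 3 / C ^ 2
  N_nonneg : 0 ≤ N
  N_le : N ≤ s / C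
  V_nonneg : 0 ≤ V
  V_le : V ≤ N ^ 2
  V1_le : |V1| ≤ 2 * N ^ 2

/-- The pointwise Carleman inequality, in divergence form, for the conjugated function. -/
theorem pointwise_carleman {a b : ℝ} (w : CarlemanWeight a b) {C N s s1 s2 V V1 x : ℝ}
    (hP : ParamBounds C N s s1 s2 V V1) (hC : 24 * w.B ^ 2 / w.κ ≤ C)
    (hx : x ∈ Icc (-1 : ℝ) 1) (z zx zxx zt ztx : ℝ) :
    -- time derivative of the energy
    (2 * zx * ztx
      + ((s2 * w.β x / 2 - s * s1 * w.β1 x ^ 2 / 2) * z ^ 2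
        + (s1 * w.β x / 2 - (s * w.β1 x / 2) ^ 2 + V) * (2 * z * zt))
      + w.K * w.χ x * (s1 * z ^ 2 + s * (2 * z * zt)))
    -- space derivative of the flux
    + (-2 * (zxx * zt + zx * ztx) + (s * w.β2 x * zx ^ 2 + s * w.β1 x * (2 * zx * zxx))
      + ((s * w.β3 x) * (z * zx) + (s * w.β2 x) * (zx * zx + z * zxx))
      - (s * w.β4 x / 2 * z ^ 2 + s * w.β3 x / 2 * (2 * z * zx))
      - ((s1 * w.β1 x / 2 - s ^ 2 * w.β1 x * w.β2 x / 2 + V1) * (s * w.β1 x * z ^ 2)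
        + (s1 * w.β x / 2 - (s * w.β1 x / 2) ^ 2 + V)
          * (s * w.β2 x * z ^ 2 + s * w.β1 x * (2 * z * zx)))
      + w.K * (-2 * s * (w.χ1 x * (z * zx) + w.χ x * (zx * zx + z * zxx))
        + s * (w.χ2 x * z ^ 2 + w.χ1 x * (2 * z * zx))
        - s ^ 2 * ((w.β2 x * w.χ x + w.β1 x * w.χ1 x) * z ^ 2 + w.β1 x * w.χ x * (2 * z * zx))))
    + (2 * w.κ * s * zx ^ 2 + w.κ / 4 * s ^ 3 * z ^ 2)
    ≤ (1 + w.K) * (zt - zxx - s * w.β1 x * zx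
        + (s1 * w.β x / 2 - (s * w.β1 x / 2) ^ 2 + V - s * w.β2 x / 2) * z) ^ 2
      + (Ioo a b).indicator (fun _ => 8 * w.K * w.B ^ 3 * s ^ 3 * z ^ 2) x := by
  obtain ⟨b0, b1, b2, b3, b4, c0, c1, c2⟩ := w.bound x hx
  have hB := w.one_le_B
  have hK := w.K_nonneg
  have hκ := w.κ_pos
  have hχ0 := w.χ_nonneg x
  have hcc := w.concave x hx
  have hcs := w.concave_sq x hx
  have hs1 : 1 ≤ s := hP.one_le.trans hP.le_s
  have hs0 : 0 < s := by linarith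
  have hC0 : 0 < C := by linarith [hP.one_le]
  have lo := lower_order_bound hP.one_le hB hP.le_s hP.s1_le hP.s2_le hP.N_nonneg hP.N_le hP.V1_le
    b0 b1 b4
  -- The origin of the threshold on `C`: the main coefficient of `s³ z²` is `κ / 2` up to the
  -- cutoff, and the remainders may consume half of it.
  have hκC : 6 * w.B ^ 2 / C ≤ w.κ / 4 := by
    rw [div_le_iff₀ hκ] at hC
    rw [div_le_iff₀ hC0]
    linarith
  have s1' : |s1| ≤ s ^ 2 := hP.s1_le.trans (div_le_self (sq_nonneg _) hP.one_le)
  set β := w.β x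
  set β1 := w.β1 x
  set β2 := w.β2 x
  set β3 := w.β3 x
  set β4 := w.β4 x
  set χ := w.χ x with hχdef
  set χ1 := w.χ1 x with hχ1def
  set χ2 := w.χ2 x with hχ2def
  set B := w.B
  set K := w.K
  set κ := w.κ
  -- coefficient of `z²`
  have hG : (κ / 4 - K / 2 * χ) * s ^ 3 ≤ -(s ^ 3 * β1 ^ 2 * β2 / 2)
      + (s * β4 / 2 + s * s1 * β1 ^ 2 + s * β1 * V1 - s2 * β / 2) := by
    have h1 : 6 * B ^ 2 / C * s ^ 3 ≤ κ / 4 * s ^ 3 := by gcongr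
    have h2 : (κ - K * χ) * (s ^ 3 / 2) ≤ -(β2 * β1 ^ 2) * (s ^ 3 / 2) := by gcongr
    nlinarith
  have hZ : 0 ≤ z ^ 2 := sq_nonneg z
  have hG' := mul_le_mul_of_nonneg_right hG hZ
  have hX : (κ - K * χ) * (2 * s * zx ^ 2) ≤ -β2 * (2 * s * zx ^ 2) := by gcongr
  -- localized part
  have hloc : -((Ioo a b).indicator (fun _ => 8 * K * B ^ 3 * s ^ 3 * z ^ 2) x) ≤
      2 * K * ((-s1 * χ / 2 - s * χ2 / 2 + s * (s * β1 / 2) * χ1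
        + s * χ * (s1 * β / 2 - (s * β1 / 2) ^ 2 + V)) * z ^ 2)
      - K * (s ^ 2 * χ ^ 2 * z ^ 2) - K / 2 * χ * s ^ 3 * z ^ 2 := by
    by_cases hxab : x ∈ Ioo a b
    · rw [indicator_of_mem hxab]
      have hl := local_coefficient_bound hB hs1 s1' hP.V_nonneg b0 b1 hχ0 c0 c1 c2
      have hl' := mul_le_mul_of_nonneg_left (mul_le_mul_of_nonneg_right hl hZ)
        (show 0 ≤ 2 * K by positivity)
      have hχB : χ ≤ B := (le_abs_self _).trans c0
      have q1 : B ≤ B ^ 3 := le_self_pow₀ hB (by norm_num)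
      have q2 : B ^ 2 ≤ B ^ 3 := pow_le_pow_right₀ hB (by norm_num)
      have p2 : s ^ 2 ≤ s ^ 3 := pow_le_pow_right₀ hs1 (by norm_num)
      have e1 : K * (s ^ 2 * χ ^ 2 * z ^ 2) ≤ K * (s ^ 3 * B ^ 3 * z ^ 2) := by
        have : χ ^ 2 ≤ B ^ 3 := (by gcongr : χ ^ 2 ≤ B ^ 2).trans q2
        gcongr
      have e2 : K / 2 * χ * s ^ 3 * z ^ 2 ≤ K / 2 * B ^ 3 * s ^ 3 * z ^ 2 := by
        have : χ ≤ B ^ 3 := hχB.trans q1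
        gcongr
      have e3 : 0 ≤ K * B ^ 3 * s ^ 3 * z ^ 2 := by positivity
      linarith
    · obtain ⟨h1, h2, h3⟩ := w.χ_zero x hxab
      rw [indicator_of_notMem hxab, hχdef, hχ1def, hχ2def, h1, h2, h3]
      simp
  -- the two parts of the conjugated operator
  set P1 := -zxx + (s1 * β / 2 - (s * β1 / 2) ^ 2 + V) * z with hP1
  set P2 := zt - s * β1 * zx - s * β2 / 2 * z with hP2
  have hF : zt - zxx - s * β1 * zx + (s1 * β / 2 - (s * β1 / 2) ^ 2 + V - s * β2 / 2) * z
      = P1 + P2 := by rw [hP1, hP2]; ring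
  rw [hF]
  have y1 : 2 * (P1 * P2) ≤ (P1 + P2) ^ 2 := two_mul_mul_le_add_sq P1 P2
  -- The equation tested with `K s χ z`. The gain is `2 K χ s zₓ²`, exactly what concavity lacks in
  -- `(a,b)`; the cost is a second copy of the squared operator, `K` times, and a local `z²` term.
  have y2 : 2 * K * ((P1 + P2) * (s * χ * z)) ≤ K * (P1 + P2) ^ 2 + K * (s ^ 2 * χ ^ 2 * z ^ 2) := by
    rw [show s ^ 2 * χ ^ 2 * z ^ 2 = (s * χ * z) ^ 2 by ring]
    exact young_sq hK (P1 + P2) (s * χ * z)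
  -- Two integrations by parts written as one polynomial identity in the jets of `z`, `β`, `χ`, `s`
  -- and `V`: derivative terms on the left, both multipliers and the commutator coefficients on the
  -- right.
  have id1 : (2 * zx * ztx
      + ((s2 * β / 2 - s * s1 * β1 ^ 2 / 2) * z ^ 2
        + (s1 * β / 2 - (s * β1 / 2) ^ 2 + V) * (2 * z * zt))
      + K * χ * (s1 * z ^ 2 + s * (2 * z * zt)))
    + (-2 * (zxx * zt + zx * ztx) + (s * β2 * zx ^ 2 + s * β1 * (2 * zx * zxx))
      + ((s * β3) * (z * zx) + (s * β2) * (zx * zx + z * zxx))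
      - (s * β4 / 2 * z ^ 2 + s * β3 / 2 * (2 * z * zx))
      - ((s1 * β1 / 2 - s ^ 2 * β1 * β2 / 2 + V1) * (s * β1 * z ^ 2)
        + (s1 * β / 2 - (s * β1 / 2) ^ 2 + V)
          * (s * β2 * z ^ 2 + s * β1 * (2 * z * zx)))
      + K * (-2 * s * (χ1 * (z * zx) + χ * (zx * zx + z * zxx))
        + s * (χ2 * z ^ 2 + χ1 * (2 * z * zx))
        - s ^ 2 * ((β2 * χ + β1 * χ1) * z ^ 2 + β1 * χ * (2 * z * zx))))
     = 2 * (P1 * P2) + 2 * K * ((P1 + P2) * (s * χ * z)) + β2 * (2 * s * zx ^ 2)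
      - (-(s ^ 3 * β1 ^ 2 * β2 / 2)
      + (s * β4 / 2 + s * s1 * β1 ^ 2 + s * β1 * V1 - s2 * β / 2)) * z ^ 2
      - 2 * K * χ * s * zx ^ 2
      - 2 * K * ((-s1 * χ / 2 - s * χ2 / 2 + s * (s * β1 / 2) * χ1
        + s * χ * (s1 * β / 2 - (s * β1 / 2) ^ 2 + V)) * z ^ 2) := by
    rw [hP1, hP2]; ring
  rw [id1]
  linarith

/-! ### Integration over a rectangle -/

/-- Lebesgue measure on the rectangle `(t₀,t₁) × (-1,1)`. -/
abbrev rectMeasure (t₀ t₁ : ℝ) : Measure (ℝ × ℝ) := (volume.restrict (Ioo t₀ t₁)).prod muI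

theorem integrable_rectMeasure {t₀ t₁ : ℝ} {E : Type*} [NormedAddCommGroup E] {k : ℝ × ℝ → E}
    (hk : ContinuousOn k (Icc t₀ t₁ ×ˢ univ)) : Integrable k (rectMeasure t₀ t₁) := by
  rw [rectMeasure, muI, Measure.prod_restrict]
  have h : IntegrableOn k (Icc t₀ t₁ ×ˢ Icc (-1 : ℝ) 1) (volume.prod volume) :=
    (hk.mono (prod_mono le_rfl (subset_univ _))).integrableOn_compact (isCompact_Icc.prod isCompact_Icc)
  exact h.mono_set (prod_mono Ioo_subset_Icc_self Ioo_subset_Icc_self)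

theorem integrable_muI {E : Type*} [NormedAddCommGroup E] {k : ℝ → E} (hk : Continuous k) :
    Integrable k muI :=
  (hk.continuousOn.integrableOn_compact (isCompact_Icc (a := (-1 : ℝ)) (b := 1))).mono_set
    Ioo_subset_Icc_self

theorem integral_Ioo_eq_sub {E : Type*} [NormedAddCommGroup E] [NormedSpace ℝ E] [CompleteSpace E]
    {a b : ℝ} (hab : a ≤ b) {f f' : ℝ → E} (hf : ∀ x ∈ Icc a b, HasDerivAt f (f' x) x)
    (hc : ContinuousOn f' (Icc a b)) : ∫ x in Ioo a b, f' x = f b - f a := by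
  rw [← integral_Ioc_eq_integral_Ioo, ← intervalIntegral.integral_of_le hab]
  refine intervalIntegral.integral_eq_sub_of_hasDerivAt (by rwa [uIcc_of_le hab]) ?_
  exact ContinuousOn.intervalIntegrable (by rwa [uIcc_of_le hab])

/-- Integration of a differential inequality in divergence form over a rectangle. -/
theorem integral_divergence_le {t₀ t₁ : ℝ} (ht : t₀ ≤ t₁) {Q Qt R Rx : ℝ → ℝ → ℝ}
    {k h : ℝ × ℝ → ℝ}
    (hQ : ∀ t ∈ Icc t₀ t₁, ∀ x, HasDerivAt (fun τ => Q τ x) (Qt t x) t)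
    (hR : ∀ t ∈ Icc t₀ t₁, ∀ x, HasDerivAt (R t) (Rx t x) x)
    (hQt : ContinuousOn (fun q : ℝ × ℝ => Qt q.1 q.2) (Icc t₀ t₁ ×ˢ univ))
    (hRx : ContinuousOn (fun q : ℝ × ℝ => Rx q.1 q.2) (Icc t₀ t₁ ×ˢ univ))
    (hQc : ∀ t ∈ Icc t₀ t₁, Continuous (Q t))
    (hk : Integrable k (rectMeasure t₀ t₁)) (hh : Integrable h (rectMeasure t₀ t₁))
    (hbd : ∀ t ∈ Icc t₀ t₁, R t (-1) ≤ R t 1)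
    (hle : ∀ t ∈ Icc t₀ t₁, ∀ x ∈ Icc (-1 : ℝ) 1, Qt t x + Rx t x + k (t, x) ≤ h (t, x)) :
    ∫ q, k q ∂rectMeasure t₀ t₁ ≤
      ∫ q, h q ∂rectMeasure t₀ t₁ + ∫ x, Q t₀ x ∂muI - ∫ x, Q t₁ x ∂muI := by
  have iQ := integrable_rectMeasure hQt
  have iR := integrable_rectMeasure hRx
  have e1 : ∫ q, Qt q.1 q.2 ∂rectMeasure t₀ t₁ = ∫ x, Q t₁ x ∂muI - ∫ x, Q t₀ x ∂muI := by
    rw [integral_prod_symm _ iQ, ← integral_sub (integrable_muI (hQc _ ⟨ht, le_rfl⟩))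
      (integrable_muI (hQc _ ⟨le_rfl, ht⟩))]
    refine integral_congr_ae (ae_of_all _ fun x => ?_)
    refine integral_Ioo_eq_sub ht (f := fun τ => Q τ x) (fun t h => hQ t h x) ?_
    exact hQt.comp (f := fun t => (t, x)) (by fun_prop) (fun t h => ⟨h, mem_univ _⟩)
  -- The space derivative integrates to the difference of the fluxes at `±1`, which has a sign by
  -- `hbd` and can be dropped.
  have e2 : 0 ≤ ∫ q, Rx q.1 q.2 ∂rectMeasure t₀ t₁ := by
    rw [integral_prod _ iR]
    refine setIntegral_nonneg measurableSet_Ioo fun t h => ?_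
    have h' := Ioo_subset_Icc_self h
    have : ∫ x, Rx t x ∂muI = R t 1 - R t (-1) := by
      refine integral_Ioo_eq_sub (by norm_num) (fun x _ => hR t h' x) ?_
      exact hRx.comp (f := fun x => (t, x)) (by fun_prop) (fun x _ => ⟨h', mem_univ _⟩)
    simp only
    rw [this]
    linarith [hbd t h']
  have e3 : ∫ q, (Qt q.1 q.2 + Rx q.1 q.2 + k q) ∂rectMeasure t₀ t₁ ≤
      ∫ q, h q ∂rectMeasure t₀ t₁ := by
    refine integral_mono_ae ((iQ.add iR).add hk) hh ?_
    rw [rectMeasure, muI, Measure.prod_restrict]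
    refine (ae_restrict_iff' (measurableSet_Ioo.prod measurableSet_Ioo)).2 (ae_of_all _ ?_)
    rintro ⟨t, x⟩ ⟨h1, h2⟩
    exact hle t (Ioo_subset_Icc_self h1) x (Ioo_subset_Icc_self h2)
  have e4 : ∫ q, (Qt q.1 q.2 + Rx q.1 q.2 + k q) ∂rectMeasure t₀ t₁ =
      ∫ q, Qt q.1 q.2 ∂rectMeasure t₀ t₁ + ∫ q, Rx q.1 q.2 ∂rectMeasure t₀ t₁
        + ∫ q, k q ∂rectMeasure t₀ t₁ := by
    have h1 := integral_add (iQ.add iR) hk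
    have h2 := integral_add iQ iR
    simp only [Pi.add_apply] at h1
    rw [h1, h2]
  linarith

/-! ### The conjugated function, its energy and its flux -/

/-- A real function on the strip, `C¹` in time and `C²` in space, vanishing at `x = ±1`. -/
structure StripFunction where
  (u ux uxx ut utx : ℝ → ℝ → ℝ)
  hx : ∀ t x, HasDerivAt (u t) (ux t x) x
  hxx : ∀ t x, HasDerivAt (ux t) (uxx t x) x
  htx : ∀ t x, HasDerivAt (ut t) (utx t x) x
  ht : ∀ t x, HasDerivAt (fun τ => u τ x) (ut t x) t
  hxt : ∀ t x, HasDerivAt (fun τ => ux τ x) (utx t x) t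
  cu : Continuous fun q : ℝ × ℝ => u q.1 q.2
  cux : Continuous fun q : ℝ × ℝ => ux q.1 q.2
  cuxx : Continuous fun q : ℝ × ℝ => uxx q.1 q.2
  cut : Continuous fun q : ℝ × ℝ => ut q.1 q.2
  cutx : Continuous fun q : ℝ × ℝ => utx q.1 q.2
  right : ∀ t, u t 1 = 0
  left : ∀ t, u t (-1) = 0
  t_right : ∀ t, ut t 1 = 0
  t_left : ∀ t, ut t (-1) = 0

/-- The parameters of the Carleman estimate on the time interval `[t₀,t₁]`. -/
structure StripParam (C t₀ t₁ : ℝ) where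
  (s s1 s2 V V1 : ℝ → ℝ)
  N : ℝ
  hs : ∀ t ∈ Icc t₀ t₁, HasDerivAt s (s1 t) t
  hs1 : ∀ t ∈ Icc t₀ t₁, HasDerivAt s1 (s2 t) t
  hs2 : ContinuousOn s2 (Icc t₀ t₁)
  hV : ∀ x, HasDerivAt V (V1 x) x
  hV1 : Continuous V1
  bounds : ∀ t ∈ Icc t₀ t₁, ∀ x ∈ Icc (-1 : ℝ) 1, ParamBounds C N (s t) (s1 t) (s2 t) (V x) (V1 x)

namespace StripFunction

variable {a b : ℝ} (w : CarlemanWeight a b) {C t₀ t₁ : ℝ} (P : StripParam C t₀ t₁)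
  (U : StripFunction)

/-- The square root of the Carleman weight. -/
def E (t x : ℝ) : ℝ := Real.exp (-(P.s t * w.β x) / 2)
/-- The conjugated function. -/
def z (t x : ℝ) : ℝ := E w P t x * U.u t x
/-- Its space derivative. -/
def zx (t x : ℝ) : ℝ := E w P t x * (U.ux t x - P.s t * w.β1 x / 2 * U.u t x)
/-- Its second space derivative. -/
def zxx (t x : ℝ) : ℝ := E w P t x * (U.uxx t x - P.s t * w.β1 x * U.ux t x
  + ((P.s t * w.β1 x / 2) ^ 2 - P.s t * w.β2 x / 2) * U.u t x)
/-- Its time derivative. -/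
def zt (t x : ℝ) : ℝ := E w P t x * (U.ut t x - P.s1 t * w.β x / 2 * U.u t x)
/-- Its mixed derivative. -/
def ztx (t x : ℝ) : ℝ := E w P t x * (U.utx t x - P.s t * w.β1 x / 2 * U.ut t x
  - P.s1 t * w.β x / 2 * U.ux t x
  + (P.s1 t * w.β x / 2 * (P.s t * w.β1 x / 2) - P.s1 t * w.β1 x / 2) * U.u t x)

theorem hasDerivAt_E_x (t x : ℝ) :
    HasDerivAt (E w P t) (E w P t x * (-(P.s t * w.β1 x / 2))) x := by
  refine (((((w.hβ x).const_mul (P.s t)).neg).div_const 2).exp).congr_deriv ?_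
  simp only [E, Pi.neg_apply]
  ring

theorem hasDerivAt_E_t {t : ℝ} (h : t ∈ Icc t₀ t₁) (x : ℝ) :
    HasDerivAt (fun τ => E w P τ x) (E w P t x * (-(P.s1 t * w.β x / 2))) t := by
  refine (((((P.hs t h).mul_const (w.β x)).neg).div_const 2).exp).congr_deriv ?_
  simp only [E, Pi.neg_apply]
  ring

theorem hasDerivAt_z_x (t x : ℝ) : HasDerivAt (z w P U t) (zx w P U t x) x := by
  refine ((hasDerivAt_E_x w P t x).mul (U.hx t x)).congr_deriv ?_
  simp only [zx]; ring

theorem hasDerivAt_zx_x (t x : ℝ) : HasDerivAt (zx w P U t) (zxx w P U t x) x := by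
  refine ((hasDerivAt_E_x w P t x).mul ((U.hxx t x).sub
    ((((w.hβ1 x).const_mul (P.s t)).div_const 2).mul (U.hx t x)))).congr_deriv ?_
  simp only [zxx, Pi.mul_apply, Pi.sub_apply]; ring

theorem hasDerivAt_zt_x (t x : ℝ) : HasDerivAt (zt w P U t) (ztx w P U t x) x := by
  refine ((hasDerivAt_E_x w P t x).mul ((U.htx t x).sub
    ((((w.hβ x).const_mul (P.s1 t)).div_const 2).mul (U.hx t x)))).congr_deriv ?_
  simp only [ztx, Pi.mul_apply, Pi.sub_apply]; ring

theorem hasDerivAt_z_t {t : ℝ} (h : t ∈ Icc t₀ t₁) (x : ℝ) :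
    HasDerivAt (fun τ => z w P U τ x) (zt w P U t x) t := by
  refine ((hasDerivAt_E_t w P h x).mul (U.ht t x)).congr_deriv ?_
  simp only [zt]; ring

theorem hasDerivAt_zx_t {t : ℝ} (h : t ∈ Icc t₀ t₁) (x : ℝ) :
    HasDerivAt (fun τ => zx w P U τ x) (ztx w P U t x) t := by
  refine ((hasDerivAt_E_t w P h x).mul ((U.hxt t x).sub
    ((((P.hs t h).mul_const (w.β1 x)).div_const 2).mul (U.ht t x)))).congr_deriv ?_
  simp only [ztx, Pi.mul_apply, Pi.sub_apply]; ring

/-- The potential of the self-adjoint part of the conjugated operator. -/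
def A (t x : ℝ) : ℝ := P.s1 t * w.β x / 2 - (P.s t * w.β1 x / 2) ^ 2 + P.V x

/-- The energy density. -/
def Q (t x : ℝ) : ℝ := zx w P U t x ^ 2 + A w P t x * z w P U t x ^ 2
  + w.K * w.χ x * (P.s t * z w P U t x ^ 2)

/-- Its time derivative. -/
def Qt (t x : ℝ) : ℝ := 2 * zx w P U t x * ztx w P U t x
  + ((P.s2 t * w.β x / 2 - P.s t * P.s1 t * w.β1 x ^ 2 / 2) * z w P U t x ^ 2
    + A w P t x * (2 * z w P U t x * zt w P U t x))
  + w.K * w.χ x * (P.s1 t * z w P U t x ^ 2 + P.s t * (2 * z w P U t x * zt w P U t x))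

/-- The flux. -/
def R (t x : ℝ) : ℝ := -2 * (zx w P U t x * zt w P U t x) + P.s t * w.β1 x * zx w P U t x ^ 2
  + P.s t * w.β2 x * (z w P U t x * zx w P U t x) - P.s t * w.β3 x / 2 * z w P U t x ^ 2
  - A w P t x * (P.s t * w.β1 x * z w P U t x ^ 2)
  + w.K * (-2 * P.s t * (w.χ x * (z w P U t x * zx w P U t x))
    + P.s t * (w.χ1 x * z w P U t x ^ 2) - P.s t ^ 2 * (w.β1 x * w.χ x * z w P U t x ^ 2))

/-- Its space derivative. -/
def Rx (t x : ℝ) : ℝ := -2 * (zxx w P U t x * zt w P U t x + zx w P U t x * ztx w P U t x)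
  + (P.s t * w.β2 x * zx w P U t x ^ 2
    + P.s t * w.β1 x * (2 * zx w P U t x * zxx w P U t x))
  + ((P.s t * w.β3 x) * (z w P U t x * zx w P U t x)
    + (P.s t * w.β2 x) * (zx w P U t x * zx w P U t x + z w P U t x * zxx w P U t x))
  - (P.s t * w.β4 x / 2 * z w P U t x ^ 2
    + P.s t * w.β3 x / 2 * (2 * z w P U t x * zx w P U t x))
  - ((P.s1 t * w.β1 x / 2 - P.s t ^ 2 * w.β1 x * w.β2 x / 2 + P.V1 x)
      * (P.s t * w.β1 x * z w P U t x ^ 2)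
    + A w P t x * (P.s t * w.β2 x * z w P U t x ^ 2
      + P.s t * w.β1 x * (2 * z w P U t x * zx w P U t x)))
  + w.K * (-2 * P.s t * (w.χ1 x * (z w P U t x * zx w P U t x)
      + w.χ x * (zx w P U t x * zx w P U t x + z w P U t x * zxx w P U t x))
    + P.s t * (w.χ2 x * z w P U t x ^ 2 + w.χ1 x * (2 * z w P U t x * zx w P U t x))
    - P.s t ^ 2 * ((w.β2 x * w.χ x + w.β1 x * w.χ1 x) * z w P U t x ^ 2
      + w.β1 x * w.χ x * (2 * z w P U t x * zx w P U t x)))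

theorem hasDerivAt_A_x (t x : ℝ) : HasDerivAt (A w P t)
    (P.s1 t * w.β1 x / 2 - P.s t ^ 2 * w.β1 x * w.β2 x / 2 + P.V1 x) x := by
  refine (((((w.hβ x).const_mul (P.s1 t)).div_const 2).sub
    ((((w.hβ1 x).const_mul (P.s t)).div_const 2).pow 2)).add (P.hV x)).congr_deriv ?_
  push_cast
  ring

theorem hasDerivAt_A_t {t : ℝ} (h : t ∈ Icc t₀ t₁) (x : ℝ) : HasDerivAt (fun τ => A w P τ x)
    (P.s2 t * w.β x / 2 - P.s t * P.s1 t * w.β1 x ^ 2 / 2) t := by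
  refine (((((P.hs1 t h).mul_const (w.β x)).div_const 2).sub
    ((((P.hs t h).mul_const (w.β1 x)).div_const 2).pow 2)).add_const (P.V x)).congr_deriv ?_
  push_cast
  ring

theorem hasDerivAt_Q {t : ℝ} (h : t ∈ Icc t₀ t₁) (x : ℝ) :
    HasDerivAt (fun τ => Q w P U τ x) (Qt w P U t x) t := by
  have hz := hasDerivAt_z_t w P U h x
  have hzx := hasDerivAt_zx_t w P U h x
  refine (((hzx.pow 2).add ((hasDerivAt_A_t w P h x).mul (hz.pow 2))).add
    (((P.hs t h).mul (hz.pow 2)).const_mul (w.K * w.χ x))).congr_deriv ?_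
  simp only [Qt, Pi.pow_apply]
  push_cast
  ring

theorem hasDerivAt_R (t x : ℝ) : HasDerivAt (R w P U t) (Rx w P U t x) x := by
  have hz := hasDerivAt_z_x w P U t x
  have hzx := hasDerivAt_zx_x w P U t x
  have hzt := hasDerivAt_zt_x w P U t x
  have hA := hasDerivAt_A_x w P t x
  refine (((((((hzx.mul hzt).const_mul (-2)).add
    (((w.hβ1 x).const_mul (P.s t)).mul (hzx.pow 2))).add
    (((w.hβ2 x).const_mul (P.s t)).mul (hz.mul hzx))).sub
    ((((w.hβ3 x).const_mul (P.s t)).div_const 2).mul (hz.pow 2))).sub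
    (hA.mul (((w.hβ1 x).const_mul (P.s t)).mul (hz.pow 2)))).add
    ((((((w.hχ x).mul (hz.mul hzx)).const_mul (-2 * P.s t)).add
      (((w.hχ1 x).mul (hz.pow 2)).const_mul (P.s t))).sub
      ((((w.hβ1 x).mul (w.hχ x)).mul (hz.pow 2)).const_mul (P.s t ^ 2))).const_mul w.K)).congr_deriv ?_
  simp only [Rx, Pi.pow_apply, Pi.mul_apply]
  push_cast
  ring

end StripFunction

theorem CarlemanWeight.continuous {a b : ℝ} (w : CarlemanWeight a b) :
    Continuous w.β ∧ Continuous w.β1 ∧ Continuous w.β2 ∧ Continuous w.β3 ∧ Continuous w.χ ∧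
      Continuous w.χ1 :=
  ⟨continuous_iff_continuousAt.2 fun x => (w.hβ x).continuousAt,
    continuous_iff_continuousAt.2 fun x => (w.hβ1 x).continuousAt,
    continuous_iff_continuousAt.2 fun x => (w.hβ2 x).continuousAt,
    continuous_iff_continuousAt.2 fun x => (w.hβ3 x).continuousAt,
    continuous_iff_continuousAt.2 fun x => (w.hχ x).continuousAt,
    continuous_iff_continuousAt.2 fun x => (w.hχ1 x).continuousAt⟩

/-- Undoes the conjugation in the gradient: with `X = zₓ` and `Z = z`, the sum `X + s β' Z / 2` is
the weighted gradient of the original function. The factor `1 + B²` pays for the term `s β' Z / 2`,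
which is controlled by `s³ Z²`. -/
theorem gradient_term_le {κ B s β1 : ℝ} (hκ : 0 < κ) (hs : 1 ≤ s) (hβ : β1 ^ 2 ≤ B ^ 2)
    (X Z : ℝ) : κ / (4 * (1 + B ^ 2)) * (s * (X + s * β1 / 2 * Z) ^ 2 + s ^ 3 * Z ^ 2) ≤
      2 * κ * s * X ^ 2 + κ / 4 * s ^ 3 * Z ^ 2 := by
  have h1 : (X + s * β1 / 2 * Z) ^ 2 ≤ 2 * X ^ 2 + s ^ 2 * B ^ 2 / 2 * Z ^ 2 := by
    have h2 := add_sq_le (a := X) (b := s * β1 / 2 * Z)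
    have h3 : s ^ 2 * β1 ^ 2 / 2 * Z ^ 2 ≤ s ^ 2 * B ^ 2 / 2 * Z ^ 2 := by gcongr
    nlinarith
  have h4 : s * (X + s * β1 / 2 * Z) ^ 2 + s ^ 3 * Z ^ 2 ≤
      (1 + B ^ 2) * (8 * s * X ^ 2 + s ^ 3 * Z ^ 2) := by
    have h5 : s * (X + s * β1 / 2 * Z) ^ 2 ≤ s * (2 * X ^ 2 + s ^ 2 * B ^ 2 / 2 * Z ^ 2) := by
      gcongr
    have h6 : 0 ≤ s * X ^ 2 := by positivity
    have h7 : 0 ≤ B ^ 2 * (s * X ^ 2) := by positivity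
    have h8 : 0 ≤ B ^ 2 * (s ^ 3 * Z ^ 2) := by positivity
    linarith
  rw [div_mul_eq_mul_div, div_le_iff₀ (by positivity)]
  have h9 := mul_le_mul_of_nonneg_left h4 hκ.le
  linarith

namespace StripFunction

variable {a b : ℝ} (w : CarlemanWeight a b) {C t₀ t₁ : ℝ} (P : StripParam C t₀ t₁)
  (U : StripFunction)

theorem continuousOn_param : ContinuousOn (fun q : ℝ × ℝ => P.s q.1) (Icc t₀ t₁ ×ˢ univ) ∧
    ContinuousOn (fun q : ℝ × ℝ => P.s1 q.1) (Icc t₀ t₁ ×ˢ univ) ∧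
    ContinuousOn (fun q : ℝ × ℝ => P.s2 q.1) (Icc t₀ t₁ ×ˢ univ) := by
  have hm : MapsTo (Prod.fst : ℝ × ℝ → ℝ) (Icc t₀ t₁ ×ˢ univ) (Icc t₀ t₁) := fun q h => h.1
  refine ⟨?_, ?_, ?_⟩
  · exact ContinuousOn.comp (g := P.s) (fun t h => (P.hs t h).continuousAt.continuousWithinAt)
      continuousOn_fst hm
  · exact ContinuousOn.comp (g := P.s1) (fun t h => (P.hs1 t h).continuousAt.continuousWithinAt)
      continuousOn_fst hm
  · exact ContinuousOn.comp (g := P.s2) P.hs2 continuousOn_fst hm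

theorem continuousOn_E : ContinuousOn (fun q : ℝ × ℝ => E w P q.1 q.2) (Icc t₀ t₁ ×ˢ univ) := by
  obtain ⟨h1, -, -⟩ := continuousOn_param P
  have := w.continuous.1
  unfold E
  fun_prop

theorem continuousOn_Qt_Rx :
    ContinuousOn (fun q : ℝ × ℝ => Qt w P U q.1 q.2) (Icc t₀ t₁ ×ˢ univ) ∧
    ContinuousOn (fun q : ℝ × ℝ => Rx w P U q.1 q.2) (Icc t₀ t₁ ×ˢ univ) := by
  obtain ⟨h1, h2, h3⟩ := continuousOn_param P
  obtain ⟨b0, b1, b2, b3, c0, c1⟩ := w.continuous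
  have b4 := w.hβ4
  have c2 := w.hχ2
  have hE := continuousOn_E w P
  have hV : Continuous P.V := continuous_iff_continuousAt.2 fun x => (P.hV x).continuousAt
  have hV1 := P.hV1
  have hu := U.cu
  have hux := U.cux
  have huxx := U.cuxx
  have hut := U.cut
  have hutx := U.cutx
  have hz : ContinuousOn (fun q : ℝ × ℝ => z w P U q.1 q.2) (Icc t₀ t₁ ×ˢ univ) := by
    unfold z; fun_prop
  have hzx : ContinuousOn (fun q : ℝ × ℝ => zx w P U q.1 q.2) (Icc t₀ t₁ ×ˢ univ) := by
    unfold zx; fun_prop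
  have hzxx : ContinuousOn (fun q : ℝ × ℝ => zxx w P U q.1 q.2) (Icc t₀ t₁ ×ˢ univ) := by
    unfold zxx; fun_prop
  have hzt : ContinuousOn (fun q : ℝ × ℝ => zt w P U q.1 q.2) (Icc t₀ t₁ ×ˢ univ) := by
    unfold zt; fun_prop
  have hztx : ContinuousOn (fun q : ℝ × ℝ => ztx w P U q.1 q.2) (Icc t₀ t₁ ×ˢ univ) := by
    unfold ztx; fun_prop
  have hA : ContinuousOn (fun q : ℝ × ℝ => A w P q.1 q.2) (Icc t₀ t₁ ×ˢ univ) := by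
    unfold A; fun_prop
  constructor
  · unfold Qt; fun_prop
  · unfold Rx; fun_prop

theorem continuous_Q (t : ℝ) : Continuous (Q w P U t) := by
  have h1 : Continuous (z w P U t) :=
    continuous_iff_continuousAt.2 fun x => (hasDerivAt_z_x w P U t x).continuousAt
  have h2 : Continuous (zx w P U t) :=
    continuous_iff_continuousAt.2 fun x => (hasDerivAt_zx_x w P U t x).continuousAt
  have h3 : Continuous (A w P t) :=
    continuous_iff_continuousAt.2 fun x => (hasDerivAt_A_x w P t x).continuousAt
  have h4 := w.continuous.2.2.2.2.1
  unfold Q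
  fun_prop

/-- The Dirichlet condition kills `z` and `zₜ` at `±1`, so that the flux there is just `s β' zₓ²`.
Its signs are those of `β'`: nonpositive at `-1`, nonnegative at `1`. -/
theorem R_left_le_right {t : ℝ} (h : t ∈ Icc t₀ t₁) : R w P U t (-1) ≤ R w P U t 1 := by
  have hB := P.bounds t h 0 (by simp)
  have hs : 0 ≤ P.s t := by linarith [hB.one_le, hB.le_s]
  have z1 : ∀ x, U.u t x = 0 → z w P U t x = 0 := fun x hx => by simp [z, hx]
  have zt1 : ∀ x, U.u t x = 0 → U.ut t x = 0 → zt w P U t x = 0 := fun x hx hx' => by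
    simp [zt, hx, hx']
  simp only [R, z1 _ (U.left t), z1 _ (U.right t), zt1 _ (U.left t) (U.t_left t),
    zt1 _ (U.right t) (U.t_right t)]
  have h1 : P.s t * w.β1 (-1) * zx w P U t (-1) ^ 2 ≤ 0 := by
    have := mul_nonneg hs (sq_nonneg (zx w P U t (-1)))
    nlinarith [w.left]
  have h2 : 0 ≤ P.s t * w.β1 1 * zx w P U t 1 ^ 2 := by
    have := mul_nonneg hs (sq_nonneg (zx w P U t 1))
    nlinarith [w.right]
  norm_num
  linarith

theorem E_sq (t x : ℝ) : E w P t x ^ 2 = Real.exp (-(P.s t * w.β x)) := by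
  rw [E, ← Real.exp_nat_mul]
  congr 1
  push_cast
  ring

/-- `pointwise_carleman` rewritten for the original function: the conjugated operator applied to `z`
is `E` times the parabolic operator applied to `u`, and `E²` is the Carleman weight. -/
theorem pointwise_le (hC : 24 * w.B ^ 2 / w.κ ≤ C) {t : ℝ} (ht : t ∈ Icc t₀ t₁) {x : ℝ}
    (hx : x ∈ Icc (-1 : ℝ) 1) :
    Qt w P U t x + Rx w P U t x + w.κ / (4 * (1 + w.B ^ 2)) *
      ((P.s t * U.ux t x ^ 2 + P.s t ^ 3 * U.u t x ^ 2) * Real.exp (-(P.s t * w.β x)))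
    ≤ (1 + w.K) * ((U.ut t x - U.uxx t x + P.V x * U.u t x) ^ 2 * Real.exp (-(P.s t * w.β x)))
      + (Ioo a b).indicator (fun _ => 8 * w.K * w.B ^ 3 *
        (P.s t ^ 3 * U.u t x ^ 2 * Real.exp (-(P.s t * w.β x)))) x := by
  have hP := P.bounds t ht x hx
  have key := pointwise_carleman w hP hC hx (z w P U t x) (zx w P U t x) (zxx w P U t x)
    (zt w P U t x) (ztx w P U t x)
  have hF : zt w P U t x - zxx w P U t x - P.s t * w.β1 x * zx w P U t x
      + (P.s1 t * w.β x / 2 - (P.s t * w.β1 x / 2) ^ 2 + P.V x - P.s t * w.β2 x / 2)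
        * z w P U t x = E w P t x * (U.ut t x - U.uxx t x + P.V x * U.u t x) := by
    simp only [z, zx, zxx, zt]
    ring
  have hz3 : P.s t ^ 3 * z w P U t x ^ 2 = P.s t ^ 3 * U.u t x ^ 2 * E w P t x ^ 2 := by
    simp only [z]; ring
  have hs : 1 ≤ P.s t := hP.one_le.trans hP.le_s
  have hκ := w.κ_pos
  have hgrad : w.κ / (4 * (1 + w.B ^ 2)) *
      ((P.s t * U.ux t x ^ 2 + P.s t ^ 3 * U.u t x ^ 2) * E w P t x ^ 2) ≤
      2 * w.κ * P.s t * zx w P U t x ^ 2 + w.κ / 4 * P.s t ^ 3 * z w P U t x ^ 2 := by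
    have e1 : E w P t x * U.ux t x = zx w P U t x + P.s t * w.β1 x / 2 * z w P U t x := by
      simp only [z, zx]; ring
    have e2 : (P.s t * U.ux t x ^ 2 + P.s t ^ 3 * U.u t x ^ 2) * E w P t x ^ 2
        = P.s t * (E w P t x * U.ux t x) ^ 2 + P.s t ^ 3 * z w P U t x ^ 2 := by
      simp only [z]; ring
    rw [e2, e1]
    have hβ1 : w.β1 x ^ 2 ≤ w.B ^ 2 := by
      rw [← sq_abs]
      have := (w.bound x hx).2.1
      gcongr
    exact gradient_term_le hκ hs hβ1 _ _
  rw [hF] at key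
  simp only [← E_sq w P]
  have hind : (Ioo a b).indicator (fun _ => 8 * w.K * w.B ^ 3 * P.s t ^ 3 * z w P U t x ^ 2) x =
      (Ioo a b).indicator (fun _ => 8 * w.K * w.B ^ 3 *
        (P.s t ^ 3 * U.u t x ^ 2 * E w P t x ^ 2)) x := by
    congr 1
    funext _
    rw [← hz3]
    ring
  rw [hind] at key
  have e3 : (E w P t x * (U.ut t x - U.uxx t x + P.V x * U.u t x)) ^ 2 =
    (U.ut t x - U.uxx t x + P.V x * U.u t x) ^ 2 * E w P t x ^ 2 := by ring
  rw [e3] at key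
  unfold Qt Rx A
  linarith

/-- The constant in the bound of the boundary terms in time. -/
def _root_.HeatCarleman.CarlemanWeight.D : ℝ := 4 + w.B + w.B ^ 2 + w.K * w.B

/-- Both bounds use `exp (-s β) ≤ exp (-s m)` and bound the powers of `s` by `s³`. The second is
free of `uₓ` because `zₓ²` enters `-Q` with a favourable sign; no gradient is therefore needed at
the final time of a strip. -/
theorem boundary_le {t : ℝ} (ht : t ∈ Icc t₀ t₁) {x : ℝ} (hx : x ∈ Icc (-1 : ℝ) 1) :
    Q w P U t x ≤ w.D * (P.s t ^ 3 * Real.exp (-(P.s t * w.m)))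
        * (U.ux t x ^ 2 + U.u t x ^ 2) ∧
    -Q w P U t x ≤ w.D * (P.s t ^ 3 * Real.exp (-(P.s t * w.m))) * U.u t x ^ 2 := by
  have hP := P.bounds t ht x hx
  have hs : 1 ≤ P.s t := hP.one_le.trans hP.le_s
  have hC0 : 0 < C := by linarith [hP.one_le]
  obtain ⟨b0, b1, -, -, -, c0, -, -⟩ := w.bound x hx
  have hB := w.one_le_B
  have hK := w.K_nonneg
  have hχ := w.χ_nonneg x
  have s1' : |P.s1 t| ≤ P.s t ^ 2 := hP.s1_le.trans (div_le_self (sq_nonneg _) hP.one_le)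
  have hV : P.V x ≤ P.s t ^ 2 := by
    have h1 : P.N ≤ P.s t := hP.N_le.trans (div_le_self (by linarith) hP.one_le)
    have := hP.N_nonneg
    exact hP.V_le.trans (by gcongr)
  have hβ1 : w.β1 x ^ 2 ≤ w.B ^ 2 := by
    rw [← sq_abs]; gcongr
  have hsβ : |P.s1 t * w.β x| ≤ P.s t ^ 2 * w.B := by rw [abs_mul]; gcongr
  have hp2 : P.s t ^ 2 ≤ P.s t ^ 3 := pow_le_pow_right₀ hs (by norm_num)
  have hp1 : P.s t ≤ P.s t ^ 3 := le_self_pow₀ hs (by norm_num)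
  have hp0 : 1 ≤ P.s t ^ 3 := one_le_pow₀ hs
  have hsβ1 : (P.s t * w.β1 x / 2) ^ 2 ≤ P.s t ^ 2 * w.B ^ 2 / 4 := by
    have : P.s t ^ 2 * w.β1 x ^ 2 ≤ P.s t ^ 2 * w.B ^ 2 := by gcongr
    nlinarith
  have hE : E w P t x ^ 2 ≤ Real.exp (-(P.s t * w.m)) := by
    rw [E_sq]
    have := w.m_le x hx
    gcongr
  have hE0 : 0 ≤ E w P t x ^ 2 := sq_nonneg _
  have hzx : zx w P U t x ^ 2 ≤ E w P t x ^ 2 *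
      (2 * U.ux t x ^ 2 + P.s t ^ 2 * w.B ^ 2 / 2 * U.u t x ^ 2) := by
    rw [zx, mul_pow]
    have h2 := add_sq_le (a := U.ux t x) (b := -(P.s t * w.β1 x / 2 * U.u t x))
    have h3 : (P.s t * w.β1 x / 2) ^ 2 * U.u t x ^ 2 ≤ P.s t ^ 2 * w.B ^ 2 / 4 * U.u t x ^ 2 := by
      gcongr
    refine mul_le_mul_of_nonneg_left ?_ hE0
    nlinarith
  have hz : z w P U t x ^ 2 = E w P t x ^ 2 * U.u t x ^ 2 := by rw [z]; ring
  have hA1 : A w P t x ≤ P.s t ^ 2 * (w.B / 2 + 1) := by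
    unfold A; nlinarith [le_of_abs_le hsβ, sq_nonneg (P.s t * w.β1 x / 2)]
  have hA2 : -A w P t x ≤ P.s t ^ 2 * (w.B / 2 + w.B ^ 2 / 4) := by
    unfold A; nlinarith [neg_le_of_abs_le hsβ, hP.V_nonneg]
  have hχB : w.χ x ≤ w.B := (le_abs_self _).trans c0
  have hu := sq_nonneg (U.u t x)
  have hux := sq_nonneg (U.ux t x)
  have hKB : 0 ≤ w.K * w.B := by positivity
  have hD : 0 ≤ w.D := by unfold CarlemanWeight.D; positivity
  have hs0 : 0 ≤ P.s t := by linarith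
  have hχs : w.K * w.χ x * P.s t ≤ w.K * w.B * P.s t ^ 3 := by gcongr
  constructor
  · calc Q w P U t x ≤ E w P t x ^ 2 *
        (2 * U.ux t x ^ 2 + P.s t ^ 2 * w.B ^ 2 / 2 * U.u t x ^ 2)
        + P.s t ^ 2 * (w.B / 2 + 1) * (E w P t x ^ 2 * U.u t x ^ 2)
        + w.K * w.B * P.s t ^ 3 * (E w P t x ^ 2 * U.u t x ^ 2) := by
          unfold Q
          rw [hz]
          have h4 : A w P t x * (E w P t x ^ 2 * U.u t x ^ 2) ≤
            P.s t ^ 2 * (w.B / 2 + 1) * (E w P t x ^ 2 * U.u t x ^ 2) := by gcongr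
          have h5 := mul_le_mul_of_nonneg_right hχs (mul_nonneg hE0 hu)
          linarith
      _ = E w P t x ^ 2 * (2 * U.ux t x ^ 2
          + (P.s t ^ 2 * (w.B ^ 2 / 2 + (w.B / 2 + 1)) + P.s t ^ 3 * (w.K * w.B)) * U.u t x ^ 2) := by
            ring
      _ ≤ E w P t x ^ 2 * (w.D * P.s t ^ 3 * U.ux t x ^ 2
          + (w.D * P.s t ^ 3) * U.u t x ^ 2) := by
          have q1 : 2 ≤ w.D * P.s t ^ 3 := by
            have : 2 ≤ w.D := by unfold CarlemanWeight.D; linarith [sq_nonneg w.B]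
            linarith [mul_le_mul this hp0 zero_le_one hD]
          have q2 : P.s t ^ 2 * (w.B ^ 2 / 2 + (w.B / 2 + 1)) + P.s t ^ 3 * (w.K * w.B)
              ≤ w.D * P.s t ^ 3 := by
            have : P.s t ^ 2 * (w.B ^ 2 / 2 + (w.B / 2 + 1))
              ≤ P.s t ^ 3 * (w.B ^ 2 / 2 + (w.B / 2 + 1)) := by gcongr
            unfold CarlemanWeight.D
            have h6 : 0 ≤ P.s t ^ 3 * (w.B ^ 2 / 2 + w.B / 2 + 3) := by positivity
            linarith
          gcongr
      _ = w.D * P.s t ^ 3 * (U.ux t x ^ 2 + U.u t x ^ 2) * E w P t x ^ 2 := by ring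
      _ ≤ w.D * P.s t ^ 3 * (U.ux t x ^ 2 + U.u t x ^ 2) * Real.exp (-(P.s t * w.m)) := by gcongr
      _ = _ := by ring
  · calc -Q w P U t x ≤ P.s t ^ 2 * (w.B / 2 + w.B ^ 2 / 4) * (E w P t x ^ 2 * U.u t x ^ 2) := by
          unfold Q
          rw [hz]
          have h4 : -A w P t x * (E w P t x ^ 2 * U.u t x ^ 2) ≤
            P.s t ^ 2 * (w.B / 2 + w.B ^ 2 / 4) * (E w P t x ^ 2 * U.u t x ^ 2) := by gcongr
          have h5 : 0 ≤ w.K * w.χ x * (P.s t * (E w P t x ^ 2 * U.u t x ^ 2)) := by positivity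
          linarith [sq_nonneg (zx w P U t x)]
      _ ≤ P.s t ^ 3 * w.D * (Real.exp (-(P.s t * w.m)) * U.u t x ^ 2) := by
          have : w.B / 2 + w.B ^ 2 / 4 ≤ w.D := by
            unfold CarlemanWeight.D; linarith [sq_nonneg w.B]
          gcongr
      _ = _ := by ring

end StripFunction

/-! ### The estimate on a strip for regular functions -/

theorem ae_rectMeasure {t₀ t₁ : ℝ} {p : ℝ × ℝ → Prop}
    (h : ∀ t ∈ Icc t₀ t₁, ∀ x ∈ Icc (-1 : ℝ) 1, p (t, x)) : ∀ᵐ q ∂rectMeasure t₀ t₁, p q := by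
  rw [rectMeasure, muI, Measure.prod_restrict]
  refine (ae_restrict_iff' (measurableSet_Ioo.prod measurableSet_Ioo)).2 (ae_of_all _ ?_)
  rintro ⟨t, x⟩ ⟨h1, h2⟩
  exact h t (Ioo_subset_Icc_self h1) x (Ioo_subset_Icc_self h2)

theorem lintegral_lintegral_eq_ofReal {t₀ t₁ : ℝ} {k : ℝ × ℝ → ℝ}
    (hk : Integrable k (rectMeasure t₀ t₁))
    (h0 : ∀ t ∈ Icc t₀ t₁, ∀ x ∈ Icc (-1 : ℝ) 1, 0 ≤ k (t, x)) :
    ∫⁻ t in Ioo t₀ t₁, ∫⁻ x in Ioo (-1 : ℝ) 1, ENNReal.ofReal (k (t, x)) =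
      ENNReal.ofReal (∫ q, k q ∂rectMeasure t₀ t₁) := by
  rw [ofReal_integral_eq_lintegral_ofReal hk (ae_rectMeasure h0)]
  exact (lintegral_prod _ hk.aestronglyMeasurable.aemeasurable.ennreal_ofReal).symm

section

variable {a b : ℝ} (w : CarlemanWeight a b) {C t₀ t₁ : ℝ} (P : StripParam C t₀ t₁)

open StripFunction in
/-- Carleman estimate on a strip with boundary terms in time, for a pair of real functions. -/
theorem strip_carleman (hC : 24 * w.B ^ 2 / w.κ ≤ C) (ht : t₀ ≤ t₁) (U₁ U₂ : StripFunction) :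
    w.κ / (4 * (1 + w.B ^ 2)) * ∫ q, (P.s q.1 * (U₁.ux q.1 q.2 ^ 2 + U₂.ux q.1 q.2 ^ 2)
        + P.s q.1 ^ 3 * (U₁.u q.1 q.2 ^ 2 + U₂.u q.1 q.2 ^ 2)) * Real.exp (-(P.s q.1 * w.β q.2))
        ∂rectMeasure t₀ t₁ ≤
      (1 + w.K) * (∫ q, ((U₁.ut q.1 q.2 - U₁.uxx q.1 q.2 + P.V q.2 * U₁.u q.1 q.2) ^ 2
        + (U₂.ut q.1 q.2 - U₂.uxx q.1 q.2 + P.V q.2 * U₂.u q.1 q.2) ^ 2)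
          * Real.exp (-(P.s q.1 * w.β q.2)) ∂rectMeasure t₀ t₁)
      + 8 * w.K * w.B ^ 3 * (∫ q, (univ ×ˢ Ioo a b).indicator (fun q : ℝ × ℝ => P.s q.1 ^ 3 *
        (U₁.u q.1 q.2 ^ 2 + U₂.u q.1 q.2 ^ 2) * Real.exp (-(P.s q.1 * w.β q.2))) q
          ∂rectMeasure t₀ t₁)
      + w.D * (P.s t₀ ^ 3 * Real.exp (-(P.s t₀ * w.m))) * (∫ x, (U₁.ux t₀ x ^ 2 + U₂.ux t₀ x ^ 2
        + (U₁.u t₀ x ^ 2 + U₂.u t₀ x ^ 2)) ∂muI)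
      + w.D * (P.s t₁ ^ 3 * Real.exp (-(P.s t₁ * w.m))) *
        ∫ x, (U₁.u t₁ x ^ 2 + U₂.u t₁ x ^ 2) ∂muI := by
  obtain ⟨cs, -, -⟩ := continuousOn_param P
  have cβ := w.continuous.1
  have hV : Continuous P.V := continuous_iff_continuousAt.2 fun x => (P.hV x).continuousAt
  have hu₁ := U₁.cu
  have hux₁ := U₁.cux
  have huxx₁ := U₁.cuxx
  have hut₁ := U₁.cut
  have hu₂ := U₂.cu
  have hux₂ := U₂.cux
  have huxx₂ := U₂.cuxx
  have hut₂ := U₂.cut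
  set k : ℝ × ℝ → ℝ := fun q => (P.s q.1 * (U₁.ux q.1 q.2 ^ 2 + U₂.ux q.1 q.2 ^ 2)
        + P.s q.1 ^ 3 * (U₁.u q.1 q.2 ^ 2 + U₂.u q.1 q.2 ^ 2)) * Real.exp (-(P.s q.1 * w.β q.2))
    with hk
  set f : ℝ × ℝ → ℝ := fun q => ((U₁.ut q.1 q.2 - U₁.uxx q.1 q.2 + P.V q.2 * U₁.u q.1 q.2) ^ 2
        + (U₂.ut q.1 q.2 - U₂.uxx q.1 q.2 + P.V q.2 * U₂.u q.1 q.2) ^ 2)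
          * Real.exp (-(P.s q.1 * w.β q.2)) with hf
  set h : ℝ × ℝ → ℝ := fun q : ℝ × ℝ => P.s q.1 ^ 3 *
        (U₁.u q.1 q.2 ^ 2 + U₂.u q.1 q.2 ^ 2) * Real.exp (-(P.s q.1 * w.β q.2)) with hh
  have ik : Integrable k (rectMeasure t₀ t₁) := integrable_rectMeasure (by rw [hk]; fun_prop)
  have i_f : Integrable f (rectMeasure t₀ t₁) := integrable_rectMeasure (by rw [hf]; fun_prop)
  have ih : Integrable h (rectMeasure t₀ t₁) := integrable_rectMeasure (by rw [hh]; fun_prop)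
  have ih' : Integrable ((univ ×ˢ Ioo a b).indicator h) (rectMeasure t₀ t₁) :=
    ih.indicator (MeasurableSet.univ.prod measurableSet_Ioo)
  obtain ⟨c1, c2⟩ := continuousOn_Qt_Rx w P U₁
  obtain ⟨c3, c4⟩ := continuousOn_Qt_Rx w P U₂
  -- The two functions will be the real and imaginary parts of one complex function. The potential
  -- and the weight being real, the inequalities are simply added.
  have main := integral_divergence_le ht
    (Q := fun t x => Q w P U₁ t x + Q w P U₂ t x) (Qt := fun t x => Qt w P U₁ t x + Qt w P U₂ t x)
    (R := fun t x => R w P U₁ t x + R w P U₂ t x) (Rx := fun t x => Rx w P U₁ t x + Rx w P U₂ t x)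
    (k := fun q => w.κ / (4 * (1 + w.B ^ 2)) * k q)
    (h := fun q => (1 + w.K) * f q + 8 * w.K * w.B ^ 3 * (univ ×ˢ Ioo a b).indicator h q)
    (fun t h x => (hasDerivAt_Q w P U₁ h x).add (hasDerivAt_Q w P U₂ h x))
    (fun t h x => (hasDerivAt_R w P U₁ t x).add (hasDerivAt_R w P U₂ t x))
    (c1.add c3) (c2.add c4) (fun t h => (continuous_Q w P U₁ t).add (continuous_Q w P U₂ t))
    (ik.const_mul _) ((i_f.const_mul _).add (ih'.const_mul _))
    (fun t h => add_le_add (R_left_le_right w P U₁ h) (R_left_le_right w P U₂ h))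
    (fun t h x hx => by
      have p1 := pointwise_le w P U₁ hC h hx
      have p2 := pointwise_le w P U₂ hC h hx
      simp only [hk, hf, hh]
      by_cases hxab : x ∈ Ioo a b
      · rw [indicator_of_mem hxab] at p1 p2
        rw [indicator_of_mem (show (t, x) ∈ univ ×ˢ Ioo a b from ⟨mem_univ _, hxab⟩)]
        linarith
      · rw [indicator_of_notMem hxab] at p1 p2
        rw [indicator_of_notMem (show (t, x) ∉ univ ×ˢ Ioo a b from fun h => hxab h.2)]
        linarith)
  rw [integral_const_mul, integral_add (i_f.const_mul _) (ih'.const_mul _), integral_const_mul,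
    integral_const_mul] at main
  have hu₁' : ∀ t, Continuous (U₁.u t) := fun t => hu₁.comp (Continuous.prodMk_right t)
  have hu₂' : ∀ t, Continuous (U₂.u t) := fun t => hu₂.comp (Continuous.prodMk_right t)
  have hux₁' : ∀ t, Continuous (U₁.ux t) := fun t => hux₁.comp (Continuous.prodMk_right t)
  have hux₂' : ∀ t, Continuous (U₂.ux t) := fun t => hux₂.comp (Continuous.prodMk_right t)
  have b0 : ∫ x, (Q w P U₁ t₀ x + Q w P U₂ t₀ x) ∂muI ≤
      w.D * (P.s t₀ ^ 3 * Real.exp (-(P.s t₀ * w.m))) * (∫ x, (U₁.ux t₀ x ^ 2 + U₂.ux t₀ x ^ 2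
        + (U₁.u t₀ x ^ 2 + U₂.u t₀ x ^ 2)) ∂muI) := by
    rw [← integral_const_mul]
    refine setIntegral_mono_on (integrable_muI ((continuous_Q w P U₁ _).add (continuous_Q w P U₂ _)))
      (integrable_muI ?_) measurableSet_Ioo fun x hx => ?_
    · have := hu₁' t₀
      have := hu₂' t₀
      have := hux₁' t₀
      have := hux₂' t₀
      fun_prop
    · have q1 := (boundary_le w P U₁ ⟨le_rfl, ht⟩ (Ioo_subset_Icc_self hx)).1
      have q2 := (boundary_le w P U₂ ⟨le_rfl, ht⟩ (Ioo_subset_Icc_self hx)).1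
      linarith
  have b1 : -∫ x, (Q w P U₁ t₁ x + Q w P U₂ t₁ x) ∂muI ≤
      w.D * (P.s t₁ ^ 3 * Real.exp (-(P.s t₁ * w.m))) *
        ∫ x, (U₁.u t₁ x ^ 2 + U₂.u t₁ x ^ 2) ∂muI := by
    rw [← integral_const_mul, ← integral_neg]
    refine setIntegral_mono_on
      (integrable_muI ((continuous_Q w P U₁ _).add (continuous_Q w P U₂ _)).neg)
      (integrable_muI ?_) measurableSet_Ioo fun x hx => ?_
    · have := hu₁' t₁
      have := hu₂' t₁
      fun_prop
    · have q1 := (boundary_le w P U₁ ⟨ht, le_rfl⟩ (Ioo_subset_Icc_self hx)).2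
      have q2 := (boundary_le w P U₂ ⟨ht, le_rfl⟩ (Ioo_subset_Icc_self hx)).2
      linarith
  linarith

/-! ### Finite sine sums -/

/-- The frequency of the `k`-th Dirichlet eigenfunction of `(-1,1)`. -/
def freq (k : ℕ) : ℝ := k * (Real.pi / 2)

/-- The functions `sin (k π (x + 1) / 2)`. -/
def sinF (k : ℕ) (x : ℝ) : ℝ := Real.sin (freq k * (x + 1))

/-- The functions `cos (k π (x + 1) / 2)`. -/
def cosF (k : ℕ) (x : ℝ) : ℝ := Real.cos (freq k * (x + 1))

theorem hasDerivAt_sinF (k : ℕ) (x : ℝ) : HasDerivAt (sinF k) (freq k * cosF k x) x := by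
  refine ((((hasDerivAt_id x).add_const 1).const_mul (freq k)).sin).congr_deriv ?_
  simp [cosF, mul_comm]

theorem hasDerivAt_cosF (k : ℕ) (x : ℝ) : HasDerivAt (cosF k) (-(freq k * sinF k x)) x := by
  refine ((((hasDerivAt_id x).add_const 1).const_mul (freq k)).cos).congr_deriv ?_
  simp [sinF, mul_comm]

@[fun_prop] theorem continuous_sinF (k : ℕ) : Continuous (sinF k) := by unfold sinF; fun_prop
@[fun_prop] theorem continuous_cosF (k : ℕ) : Continuous (cosF k) := by unfold cosF; fun_prop

theorem sinF_neg_one (k : ℕ) : sinF k (-1) = 0 := by simp [sinF]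

theorem sinF_one (k : ℕ) : sinF k 1 = 0 := by
  rw [sinF, freq, show (k : ℝ) * (Real.pi / 2) * (1 + 1) = k * Real.pi by ring]
  exact Real.sin_nat_mul_pi k

/-- A finite sine sum with `C¹` coefficients. -/
def sineStrip (N : ℕ) (c c' : ℕ → ℝ → ℝ) (hc : ∀ k t, HasDerivAt (c k) (c' k t) t)
    (hc' : ∀ k, Continuous (c' k)) : StripFunction :=
  have cc : ∀ k, Continuous (c k) := fun k =>
    continuous_iff_continuousAt.2 fun t => (hc k t).continuousAt
  { u := fun t x => ∑ k ∈ Finset.range N, c k t * sinF k x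
    ux := fun t x => ∑ k ∈ Finset.range N, c k t * (freq k * cosF k x)
    uxx := fun t x => ∑ k ∈ Finset.range N, c k t * (freq k * -(freq k * sinF k x))
    ut := fun t x => ∑ k ∈ Finset.range N, c' k t * sinF k x
    utx := fun t x => ∑ k ∈ Finset.range N, c' k t * (freq k * cosF k x)
    hx := fun t x => HasDerivAt.fun_sum fun k _ => (hasDerivAt_sinF k x).const_mul _
    hxx := fun t x => HasDerivAt.fun_sum fun k _ => ((hasDerivAt_cosF k x).const_mul _).const_mul _
    htx := fun t x => HasDerivAt.fun_sum fun k _ => (hasDerivAt_sinF k x).const_mul _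
    ht := fun t x => HasDerivAt.fun_sum fun k _ => (hc k t).mul_const _
    hxt := fun t x => HasDerivAt.fun_sum fun k _ => (hc k t).mul_const _
    cu := by fun_prop
    cux := by fun_prop
    cuxx := by fun_prop
    cut := by fun_prop
    cutx := by fun_prop
    right := fun t => by simp [sinF_one]
    left := fun t => by simp [sinF_neg_one]
    t_right := fun t => by simp [sinF_one]
    t_left := fun t => by simp [sinF_neg_one] }

/-- Finite complex sine sums. -/
def sineSum (N : ℕ) (c : ℕ → ℂ) (x : ℝ) : ℂ := ∑ k ∈ Finset.range N, c k * (sinF k x : ℂ)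

/-- The derivative of a finite sine sum. -/
def cosineSum (N : ℕ) (c : ℕ → ℂ) (x : ℝ) : ℂ :=
  ∑ k ∈ Finset.range N, c k * ((freq k * cosF k x : ℝ) : ℂ)

theorem norm_sq_re_im (z : ℂ) : ‖z‖ ^ 2 = z.re ^ 2 + z.im ^ 2 := by
  rw [← Complex.normSq_eq_norm_sq, Complex.normSq_apply]; ring

/-- Converts an inequality between real integrals into one between integrals in `[0,∞]`. Everything
is continuous in the closed strip, hence integrable, and nonnegative. -/
theorem ofReal_carleman (ht : t₀ ≤ t₁) {S G F : ℝ → ℝ → ℂ}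
    (cS : Continuous fun q : ℝ × ℝ => S q.1 q.2) (cG : Continuous fun q : ℝ × ℝ => G q.1 q.2)
    (cF : Continuous fun q : ℝ × ℝ => F q.1 q.2)
    (main : w.κ / (4 * (1 + w.B ^ 2)) * ∫ q, (P.s q.1 * ‖G q.1 q.2‖ ^ 2
        + P.s q.1 ^ 3 * ‖S q.1 q.2‖ ^ 2) * Real.exp (-(P.s q.1 * w.β q.2)) ∂rectMeasure t₀ t₁ ≤
      (1 + w.K) * (∫ q, ‖F q.1 q.2‖ ^ 2
          * Real.exp (-(P.s q.1 * w.β q.2)) ∂rectMeasure t₀ t₁)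
      + 8 * w.K * w.B ^ 3 * (∫ q, (univ ×ˢ Ioo a b).indicator (fun q : ℝ × ℝ => P.s q.1 ^ 3 *
        ‖S q.1 q.2‖ ^ 2 * Real.exp (-(P.s q.1 * w.β q.2))) q ∂rectMeasure t₀ t₁)
      + w.D * (P.s t₀ ^ 3 * Real.exp (-(P.s t₀ * w.m))) *
        (∫ x, (‖G t₀ x‖ ^ 2 + ‖S t₀ x‖ ^ 2) ∂muI)
      + w.D * (P.s t₁ ^ 3 * Real.exp (-(P.s t₁ * w.m))) * ∫ x, ‖S t₁ x‖ ^ 2 ∂muI) :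
    ENNReal.ofReal (w.κ / (4 * (1 + w.B ^ 2))) *
      ∫⁻ t in Ioo t₀ t₁, ∫⁻ x in Ioo (-1 : ℝ) 1, ENNReal.ofReal
        ((P.s t * ‖G t x‖ ^ 2 + P.s t ^ 3 * ‖S t x‖ ^ 2) * Real.exp (-(P.s t * w.β x))) ≤
      ENNReal.ofReal (1 + w.K) * (∫⁻ t in Ioo t₀ t₁, ∫⁻ x in Ioo (-1 : ℝ) 1, ENNReal.ofReal
        (‖F t x‖ ^ 2 * Real.exp (-(P.s t * w.β x))))
      + ENNReal.ofReal (8 * w.K * w.B ^ 3) * (∫⁻ t in Ioo t₀ t₁, ∫⁻ x in Ioo a b, ENNReal.ofReal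
        (P.s t ^ 3 * ‖S t x‖ ^ 2 * Real.exp (-(P.s t * w.β x))))
      + ENNReal.ofReal (w.D * (P.s t₀ ^ 3 * Real.exp (-(P.s t₀ * w.m))) *
        ∫ x, (‖G t₀ x‖ ^ 2 + ‖S t₀ x‖ ^ 2) ∂muI)
      + ENNReal.ofReal (w.D * (P.s t₁ ^ 3 * Real.exp (-(P.s t₁ * w.m))) *
        ∫ x, ‖S t₁ x‖ ^ 2 ∂muI) := by
  obtain ⟨cs, -, -⟩ := StripFunction.continuousOn_param P
  have cβ := w.continuous.1
  have hs0 : ∀ t ∈ Icc t₀ t₁, 0 ≤ P.s t := fun t h => by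
    have := P.bounds t h 0 (by simp)
    linarith [this.one_le, this.le_s]
  have i1 : Integrable ( fun q : ℝ × ℝ =>
    (P.s q.1 * ‖G q.1 q.2‖ ^ 2 + P.s q.1 ^ 3 * ‖S q.1 q.2‖ ^ 2)
          * Real.exp (-(P.s q.1 * w.β q.2))) (rectMeasure t₀ t₁) :=
    integrable_rectMeasure (by fun_prop)
  have i2 : Integrable ( fun q : ℝ × ℝ =>
    ‖F q.1 q.2‖ ^ 2
          * Real.exp (-(P.s q.1 * w.β q.2))) (rectMeasure t₀ t₁) :=
    integrable_rectMeasure (by fun_prop)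
  have i3' : Integrable ( fun q : ℝ × ℝ =>
    P.s q.1 ^ 3 * ‖S q.1 q.2‖ ^ 2 * Real.exp (-(P.s q.1 * w.β q.2)))
      (rectMeasure t₀ t₁) := integrable_rectMeasure (by fun_prop)
  have i3 := i3'.indicator (MeasurableSet.univ.prod (measurableSet_Ioo (a := a) (b := b)))
  have l1 := lintegral_lintegral_eq_ofReal i1 fun t h x _ => by
    have := hs0 t h
    positivity
  have l2 := lintegral_lintegral_eq_ofReal i2 fun t h x _ => by positivity
  have l3 := lintegral_lintegral_eq_ofReal i3 fun t h x _ =>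
    by
      have := hs0 t h
      rw [indicator_apply]
      split_ifs
      · positivity
      · exact le_rfl
  have l3' : ∫⁻ t in Ioo t₀ t₁, ∫⁻ x in Ioo (-1 : ℝ) 1, ENNReal.ofReal
      ((univ ×ˢ Ioo a b).indicator (fun q : ℝ × ℝ =>
        P.s q.1 ^ 3 * ‖S q.1 q.2‖ ^ 2 * Real.exp (-(P.s q.1 * w.β q.2))) (t, x)) ≤
      ∫⁻ t in Ioo t₀ t₁, ∫⁻ x in Ioo a b, ENNReal.ofReal
        (P.s t ^ 3 * ‖S t x‖ ^ 2 * Real.exp (-(P.s t * w.β x))) := by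
    refine lintegral_mono fun t => ?_
    have : ∀ x, ENNReal.ofReal ((univ ×ˢ Ioo a b).indicator (fun q : ℝ × ℝ =>
        P.s q.1 ^ 3 * ‖S q.1 q.2‖ ^ 2 * Real.exp (-(P.s q.1 * w.β q.2))) (t, x)) =
        (Ioo a b).indicator (fun x => ENNReal.ofReal
        (P.s t ^ 3 * ‖S t x‖ ^ 2 * Real.exp (-(P.s t * w.β x)))) x := fun x => by
      by_cases hx : x ∈ Ioo a b
      · rw [indicator_of_mem hx, indicator_of_mem (show (t, x) ∈ univ ×ˢ Ioo a b from ⟨mem_univ _, hx⟩)]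
      · rw [indicator_of_notMem hx, indicator_of_notMem (show (t, x) ∉ univ ×ˢ Ioo a b from fun h => hx h.2)]
        simp
    simp only [this]
    rw [lintegral_indicator measurableSet_Ioo]
    -- Only an inequality is taken between integrals over `(a,b) ∩ (-1,1)` and over `(a,b)`, so no
    -- position of `a` and `b` is needed here.
    exact lintegral_mono' (Measure.restrict_mono_measure Measure.restrict_le_self _) le_rfl
  rw [l3] at l3'
  have hκ := w.κ_pos
  have hK := w.K_nonneg
  have hB := w.one_le_B
  have hD : 0 ≤ w.D := by unfold CarlemanWeight.D; positivity
  have j2 : 0 ≤ ∫ q : ℝ × ℝ, ‖F q.1 q.2‖ ^ 2 * Real.exp (-(P.s q.1 * w.β q.2))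
        ∂rectMeasure t₀ t₁ := integral_nonneg fun q => by positivity
  have k0 := hs0 t₀ ⟨le_rfl, ht⟩
  have k1 := hs0 t₁ ⟨ht, le_rfl⟩
  rw [l1, l2, ← ENNReal.ofReal_mul (by positivity), ← ENNReal.ofReal_mul (by positivity)]
  refine le_trans ?_ (add_le_add_left (add_le_add_left (add_le_add_right
    (mul_le_mul_right l3' _) _) _) _)
  rw [← ENNReal.ofReal_mul (by positivity)]
  have j3 : 0 ≤ ∫ q, (univ ×ˢ Ioo a b).indicator (fun q : ℝ × ℝ =>
      P.s q.1 ^ 3 * ‖S q.1 q.2‖ ^ 2 * Real.exp (-(P.s q.1 * w.β q.2))) q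
        ∂rectMeasure t₀ t₁ := integral_nonneg_of_ae (ae_rectMeasure fun t h x _ =>
    by
      have := hs0 t h
      rw [indicator_apply]
      split_ifs
      · positivity
      · exact le_rfl)
  have j4 : 0 ≤ ∫ x, (‖G t₀ x‖ ^ 2 + ‖S t₀ x‖ ^ 2) ∂muI :=
    integral_nonneg fun x => by positivity
  have j5 : 0 ≤ ∫ x, ‖S t₁ x‖ ^ 2 ∂muI := integral_nonneg fun x => by positivity
  rw [← ENNReal.ofReal_add (by positivity) (by positivity),
    ← ENNReal.ofReal_add (by positivity) (by positivity),
    ← ENNReal.ofReal_add (by positivity) (by positivity)]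
  exact ENNReal.ofReal_le_ofReal main

/-- Carleman estimate on a strip with boundary terms in time, for finite sine sums. -/
theorem sineSum_carleman (hC : 24 * w.B ^ 2 / w.κ ≤ C) (ht : t₀ ≤ t₁) (N : ℕ) (c c' : ℝ → ℕ → ℂ)
    (hc : ∀ k t, HasDerivAt (fun τ => c τ k) (c' t k) t) (hc' : ∀ k, Continuous fun t => c' t k) :
    ENNReal.ofReal (w.κ / (4 * (1 + w.B ^ 2))) *
      ∫⁻ t in Ioo t₀ t₁, ∫⁻ x in Ioo (-1 : ℝ) 1, ENNReal.ofReal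
        ((P.s t * ‖cosineSum N (c t) x‖ ^ 2 + P.s t ^ 3 * ‖sineSum N (c t) x‖ ^ 2)
          * Real.exp (-(P.s t * w.β x))) ≤
      ENNReal.ofReal (1 + w.K) * (∫⁻ t in Ioo t₀ t₁, ∫⁻ x in Ioo (-1 : ℝ) 1, ENNReal.ofReal
        (‖sineSum N (fun k => c' t k + freq k ^ 2 * c t k) x + P.V x * sineSum N (c t) x‖ ^ 2
          * Real.exp (-(P.s t * w.β x))))
      + ENNReal.ofReal (8 * w.K * w.B ^ 3) * (∫⁻ t in Ioo t₀ t₁, ∫⁻ x in Ioo a b, ENNReal.ofReal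
        (P.s t ^ 3 * ‖sineSum N (c t) x‖ ^ 2 * Real.exp (-(P.s t * w.β x))))
      + ENNReal.ofReal (w.D * (P.s t₀ ^ 3 * Real.exp (-(P.s t₀ * w.m))) *
        ∫ x, (‖cosineSum N (c t₀) x‖ ^ 2 + ‖sineSum N (c t₀) x‖ ^ 2) ∂muI)
      + ENNReal.ofReal (w.D * (P.s t₁ ^ 3 * Real.exp (-(P.s t₁ * w.m))) *
        ∫ x, ‖sineSum N (c t₁) x‖ ^ 2 ∂muI) := by
  have hre : ∀ k t, HasDerivAt (fun τ => (c τ k).re) ((c' t k).re) t := fun k t =>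
    (Complex.reCLM.hasFDerivAt.comp_hasDerivAt t (hc k t))
  have him : ∀ k t, HasDerivAt (fun τ => (c τ k).im) ((c' t k).im) t := fun k t =>
    (Complex.imCLM.hasFDerivAt.comp_hasDerivAt t (hc k t))
  let U₁ := sineStrip N (fun k t => (c t k).re) (fun k t => (c' t k).re) hre
    (fun k => Complex.continuous_re.comp (hc' k))
  let U₂ := sineStrip N (fun k t => (c t k).im) (fun k t => (c' t k).im) him
    (fun k => Complex.continuous_im.comp (hc' k))
  have main := strip_carleman w P hC ht U₁ U₂
  have e1 : ∀ t x, U₁.u t x ^ 2 + U₂.u t x ^ 2 = ‖sineSum N (c t) x‖ ^ 2 := fun t x => by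
    rw [norm_sq_re_im]
    simp [sineSum, U₁, U₂, sineStrip]
  have e2 : ∀ t x, U₁.ux t x ^ 2 + U₂.ux t x ^ 2 = ‖cosineSum N (c t) x‖ ^ 2 := fun t x => by
    rw [norm_sq_re_im, cosineSum, Complex.re_sum, Complex.im_sum]
    simp only [Complex.re_mul_ofReal, Complex.im_mul_ofReal]
    rfl
  have e3 : ∀ t x, (U₁.ut t x - U₁.uxx t x + P.V x * U₁.u t x) ^ 2
      + (U₂.ut t x - U₂.uxx t x + P.V x * U₂.u t x) ^ 2 =
      ‖sineSum N (fun k => c' t k + freq k ^ 2 * c t k) x + P.V x * sineSum N (c t) x‖ ^ 2 :=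
    fun t x => by
    rw [norm_sq_re_im]
    have q1 : (sineSum N (fun k => c' t k + freq k ^ 2 * c t k) x + P.V x * sineSum N (c t) x).re =
        U₁.ut t x - U₁.uxx t x + P.V x * U₁.u t x := by
      rw [Complex.add_re, Complex.re_ofReal_mul, sineSum, sineSum, Complex.re_sum, Complex.re_sum]
      simp only [Complex.re_mul_ofReal, U₁, sineStrip]
      rw [← Finset.sum_sub_distrib]
      congr 1
      refine Finset.sum_congr rfl fun k _ => ?_
      rw [Complex.add_re, ← Complex.ofReal_pow, Complex.re_ofReal_mul]
      ring
    have q2 : (sineSum N (fun k => c' t k + freq k ^ 2 * c t k) x + P.V x * sineSum N (c t) x).im =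
        U₂.ut t x - U₂.uxx t x + P.V x * U₂.u t x := by
      rw [Complex.add_im, Complex.im_ofReal_mul, sineSum, sineSum, Complex.im_sum, Complex.im_sum]
      simp only [Complex.im_mul_ofReal, U₂, sineStrip]
      rw [← Finset.sum_sub_distrib]
      congr 1
      refine Finset.sum_congr rfl fun k _ => ?_
      rw [Complex.add_im, ← Complex.ofReal_pow, Complex.im_ofReal_mul]
      ring
    rw [q1, q2]
  simp only [e1, e2, e3] at main
  have hV : Continuous P.V := continuous_iff_continuousAt.2 fun x => (P.hV x).continuousAt
  have hck : ∀ k, Continuous fun t => c t k := fun k =>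
    continuous_iff_continuousAt.2 fun t => (hc k t).continuousAt
  exact ofReal_carleman w P ht (S := fun t => sineSum N (c t)) (G := fun t => cosineSum N (c t))
    (F := fun t x => sineSum N (fun k => c' t k + freq k ^ 2 * c t k) x
      + P.V x * sineSum N (c t) x)
    (by unfold sineSum; fun_prop) (by unfold cosineSum; fun_prop) (by unfold sineSum; fun_prop) main

end

/-! ### Sine and cosine series in `L²(-1,1)` -/

theorem memLp_muI {φ : ℝ → ℂ} (h : Continuous φ) : MemLp φ 2 muI := by
  obtain ⟨B, hB⟩ := isCompact_Icc.exists_bound_of_continuousOn (f := φ)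
    (h.continuousOn (s := Icc (-1 : ℝ) 1))
  exact MemLp.of_bound h.aestronglyMeasurable B
    ((ae_restrict_iff' measurableSet_Ioo).2 (ae_of_all _ fun x hx => hB x (Ioo_subset_Icc_self hx)))

/-- The class in `L²(-1,1)` of a continuous function. -/
def toL2 (φ : ℝ → ℂ) (h : Continuous φ) : L2I := (memLp_muI h).toLp φ

theorem coeFn_toL2 {φ : ℝ → ℂ} (h : Continuous φ) : toL2 φ h =ᵐ[muI] φ := MemLp.coeFn_toLp _

/-- The classes of the functions `sinF`. -/
def sinL (k : ℕ) : L2I := toL2 (fun x => (sinF k x : ℂ)) (by fun_prop)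

/-- The classes of the functions `cosF`. -/
def cosL (k : ℕ) : L2I := toL2 (fun x => (cosF k x : ℂ)) (by fun_prop)

theorem inner_toL2_real {φ : ℝ → ℝ} (h : Continuous fun x => (φ x : ℂ)) (v : L2I) :
    inner ℂ (toL2 _ h) v = ∫ x, (φ x : ℂ) * v x ∂muI := by
  rw [L2.inner_def]
  refine integral_congr_ae ?_
  filter_upwards [coeFn_toL2 h] with x hx
  simp only [hx, RCLike.inner_apply, Complex.conj_ofReal]
  ring

theorem inner_sinL (k : ℕ) (v : L2I) : inner ℂ (sinL k) v = ∫ x, (sinF k x : ℂ) * v x ∂muI :=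
  inner_toL2_real _ v

theorem inner_cosL (k : ℕ) (v : L2I) : inner ℂ (cosL k) v = ∫ x, (cosF k x : ℂ) * v x ∂muI :=
  inner_toL2_real _ v

theorem freq_injective : Function.Injective freq := fun i j h => by
  have := Real.pi_pos
  unfold freq at h
  exact_mod_cast mul_right_cancel₀ (by positivity) h

theorem freq_nonneg (k : ℕ) : 0 ≤ freq k := by unfold freq; positivity

theorem inner_sinL_sinL (j k : ℕ) :
    inner ℂ (sinL j) (sinL k) = ((∫ x, sinF j x * sinF k x ∂muI : ℝ) : ℂ) := by
  rw [inner_sinL, ← integral_complex_ofReal]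
  refine integral_congr_ae ?_
  filter_upwards [coeFn_toL2 (φ := fun x => (sinF k x : ℂ)) (by fun_prop)] with x hx
  rw [sinL, hx]
  push_cast
  rfl

theorem inner_cosL_cosL (j k : ℕ) :
    inner ℂ (cosL j) (cosL k) = ((∫ x, cosF j x * cosF k x ∂muI : ℝ) : ℂ) := by
  rw [inner_cosL, ← integral_complex_ofReal]
  refine integral_congr_ae ?_
  filter_upwards [coeFn_toL2 (φ := fun x => (cosF k x : ℂ)) (by fun_prop)] with x hx
  rw [cosL, hx]
  push_cast
  rfl

/-- Eigenfunctions for distinct eigenvalues: the difference of the eigenvalues times the product is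
the derivative of the Wronskian, which vanishes at `±1`. -/
theorem integral_sinF_mul_ne {j k : ℕ} (h : j ≠ k) : ∫ x, sinF j x * sinF k x ∂muI = 0 := by
  have h1 : ∫ x in Ioo (-1 : ℝ) 1, (freq j ^ 2 - freq k ^ 2) * (sinF j x * sinF k x) = 0 := by
    rw [integral_Ioo_eq_sub (f := fun x => sinF j x * (freq k * cosF k x)
      - (freq j * cosF j x) * sinF k x) (by norm_num)]
    · simp [sinF_one, sinF_neg_one]
    · intro x _
      refine (((hasDerivAt_sinF j x).mul ((hasDerivAt_cosF k x).const_mul _)).sub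
        (((hasDerivAt_cosF j x).const_mul _).mul (hasDerivAt_sinF k x))).congr_deriv ?_
      ring
    · fun_prop
  rw [integral_const_mul] at h1
  refine (mul_eq_zero.1 h1).resolve_left fun h2 => h (freq_injective ?_)
  nlinarith [freq_nonneg j, freq_nonneg k]

theorem integral_cosF_mul_ne {j k : ℕ} (h : j ≠ k) : ∫ x, cosF j x * cosF k x ∂muI = 0 := by
  have h1 : ∫ x in Ioo (-1 : ℝ) 1, (freq j ^ 2 - freq k ^ 2) * (cosF j x * cosF k x) = 0 := by
    rw [integral_Ioo_eq_sub (f := fun x => (freq j * sinF j x) * cosF k x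
      - cosF j x * (freq k * sinF k x)) (by norm_num)]
    · simp [sinF_one, sinF_neg_one]
    · intro x _
      refine ((((hasDerivAt_sinF j x).const_mul _).mul (hasDerivAt_cosF k x)).sub
        ((hasDerivAt_cosF j x).mul ((hasDerivAt_sinF k x).const_mul _))).congr_deriv ?_
      ring
    · fun_prop
  rw [integral_const_mul] at h1
  refine (mul_eq_zero.1 h1).resolve_left fun h2 => h (freq_injective ?_)
  nlinarith [freq_nonneg j, freq_nonneg k]

theorem integral_sinF_cosF_sq (k : ℕ) (hk : k ≠ 0) :
    ∫ x, sinF k x * sinF k x ∂muI = 1 ∧ ∫ x, cosF k x * cosF k x ∂muI = 1 := by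
  have hf : freq k ≠ 0 := fun h => hk (freq_injective (h.trans (by simp [freq])))
  have hsc : ∀ x, sinF k x * sinF k x + cosF k x * cosF k x = 1 := fun x => by
    have := Real.sin_sq_add_cos_sq (freq k * (x + 1))
    simp only [sinF, cosF]; nlinarith
  constructor
  · rw [integral_Ioo_eq_sub (f := fun x => x / 2 - sinF k x * cosF k x / (2 * freq k)) (by norm_num)]
    · simp [sinF_one, sinF_neg_one]; norm_num
    · intro x _
      refine (((hasDerivAt_id x).div_const 2).sub
        (((hasDerivAt_sinF k x).mul (hasDerivAt_cosF k x)).div_const (2 * freq k))).congr_deriv ?_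
      have := hsc x
      field_simp
      linarith
    · fun_prop
  · rw [integral_Ioo_eq_sub (f := fun x => x / 2 + sinF k x * cosF k x / (2 * freq k)) (by norm_num)]
    · simp [sinF_one, sinF_neg_one]; norm_num
    · intro x _
      refine (((hasDerivAt_id x).div_const 2).add
        (((hasDerivAt_sinF k x).mul (hasDerivAt_cosF k x)).div_const (2 * freq k))).congr_deriv ?_
      have := hsc x
      field_simp
      linarith
    · fun_prop

theorem orthonormal_sinL : Orthonormal ℂ fun k => sinL (k + 1) := by
  rw [orthonormal_iff_ite]
  intro i j
  rw [inner_sinL_sinL]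
  split_ifs with h
  · subst h
    rw [(integral_sinF_cosF_sq _ (Nat.succ_ne_zero i)).1]; simp
  · rw [integral_sinF_mul_ne (by omega)]; simp

theorem orthonormal_cosL : Orthonormal ℂ fun k => cosL (k + 1) := by
  rw [orthonormal_iff_ite]
  intro i j
  rw [inner_cosL_cosL]
  split_ifs with h
  · subst h
    rw [(integral_sinF_cosF_sq _ (Nat.succ_ne_zero i)).2]; simp
  · rw [integral_cosF_mul_ne (by omega)]; simp

theorem integrable_continuous_mul {v φ : ℝ → ℂ} (hv : Integrable v muI) (hc : Continuous φ) :
    Integrable (fun x => φ x * v x) muI := by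
  obtain ⟨B, hB⟩ := isCompact_Icc.exists_bound_of_continuousOn
    (hc.continuousOn (s := Icc (-1 : ℝ) 1))
  exact hv.bdd_mul (c := B) hc.aestronglyMeasurable
    ((ae_restrict_iff' measurableSet_Ioo).2 (ae_of_all _ fun x hx => hB x (Ioo_subset_Icc_self hx)))

/-- An integrable function on `(-1,1)` orthogonal to the powers of `cos (π (x + 1) / 2)` is zero. -/
theorem ae_eq_zero_of_integral_cosF_pow {v : ℝ → ℂ} (hv : Integrable v muI)
    (h : ∀ m : ℕ, ∫ x, ((cosF 1 x ^ m : ℝ) : ℂ) * v x ∂muI = 0) : v =ᵐ[muI] 0 := by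
  have hpoly : ∀ p : Polynomial ℝ, ∫ x, ((p.eval (cosF 1 x) : ℝ) : ℂ) * v x ∂muI = 0 := by
    intro p
    have hint : ∀ q : Polynomial ℝ, Integrable (fun x => ((q.eval (cosF 1 x) : ℝ) : ℂ) * v x) muI := by
      intro q
      exact integrable_continuous_mul hv
        (Complex.continuous_ofReal.comp (q.continuous.comp (continuous_cosF 1)))
    induction p using Polynomial.induction_on' with
    | add p q hp hq =>
      have e : ∀ x, (((p + q).eval (cosF 1 x) : ℝ) : ℂ) * v x =
          ((p.eval (cosF 1 x) : ℝ) : ℂ) * v x + ((q.eval (cosF 1 x) : ℝ) : ℂ) * v x := fun x => by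
        rw [Polynomial.eval_add]; push_cast; ring
      simp only [e]
      rw [integral_add (hint p) (hint q), hp, hq, add_zero]
    | monomial n a =>
      have e : ∀ x, (((Polynomial.monomial n a).eval (cosF 1 x) : ℝ) : ℂ) * v x =
          (a : ℂ) * (((cosF 1 x ^ n : ℝ) : ℂ) * v x) := fun x => by
        rw [Polynomial.eval_monomial]; push_cast; ring
      simp only [e]
      rw [integral_const_mul, h, mul_zero]
  let c₁ : C(Icc (-1 : ℝ) 1, ℝ) := ⟨fun x => cosF 1 x, by fun_prop⟩
  -- The argument of the cosine runs through `[0,π]`, where the cosine is injective. By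
  -- Stone–Weierstrass, polynomials in `cosF 1` are thus dense in the continuous functions on
  -- `[-1,1]`.
  have hsep : (Algebra.adjoin ℝ {c₁}).SeparatesPoints := by
    intro x y hxy
    refine ⟨c₁, ⟨c₁, Algebra.subset_adjoin rfl, rfl⟩, fun hc => hxy (Subtype.ext ?_)⟩
    have hpi := Real.pi_pos
    have hm : ∀ z : Icc (-1 : ℝ) 1, freq 1 * ((z : ℝ) + 1) ∈ Icc 0 Real.pi := fun z => by
      have h1 := z.2.1
      have h2 := z.2.2
      simp only [freq]
      push_cast
      constructor <;> nlinarith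
    have := Real.injOn_cos (hm x) (hm y) hc
    have hf : freq 1 ≠ 0 := by simp [freq, hpi.ne']
    have := mul_left_cancel₀ hf this
    linarith
  have hcont : ∀ g : ℝ → ℝ, Continuous g → ∫ x, g x • v x ∂muI = 0 := by
    intro g hg
    have hgi : Integrable (fun x => g x • v x) muI := by
      simp only [Complex.real_smul]
      exact integrable_continuous_mul hv (Complex.continuous_ofReal.comp hg)
    have hle : ∀ ε > 0, ‖∫ x, g x • v x ∂muI‖ ≤ ε * ∫ x, ‖v x‖ ∂muI := by
      intro ε hε
      obtain ⟨⟨q, hq⟩, hqe⟩ := ContinuousMap.exists_mem_subalgebra_near_continuous_of_separatesPoints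
        (Algebra.adjoin ℝ {c₁}) hsep (fun x : Icc (-1 : ℝ) 1 => g x) (by fun_prop) ε hε
      rw [Algebra.adjoin_singleton_eq_range_aeval] at hq
      obtain ⟨p, rfl⟩ := hq
      have hqe' : ∀ x ∈ Icc (-1 : ℝ) 1, |p.eval (cosF 1 x) - g x| < ε := fun x hx => by
        have := hqe ⟨x, hx⟩
        rw [Real.norm_eq_abs] at this
        have e : ((Polynomial.aeval c₁) p : C(Icc (-1 : ℝ) 1, ℝ)) ⟨x, hx⟩ = p.eval (cosF 1 x) := by
          rw [Polynomial.aeval_continuousMap_apply]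
          rfl
        simpa [e] using this
      have hpi : Integrable (fun x => ((p.eval (cosF 1 x) : ℝ) : ℂ) * v x) muI := by
        exact integrable_continuous_mul hv
          (Complex.continuous_ofReal.comp (p.continuous.comp (continuous_cosF 1)))
      have e : ∫ x, g x • v x ∂muI = ∫ x, (g x • v x - ((p.eval (cosF 1 x) : ℝ) : ℂ) * v x) ∂muI := by
        rw [integral_sub hgi hpi, hpoly p, sub_zero]
      rw [e, ← integral_const_mul]
      refine norm_integral_le_of_norm_le (hv.norm.const_mul ε)
        ((ae_restrict_iff' measurableSet_Ioo).2 (ae_of_all _ fun x hx => ?_))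
      rw [Complex.real_smul, ← sub_mul, norm_mul, ← Complex.ofReal_sub, Complex.norm_real,
        Real.norm_eq_abs, abs_sub_comm]
      exact mul_le_mul_of_nonneg_right (hqe' x (Ioo_subset_Icc_self hx)).le (norm_nonneg _)
    have h0 : ‖∫ x, g x • v x ∂muI‖ ≤ 0 := by
      refine le_of_forall_pos_le_add fun δ hδ => ?_
      have hI : 0 ≤ ∫ x, ‖v x‖ ∂muI := integral_nonneg fun x => norm_nonneg _
      refine (hle (δ / ((∫ x, ‖v x‖ ∂muI) + 1)) (by positivity)).trans ?_
      rw [zero_add, div_mul_eq_mul_div, div_le_iff₀ (by positivity)]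
      nlinarith
    exact norm_le_zero_iff.1 h0
  have := isOpen_Ioo.ae_eq_zero_of_integral_contDiff_smul_eq_zero (μ := volume)
    (IntegrableOn.locallyIntegrableOn hv) fun g hg _ hgs => by
    rw [← hcont g hg.continuous]
    exact (setIntegral_eq_integral_of_forall_compl_eq_zero fun x hx => by
      rw [image_eq_zero_of_notMem_tsupport (fun h => hx (hgs h)), zero_smul]).symm
  exact (ae_restrict_iff' measurableSet_Ioo).2 this

theorem integrable_L2I (v : L2I) : Integrable v muI :=
  (Lp.memLp v).integrable (by norm_num)

theorem sinF_zero (x : ℝ) : sinF 0 x = 0 := by simp [sinF, freq]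

/-- This three-term relation turns orthogonality to all sines into orthogonality to all products of
sines with powers of `cosF 1`. -/
theorem two_cosF_mul_sinF (k : ℕ) (x : ℝ) :
    2 * cosF 1 x * sinF (k + 1) x = sinF (k + 2) x + sinF k x := by
  have e1 : freq (k + 2) * (x + 1) = freq (k + 1) * (x + 1) + freq 1 * (x + 1) := by
    simp only [freq]; push_cast; ring
  have e2 : freq k * (x + 1) = freq (k + 1) * (x + 1) - freq 1 * (x + 1) := by
    simp only [freq]; push_cast; ring
  simp only [sinF, cosF]
  rw [e1, e2, Real.sin_add, Real.sin_sub]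
  ring

theorem two_cosF_mul_cosF (k : ℕ) (x : ℝ) :
    2 * cosF 1 x * cosF (k + 1) x = cosF (k + 2) x + cosF k x := by
  have e1 : freq (k + 2) * (x + 1) = freq (k + 1) * (x + 1) + freq 1 * (x + 1) := by
    simp only [freq]; push_cast; ring
  have e2 : freq k * (x + 1) = freq (k + 1) * (x + 1) - freq 1 * (x + 1) := by
    simp only [freq]; push_cast; ring
  simp only [cosF]
  rw [e1, e2, Real.cos_add, Real.cos_sub]
  ring

theorem cosF_zero (x : ℝ) : cosF 0 x = 1 := by simp [cosF, freq]

/-- Orthogonality to a family closed under multiplication by `cosF 1` passes to the products with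
powers of `cosF 1`. -/
theorem integral_cosF_pow_mul {e : ℕ → ℝ → ℝ} (he : ∀ k, Continuous (e k))
    (h0 : (∀ x, e 0 x = 0) ∨ ∀ x, cosF 1 x * e 0 x = e 1 x)
    (hs : ∀ k x, 2 * cosF 1 x * e (k + 1) x = e (k + 2) x + e k x) {v : ℝ → ℂ}
    (hv : Integrable v muI) (h : ∀ k, ∫ x, (e k x : ℂ) * v x ∂muI = 0) (m : ℕ) :
    ∀ k, ∫ x, ((cosF 1 x ^ m * e k x : ℝ) : ℂ) * v x ∂muI = 0 := by
  induction m with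
  | zero => simpa using h
  | succ m ih =>
    have hi : ∀ k, Integrable (fun x => ((cosF 1 x ^ m * e k x : ℝ) : ℂ) * v x) muI := fun k =>
      integrable_continuous_mul hv (Complex.continuous_ofReal.comp
        (((continuous_cosF 1).pow m).mul (he k)))
    rintro (_ | k)
    · rcases h0 with h0 | h0
      · simp [h0]
      · rw [← ih 1]
        refine integral_congr_ae (ae_of_all _ fun x => ?_)
        simp only
        rw [← h0 x]
        ring_nf
    · have e1 : ∀ x, ((cosF 1 x ^ (m + 1) * e (k + 1) x : ℝ) : ℂ) * v x =
          (1 / 2 : ℂ) * (((cosF 1 x ^ m * e (k + 2) x : ℝ) : ℂ) * v x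
            + ((cosF 1 x ^ m * e k x : ℝ) : ℂ) * v x) := fun x => by
        have h1 : cosF 1 x ^ (m + 1) * e (k + 1) x =
          1 / 2 * (cosF 1 x ^ m * e (k + 2) x + cosF 1 x ^ m * e k x) := by
          rw [← mul_add, ← hs]; ring
        rw [h1]
        push_cast
        ring
      simp only [e1]
      rw [integral_const_mul, integral_add (hi _) (hi _), ih, ih]
      simp

/-- By the three-term relation, `sinF 1 · v` is orthogonal to every power of `cosF 1`, hence zero;
and `sinF 1` is positive on `(-1,1)`. -/
theorem eq_zero_of_inner_sinL {v : L2I} (h : ∀ k, inner ℂ (sinL k) v = 0) : v = 0 := by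
  have hv := integrable_L2I v
  have h1 := integral_cosF_pow_mul (e := sinF) continuous_sinF (Or.inl sinF_zero) two_cosF_mul_sinF
    hv (fun k => by rw [← inner_sinL, h])
  have h2 := ae_eq_zero_of_integral_cosF_pow (v := fun x => (sinF 1 x : ℂ) * v x)
    (integrable_continuous_mul hv (by fun_prop)) fun m => by
      rw [← h1 m 1]
      refine integral_congr_ae (ae_of_all _ fun x => ?_)
      push_cast
      ring
  rw [Lp.eq_zero_iff_ae_eq_zero]
  filter_upwards [h2, ae_restrict_mem measurableSet_Ioo] with x hx hx'
  refine (mul_eq_zero.1 hx).resolve_left ?_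
  have hpi := Real.pi_pos
  have : 0 < sinF 1 x := by
    unfold sinF freq
    push_cast
    apply Real.sin_pos_of_pos_of_lt_pi <;> nlinarith [hx'.1, hx'.2]
  exact_mod_cast this.ne'

theorem eq_zero_of_inner_cosL {v : L2I} (h : ∀ k, inner ℂ (cosL k) v = 0) : v = 0 := by
  have hv := integrable_L2I v
  have h1 := integral_cosF_pow_mul (e := cosF) continuous_cosF
    (Or.inr fun x => by rw [cosF_zero, mul_one]) two_cosF_mul_cosF
    hv (fun k => by rw [← inner_cosL, h])
  have h2 := ae_eq_zero_of_integral_cosF_pow hv fun m => by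
      rw [← h1 m 0]
      simp only [cosF_zero, mul_one]
  rw [Lp.eq_zero_iff_ae_eq_zero]
  exact h2

/-- Partial sums of the sine series. -/
def sinProj (N : ℕ) (v : L2I) : L2I := ∑ k ∈ Finset.range N, inner ℂ (sinL k) v • sinL k

/-- Partial sums of the cosine series, without the constant term. -/
def cosProj (N : ℕ) (v : L2I) : L2I :=
  ∑ k ∈ Finset.range N, inner ℂ (cosL (k + 1)) v • cosL (k + 1)

/-- The index `0` is kept among the sines, where it contributes nothing, so that sines and cosines
share frequencies and recursions. Orthonormality starts at index `1`, whence the shifts by one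
below. -/
theorem sinL_zero : sinL 0 = 0 := by
  rw [sinL, Lp.eq_zero_iff_ae_eq_zero]
  filter_upwards [coeFn_toL2 (φ := fun x => (sinF 0 x : ℂ)) (by fun_prop)] with x hx
  rw [hx]
  simp [sinF_zero]

theorem sinProj_succ (N : ℕ) (v : L2I) : sinProj (N + 1) v =
    ∑ k ∈ Finset.range N, inner ℂ (sinL (k + 1)) v • sinL (k + 1) := by
  rw [sinProj, Finset.sum_range_succ', sinL_zero, smul_zero, add_zero]

theorem Orthonormal.norm_sum_inner_le {H : Type*} [NormedAddCommGroup H] [InnerProductSpace ℂ H]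
    {e : ℕ → H} (he : Orthonormal ℂ e) (N : ℕ) (v : H) :
    ‖∑ k ∈ Finset.range N, inner ℂ (e k) v • e k‖ ≤ ‖v‖ := by
  have h1 := he.sum_inner_products_le (x := v) (s := Finset.range N)
  have h2 : ‖∑ k ∈ Finset.range N, inner ℂ (e k) v • e k‖ ^ 2 =
      ∑ k ∈ Finset.range N, ‖inner ℂ (e k) v‖ ^ 2 :=
    he.orthogonalFamily.norm_sum (fun k => inner ℂ (e k) v) (Finset.range N)
  exact (sq_le_sq₀ (norm_nonneg _) (norm_nonneg _)).1 (h2.trans_le h1)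

theorem tendsto_sinProj (v : L2I) : Tendsto (fun N => sinProj (N + 1) v) atTop (𝓝 v) := by
  let b := HilbertBasis.mkOfOrthogonalEqBot orthonormal_sinL (by
    rw [Submodule.eq_bot_iff]
    intro v hv
    refine eq_zero_of_inner_sinL fun k => ?_
    rcases k with _ | k
    · rw [sinL_zero, inner_zero_left]
    · exact hv _ (Submodule.subset_span ⟨k, rfl⟩))
  have := (b.hasSum_repr v).tendsto_sum_nat
  simp only [b.repr_apply_apply, b, HilbertBasis.coe_mkOfOrthogonalEqBot] at this
  simpa only [sinProj_succ] using this

theorem norm_sinProj_le (N : ℕ) (v : L2I) : ‖sinProj (N + 1) v‖ ≤ ‖v‖ := by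
  rw [sinProj_succ]
  exact Orthonormal.norm_sum_inner_le orthonormal_sinL N v

theorem norm_cosProj_le (N : ℕ) (v : L2I) : ‖cosProj N v‖ ≤ ‖v‖ :=
  Orthonormal.norm_sum_inner_le orthonormal_cosL N v

/-- The constant is left out of `cosProj`. The series converges by Bessel, and its sum has the same
coefficients as `v`, the zeroth one by hypothesis; completeness of the cosines concludes. -/
theorem tendsto_cosProj {v : L2I} (hv : inner ℂ (cosL 0) v = 0) :
    Tendsto (fun N => cosProj N v) atTop (𝓝 v) := by
  have hon := orthonormal_cosL
  have hsum : Summable fun k => inner ℂ (cosL (k + 1)) v • cosL (k + 1) := by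
    exact (hon.orthogonalFamily.summable_iff_norm_sq_summable
      (fun k => inner ℂ (cosL (k + 1)) v)).2 (hon.inner_products_summable v)
  have hlim := hsum.hasSum.tendsto_sum_nat
  set L := ∑' k, inner ℂ (cosL (k + 1)) v • cosL (k + 1)
  have hL : v - L = 0 := by
    refine eq_zero_of_inner_cosL fun k => ?_
    have hk : HasSum (fun j => inner ℂ (cosL k) (inner ℂ (cosL (j + 1)) v • cosL (j + 1)))
      (inner ℂ (cosL k) L) := hsum.hasSum.mapL (innerSL ℂ (cosL k))
    have horth : ∀ i j, i ≠ j → inner ℂ (cosL i) (cosL j) = 0 := fun i j hij => by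
      rw [inner_cosL_cosL, integral_cosF_mul_ne hij]; simp
    simp only [inner_smul_right] at hk
    rw [inner_sub_right]
    rcases k with _ | k
    · have : inner ℂ (cosL 0) L = 0 := by
        refine hk.unique ?_
        convert hasSum_zero using 2 with j
        rw [horth 0 (j + 1) (by omega), mul_zero]
      rw [hv, this, sub_zero]
    · have : inner ℂ (cosL (k + 1)) L = inner ℂ (cosL (k + 1)) v := by
        refine hk.unique ?_
        convert hasSum_single k ?_ using 1
        · have := hon.1 k
          rw [inner_self_eq_norm_sq_to_K, this]; simp
        · intro j hj
          rw [horth (k + 1) (j + 1) (by omega), mul_zero]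
      rw [this, sub_self]
  rwa [← sub_eq_zero.1 hL] at hlim

/-! ### Membership in `H¹₀` and integration by parts -/

open scoped ContDiff

theorem norm_sq_L2I (v : L2I) : ‖v‖ ^ 2 = ∫ x, ‖v x‖ ^ 2 ∂muI := by
  have h1 : inner ℂ v v = ((‖v‖ ^ 2 : ℝ) : ℂ) := by
    rw [inner_self_eq_norm_sq_to_K]; push_cast; rfl
  rw [L2.inner_def] at h1
  have h2 : ∀ x, inner ℂ (v x) (v x) = ((‖v x‖ ^ 2 : ℝ) : ℂ) := fun x => by
    rw [inner_self_eq_norm_sq_to_K]; push_cast; rfl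
  simp only [h2] at h1
  rw [integral_complex_ofReal] at h1
  exact_mod_cast h1.symm

theorem tendsto_toL2 {φ : ℕ → ℝ → ℂ} {ψ : ℝ → ℂ} (hφ : ∀ n, Continuous (φ n)) (hψ : Continuous ψ)
    {B : ℝ} (hB : ∀ n, ∀ x ∈ Ioo (-1 : ℝ) 1, ‖φ n x‖ ≤ B)
    (hlim : ∀ x ∈ Ioo (-1 : ℝ) 1, Tendsto (fun n => φ n x) atTop (𝓝 (ψ x))) :
    Tendsto (fun n => toL2 (φ n) (hφ n)) atTop (𝓝 (toL2 ψ hψ)) := by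
  rw [tendsto_iff_norm_sub_tendsto_zero]
  have hsq : Tendsto (fun n => ‖toL2 (φ n) (hφ n) - toL2 ψ hψ‖ ^ 2) atTop (𝓝 0) := by
    have e : ∀ n, ‖toL2 (φ n) (hφ n) - toL2 ψ hψ‖ ^ 2 = ∫ x, ‖φ n x - ψ x‖ ^ 2 ∂muI := fun n => by
      rw [norm_sq_L2I]
      refine integral_congr_ae ?_
      filter_upwards [coeFn_toL2 (hφ n), coeFn_toL2 hψ, Lp.coeFn_sub (toL2 (φ n) (hφ n)) (toL2 ψ hψ)]
        with x h1 h2 h3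
      rw [h3, Pi.sub_apply, h1, h2]
    simp only [e]
    have hz : (0 : ℝ) = ∫ x, (0 : ℝ) ∂muI := by simp
    rw [hz]
    have hBψ : ∀ x ∈ Ioo (-1 : ℝ) 1, ‖ψ x‖ ≤ B := fun x hx =>
      le_of_tendsto (hlim x hx).norm (Eventually.of_forall fun n => hB n x hx)
    refine tendsto_integral_of_dominated_convergence (fun _ => (B + B) ^ 2) ?_
      (integrable_const _) ?_ ?_
    · intro n
      exact (((hφ n).sub hψ).norm.pow 2).aestronglyMeasurable
    · intro n
      filter_upwards [ae_restrict_mem measurableSet_Ioo] with x hx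
      rw [Real.norm_eq_abs, abs_of_nonneg (by positivity)]
      have := norm_sub_le (φ n x) (ψ x)
      have h1 := hB n x hx
      have h2 := hBψ x hx
      gcongr
      linarith
    · filter_upwards [ae_restrict_mem measurableSet_Ioo] with x hx
      have := (((hlim x hx).sub_const (ψ x)).norm).pow 2
      simpa using this
  have := hsq.sqrt
  simpa [Real.sqrt_sq (norm_nonneg _)] using this

/-- A cutoff function equal to `0` near `±1`, and to `1` away from these points. -/
def endCutoff (n : ℕ) (x : ℝ) : ℝ := Real.smoothTransition ((1 - x ^ 2) * (n + 1) - 1)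

theorem abs_endCutoff_le (n : ℕ) (x : ℝ) : |endCutoff n x| ≤ 1 := by
  unfold endCutoff
  rw [abs_of_nonneg (Real.smoothTransition.nonneg _)]
  exact Real.smoothTransition.le_one _

theorem contDiff_endCutoff (n : ℕ) : ContDiff ℝ ∞ (endCutoff n) := by
  unfold endCutoff
  exact Real.smoothTransition.contDiff.comp (by fun_prop)

theorem hasDerivAt_endCutoff (n : ℕ) (x : ℝ) : HasDerivAt (endCutoff n)
    (deriv Real.smoothTransition ((1 - x ^ 2) * (n + 1) - 1) * (-2 * x * (n + 1))) x := by
  have h1 : HasDerivAt (fun x : ℝ => (1 - x ^ 2) * ((n : ℝ) + 1) - 1) (-2 * x * (n + 1)) x := by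
    refine (((((hasDerivAt_id x).pow 2).const_sub 1).mul_const ((n : ℝ) + 1)).sub_const 1).congr_deriv ?_
    simp
  have h2 : HasDerivAt Real.smoothTransition _ ((1 - x ^ 2) * (n + 1) - 1) :=
    ((Real.smoothTransition.contDiff (n := 1)).differentiable (by norm_num) _).hasDerivAt
  exact h2.comp x h1

theorem deriv_smoothTransition_of_one_lt {y : ℝ} (hy : 1 < y) :
    deriv Real.smoothTransition y = 0 := by
  have : Real.smoothTransition =ᶠ[𝓝 y] fun _ => 1 := by
    filter_upwards [lt_mem_nhds hy] with z hz
    exact Real.smoothTransition.one_of_one_le hz.le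
  rw [this.deriv_eq, deriv_const]

theorem tsupport_endCutoff_mul (n : ℕ) (f : ℝ → ℂ) :
    tsupport (fun x => (endCutoff n x : ℂ) * f x) ⊆ Ioo (-1) 1 ∧
      HasCompactSupport fun x => (endCutoff n x : ℂ) * f x := by
  have hcl : IsClosed {x : ℝ | 1 ≤ (1 - x ^ 2) * (n + 1)} := by
    apply isClosed_le <;> fun_prop
  have hsub : tsupport (fun x => (endCutoff n x : ℂ) * f x) ⊆ {x : ℝ | 1 ≤ (1 - x ^ 2) * (n + 1)} := by
    refine closure_minimal (fun x hx => ?_) hcl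
    by_contra h
    rw [mem_ofPred_eq, not_le] at h
    refine hx ?_
    have : endCutoff n x = 0 := Real.smoothTransition.zero_of_nonpos (by linarith)
    simp [this]
  have hsub' : {x : ℝ | 1 ≤ (1 - x ^ 2) * (n + 1)} ⊆ Ioo (-1) 1 := fun x hx => by
    rw [mem_ofPred_eq] at hx
    have hn : (0 : ℝ) < n + 1 := by positivity
    have : 0 < 1 - x ^ 2 := by
      by_contra h
      rw [not_lt] at h
      nlinarith
    constructor <;> nlinarith
  refine ⟨hsub.trans hsub', ?_⟩
  exact isCompact_Icc.of_isClosed_subset isClosed_closure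
    ((hsub.trans hsub').trans Ioo_subset_Icc_self)

/-- Vanishing to first order at both endpoints. This compensates the derivative of the cutoff, of
size `n`, in a layer of width of order `1 / n`. -/
theorem abs_sinF_le (k : ℕ) {x : ℝ} (hx : x ∈ Ioo (-1 : ℝ) 1) : |sinF k x| ≤ freq k * (1 - x ^ 2) := by
  have hf := freq_nonneg k
  have h1 : |sinF k x| ≤ freq k * (1 + x) := by
    refine (Real.abs_sin_le_abs).trans ?_
    rw [abs_of_nonneg (mul_nonneg hf (by linarith [hx.1]))]
    linarith
  have h2 : |sinF k x| ≤ freq k * (1 - x) := by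
    have e : |sinF k x| = |Real.sin (freq k * (1 - x))| := by
      have e1 : freq k * (x + 1) = k * Real.pi - freq k * (1 - x) := by
        simp only [freq]; ring
      rw [sinF, e1, Real.sin_sub, Real.sin_nat_mul_pi, zero_mul, zero_sub, abs_neg, abs_mul,
        Real.cos_nat_mul_pi, abs_pow, abs_neg, abs_one, one_pow, one_mul]
    rw [e]
    refine (Real.abs_sin_le_abs).trans ?_
    rw [abs_of_nonneg (mul_nonneg hf (by linarith [hx.2]))]
  rcases le_total 0 x with h | h
  · have : 1 - x ≤ 1 - x ^ 2 := by nlinarith [hx.2]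
    exact h2.trans (by gcongr)
  · have : 1 + x ≤ 1 - x ^ 2 := by nlinarith [hx.1]
    exact h1.trans (by gcongr)

/-- The sine functions belong to `H¹₀(-1,1)`. -/
theorem hasH10Deriv_sinL (k : ℕ) : HasH10Deriv (sinL k) ((freq k : ℂ) • cosL k) := by
  obtain ⟨D, hD⟩ := (isCompact_Icc (a := (-1 : ℝ)) (b := 1)).exists_bound_of_continuousOn
    ((Real.smoothTransition.contDiff (n := 1)).continuous_deriv le_rfl).continuousOn
  have hD0 : 0 ≤ D := (norm_nonneg _).trans (hD 0 (by simp))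
  let φ : ℕ → ℝ → ℂ := fun n x => (endCutoff n x : ℂ) * (sinF k x : ℂ)
  let φ' : ℕ → ℝ → ℂ := fun n x =>
    ((deriv Real.smoothTransition ((1 - x ^ 2) * (n + 1) - 1) * (-2 * x * (n + 1)) * sinF k x
      + endCutoff n x * (freq k * cosF k x) : ℝ) : ℂ)
  have hsinC : ContDiff ℝ ∞ (sinF k) := by
    unfold sinF; exact Real.contDiff_sin.comp (by fun_prop)
  have hφC : ∀ n, ContDiff ℝ ∞ (φ n) := fun n =>
    (Complex.ofRealCLM.contDiff.comp (contDiff_endCutoff n)).mul (Complex.ofRealCLM.contDiff.comp hsinC)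
  have hφd : ∀ n x, HasDerivAt (φ n) (φ' n x) x := fun n x => by
    have := ((hasDerivAt_endCutoff n x).mul (hasDerivAt_sinF k x)).ofReal_comp
    refine this.congr_of_eventuallyEq (Eventually.of_forall fun y => ?_)
    simp [φ]
  have hderiv : ∀ n, deriv (φ n) = φ' n := fun n => funext fun x => (hφd n x).deriv
  have hφ'c : ∀ n, Continuous (φ' n) := fun n => by
    rw [← hderiv n]
    exact (hφC n).continuous_deriv (by norm_num)
  have hlim1 : Tendsto (fun n => toL2 (φ n) (hφC n).continuous) atTop (𝓝 (sinL k)) := by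
    refine tendsto_toL2 _ _ (B := 1) ?_ ?_
    · intro n x _
      simp only [φ, norm_mul, Complex.norm_real, Real.norm_eq_abs]
      have h1 : |endCutoff n x| ≤ 1 :=
        abs_endCutoff_le n x
      have h2 : |sinF k x| ≤ 1 := Real.abs_sin_le_one _
      exact mul_le_one₀ h1 (abs_nonneg _) h2
    · intro x hx
      refine tendsto_const_nhds.congr' ?_
      have h0 : 0 < 1 - x ^ 2 := by nlinarith [hx.1, hx.2]
      have := (tendsto_natCast_atTop_atTop (R := ℝ)).eventually_ge_atTop (2 / (1 - x ^ 2))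
      filter_upwards [this] with n hn
      rw [div_le_iff₀ h0] at hn
      simp only [φ, endCutoff]
      rw [Real.smoothTransition.one_of_one_le (by nlinarith)]
      simp
  have hlim2 : Tendsto (fun n => toL2 (φ' n) (hφ'c n)) atTop (𝓝 ((freq k : ℂ) • cosL k)) := by
    have e : (freq k : ℂ) • cosL k = toL2 (fun x => (freq k : ℂ) * (cosF k x : ℂ)) (by fun_prop) := by
      apply Lp.ext
      filter_upwards [coeFn_toL2 (φ := fun x => (freq k : ℂ) * (cosF k x : ℂ)) (by fun_prop),
        coeFn_toL2 (φ := fun x => (cosF k x : ℂ)) (by fun_prop),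
        Lp.coeFn_smul (freq k : ℂ) (cosL k)] with x h1 h2 h3
      rw [h1, h3, Pi.smul_apply, cosL, h2, smul_eq_mul]
    rw [e]
    refine tendsto_toL2 _ _ (B := 4 * D * freq k + freq k) ?_ ?_
    · intro n x hx
      simp only [φ', Complex.norm_real, Real.norm_eq_abs]
      have h0 : 0 < 1 - x ^ 2 := by nlinarith [hx.1, hx.2]
      have hf := freq_nonneg k
      have hn : (0 : ℝ) < n + 1 := by positivity
      have h1 : |endCutoff n x| ≤ 1 :=
        abs_endCutoff_le n x
      have h2 : |endCutoff n x * (freq k * cosF k x)| ≤ freq k := by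
        rw [abs_mul, abs_mul, abs_of_nonneg hf]
        have : |cosF k x| ≤ 1 := Real.abs_cos_le_one _
        calc |endCutoff n x| * (freq k * |cosF k x|) ≤ 1 * (freq k * 1) := by gcongr
          _ = _ := by ring
      -- The derivative of the cutoff vanishes unless `(1 - x²)(n + 1) ≤ 2`. There the factor `n +
      -- 1` is absorbed by the factor `1 - x²` from `abs_sinF_le`, which gives a bound uniform in
      -- `n`.
      have h3 : |deriv Real.smoothTransition ((1 - x ^ 2) * (n + 1) - 1) * (-2 * x * (n + 1))
          * sinF k x| ≤ 4 * D * freq k := by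
        rcases lt_or_ge 1 ((1 - x ^ 2) * ((n : ℝ) + 1) - 1) with h | h
        · rw [deriv_smoothTransition_of_one_lt h]
          simp only [zero_mul, abs_zero]
          positivity
        · have h4 := hD ((1 - x ^ 2) * ((n : ℝ) + 1) - 1) ⟨by nlinarith, h⟩
          rw [Real.norm_eq_abs] at h4
          have h5 : |-2 * x * ((n : ℝ) + 1)| ≤ 2 * (n + 1) := by
            rw [abs_mul, abs_mul, abs_of_pos hn]
            have : |x| ≤ 1 := abs_le.2 ⟨hx.1.le, hx.2.le⟩
            rw [abs_neg, abs_two]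
            nlinarith
          rw [abs_mul, abs_mul]
          calc _ ≤ D * (2 * ((n : ℝ) + 1)) * (freq k * (1 - x ^ 2)) := by
                gcongr
                exact abs_sinF_le k hx
            _ = 2 * D * freq k * ((1 - x ^ 2) * ((n : ℝ) + 1)) := by ring
            _ ≤ 2 * D * freq k * 2 := by
                gcongr
                linarith
            _ = _ := by ring
      exact (abs_add_le _ _).trans (add_le_add h3 h2)
    · intro x hx
      refine tendsto_const_nhds.congr' ?_
      have h0 : 0 < 1 - x ^ 2 := by nlinarith [hx.1, hx.2]
      have := (tendsto_natCast_atTop_atTop (R := ℝ)).eventually_ge_atTop (2 / (1 - x ^ 2))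
      filter_upwards [this] with n hn
      rw [div_le_iff₀ h0] at hn
      simp only [φ', endCutoff]
      rw [Real.smoothTransition.one_of_one_le (by nlinarith),
        deriv_smoothTransition_of_one_lt (by nlinarith)]
      simp
  refine mem_closure_of_tendsto (hlim1.prodMk_nhds hlim2) (Eventually.of_forall fun n => ?_)
  let Φ : TestFunction openI ℂ ⊤ :=
    ⟨φ n, hφC n, (tsupport_endCutoff_mul n _).2, (tsupport_endCutoff_mul n _).1⟩
  refine ⟨Φ, coeFn_toL2 (hφC n).continuous, ?_⟩
  refine (coeFn_toL2 (hφ'c n)).trans (Eventually.of_forall fun x => ?_)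
  change φ' n x = deriv (φ n) x
  rw [hderiv]

/-- Integration by parts against cosines for elements of `H¹₀(-1,1)`. -/
theorem HasH10Deriv.inner_cosL {u v : L2I} (h : HasH10Deriv u v) (k : ℕ) :
    inner ℂ (cosL k) v = freq k * inner ℂ (sinL k) u := by
  have hcl : IsClosed {q : L2I × L2I | inner ℂ (cosL k) q.2 = freq k * inner ℂ (sinL k) q.1} :=
    isClosed_eq (continuous_const.inner continuous_snd)
      (continuous_const.mul (continuous_const.inner continuous_fst))
  refine closure_minimal ?_ hcl h
  rintro ⟨u, v⟩ ⟨φ, hu, hv⟩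
  simp only [mem_ofPred_eq]
  have hφC : ContDiff ℝ 1 φ := φ.contDiff.of_le (by exact_mod_cast le_top)
  have hφd : ∀ x, HasDerivAt φ (deriv φ x) x := fun x =>
    (hφC.differentiable (by norm_num) x).hasDerivAt
  have hφ'c : Continuous (deriv φ) := hφC.continuous_deriv le_rfl
  have hφc := hφC.continuous
  have hz : ∀ x ∉ Ioo (-1 : ℝ) 1, φ x = 0 := fun x hx =>
    image_eq_zero_of_notMem_tsupport fun h => hx (φ.tsupport_subset h)
  rw [HeatCarleman.inner_cosL, inner_sinL]
  have e1 : ∫ x, (cosF k x : ℂ) * v x ∂muI = ∫ x, (cosF k x : ℂ) * deriv φ x ∂muI :=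
    integral_congr_ae (by filter_upwards [hv] with x hx; rw [hx])
  have e2 : ∫ x, (sinF k x : ℂ) * u x ∂muI = ∫ x, (sinF k x : ℂ) * φ x ∂muI :=
    integral_congr_ae (by filter_upwards [hu] with x hx; rw [hx])
  rw [e1, e2, ← integral_const_mul, ← sub_eq_zero, ← integral_sub
    (integrable_muI (by fun_prop)) (integrable_muI (by fun_prop))]
  rw [integral_Ioo_eq_sub (f := fun x => (cosF k x : ℂ) * φ x) (by norm_num)]
  · rw [hz 1 (by simp), hz (-1) (by simp)]; simp
  · intro x _
    refine ((hasDerivAt_cosF k x).ofReal_comp.mul (hφd x)).congr_deriv ?_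
    push_cast
    ring
  · fun_prop

/-! ### The du Bois-Reymond lemma -/

theorem deriv_smoothTransition_nonneg (y : ℝ) : 0 ≤ deriv Real.smoothTransition y :=
  Real.smoothTransition.monotone.deriv_nonneg

theorem deriv_smoothTransition_of_neg {y : ℝ} (hy : y < 0) : deriv Real.smoothTransition y = 0 := by
  have : Real.smoothTransition =ᶠ[𝓝 y] fun _ => 0 := by
    filter_upwards [gt_mem_nhds hy] with z hz
    exact Real.smoothTransition.zero_of_nonpos hz.le
  rw [this.deriv_eq, deriv_const]

/-- A smooth step from `0` at `α` to `1` at `α + 1 / n`. -/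
def step (α n t : ℝ) : ℝ := Real.smoothTransition ((t - α) * n)

theorem hasDerivAt_step (α n t : ℝ) :
    HasDerivAt (step α n) (deriv Real.smoothTransition ((t - α) * n) * n) t := by
  have h1 : HasDerivAt (fun t : ℝ => (t - α) * n) n t := by
    refine (((hasDerivAt_id t).sub_const α).mul_const n).congr_deriv (by simp)
  have h2 : HasDerivAt Real.smoothTransition _ ((t - α) * n) :=
    ((Real.smoothTransition.contDiff (n := 1)).differentiable (by norm_num) _).hasDerivAt
  exact h2.comp t h1

theorem continuous_deriv_step (α n : ℝ) :
    Continuous fun t => deriv Real.smoothTransition ((t - α) * n) * n := by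
  have := (Real.smoothTransition.contDiff (n := 1)).continuous_deriv le_rfl
  fun_prop

/-- The derivatives of steadily steeper steps at `α` form an approximation of the Dirac mass. -/
theorem tendsto_integral_deriv_step {t₀ t₁ α : ℝ} (hα : α ∈ Ioo t₀ t₁) {q : ℝ → ℂ}
    (hq : ContinuousOn q (Icc t₀ t₁)) :
    Tendsto (fun n : ℕ => ∫ t in Ioo t₀ t₁,
      ((deriv Real.smoothTransition ((t - α) * n) * n : ℝ) : ℂ) * q t) atTop (𝓝 (q α)) := by
  rw [Metric.tendsto_atTop]
  intro ε hε
  have hqα := (hq α (Ioo_subset_Icc_self hα)).continuousAt (Icc_mem_nhds hα.1 hα.2)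
  obtain ⟨δ, hδ, hδq⟩ := Metric.continuousAt_iff.1 hqα (ε / 2) (by positivity)
  -- The kernel lives in `[α, α + 1 / n]`: the first bound keeps this within `δ` of `α`, the second
  -- inside the interval, so that the total mass is `1`.
  obtain ⟨n₀, hn₀⟩ := exists_nat_gt (max (1 / δ) (1 / (t₁ - α)))
  refine ⟨n₀, fun n hn => ?_⟩
  have h1 : (1 / δ) < n := (le_max_left _ _).trans_lt (hn₀.trans_le (by exact_mod_cast hn))
  have h2 : (1 / (t₁ - α)) < n := (le_max_right _ _).trans_lt (hn₀.trans_le (by exact_mod_cast hn))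
  have hn0 : (0 : ℝ) < n := (by positivity : 0 < 1 / δ).trans h1
  have hα1 : 0 < t₁ - α := by linarith [hα.2]
  rw [div_lt_iff₀ hδ] at h1
  rw [div_lt_iff₀ hα1] at h2
  set ρ : ℝ → ℝ := fun t => deriv Real.smoothTransition ((t - α) * n) * n with hρ
  have hρc : Continuous ρ := continuous_deriv_step α n
  have hρ0 : ∀ t, 0 ≤ ρ t := fun t => mul_nonneg (deriv_smoothTransition_nonneg _) hn0.le
  have hρi : ∫ t in Ioo t₀ t₁, ρ t = 1 := by
    rw [integral_Ioo_eq_sub (hα.1.trans hα.2).le (fun t _ => hasDerivAt_step α n t) hρc.continuousOn]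
    rw [step, step, Real.smoothTransition.one_of_one_le (by linarith),
      Real.smoothTransition.zero_of_nonpos (by nlinarith [hα.1]), sub_zero]
  have hρint : IntegrableOn ρ (Ioo t₀ t₁) :=
    (hρc.continuousOn.integrableOn_compact isCompact_Icc).mono_set Ioo_subset_Icc_self
  have hqint : IntegrableOn (fun t => (ρ t : ℂ) * q t) (Ioo t₀ t₁) :=
    (((Complex.continuous_ofReal.comp hρc).continuousOn.mul hq).integrableOn_compact
      isCompact_Icc).mono_set Ioo_subset_Icc_self
  have e : (∫ t in Ioo t₀ t₁, (ρ t : ℂ) * q t) - q α =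
      ∫ t in Ioo t₀ t₁, (ρ t : ℂ) * (q t - q α) := by
    have hρC : IntegrableOn (fun t => (ρ t : ℂ)) (Ioo t₀ t₁) := hρint.ofReal
    simp only [mul_sub]
    rw [integral_sub hqint (hρC.mul_const _), integral_mul_const, integral_complex_ofReal,
      hρi]
    simp
  rw [dist_eq_norm, e]
  have hb : ‖∫ t in Ioo t₀ t₁, (ρ t : ℂ) * (q t - q α)‖ ≤ ∫ t in Ioo t₀ t₁, ρ t * (ε / 2) := by
    refine norm_integral_le_of_norm_le (hρint.mul_const _) (ae_of_all _ fun t => ?_)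
    rw [norm_mul, Complex.norm_real, Real.norm_eq_abs, abs_of_nonneg (hρ0 t)]
    rcases lt_or_ge t α with h | h
    · have : ρ t = 0 := by
        simp only [hρ]; rw [deriv_smoothTransition_of_neg (by nlinarith), zero_mul]
      rw [this]; simp
    · rcases lt_or_ge 1 ((t - α) * n) with h' | h'
      · have : ρ t = 0 := by
          simp only [hρ]; rw [deriv_smoothTransition_of_one_lt h', zero_mul]
        rw [this]; simp
      · have hd : dist t α < δ := by
          rw [Real.dist_eq, abs_of_nonneg (by linarith)]
          by_contra hc
          rw [not_lt] at hc
          nlinarith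
        have := (hδq hd).le
        rw [dist_eq_norm] at this
        exact mul_le_mul_of_nonneg_left this (hρ0 t)
  rw [integral_mul_const, hρi] at hb
  linarith

/-- The du Bois-Reymond lemma: a continuous function with integrable distributional derivative is
a primitive of it. -/
theorem eq_add_integral_of_weak_deriv {t₀ t₁ : ℝ} (ht : t₀ < t₁) {q m : ℝ → ℂ}
    (hq : ContinuousOn q (Icc t₀ t₁)) (hm : IntegrableOn m (Ioo t₀ t₁))
    (h : ∀ η : ℝ → ℝ, ContDiff ℝ ∞ η → HasCompactSupport η → tsupport η ⊆ Ioo t₀ t₁ →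
      ∫ t in Ioo t₀ t₁, (((deriv η t : ℝ) : ℂ) * q t + (η t : ℂ) * m t) = 0) :
    ∀ t ∈ Icc t₀ t₁, q t = q t₀ + ∫ s in t₀..t, m s := by
  have hmI : IntervalIntegrable m volume t₀ t₁ :=
    (intervalIntegrable_iff_integrableOn_Ioo_of_le ht.le).2 hm
  have hsubI : ∀ α ∈ Icc t₀ t₁, ∀ β ∈ Icc t₀ t₁, IntervalIntegrable m volume α β := fun α hα β hβ =>
    hmI.mono_set (by rw [uIcc_of_le ht.le]; exact uIcc_subset_Icc hα hβ)
  -- The test function is the difference of the steps at `α` and `β`. As they steepen, its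
  -- derivative tends to the difference of two Dirac masses, and it tends itself to the indicator of
  -- `(α,β]`.
  have key : ∀ α ∈ Ioo t₀ t₁, ∀ β ∈ Ioo t₀ t₁, α < β → q β - q α = ∫ s in α..β, m s := by
    intro α hα β hβ hαβ
    have l1 := (tendsto_integral_deriv_step hα hq).sub (tendsto_integral_deriv_step hβ hq)
    have l2 : Tendsto (fun n : ℕ => ∫ t in Ioo t₀ t₁, ((step α n t - step β n t : ℝ) : ℂ) * m t) atTop
        (𝓝 (∫ t in Ioo t₀ t₁, (Ioc α β).indicator m t)) := by
      refine tendsto_integral_of_dominated_convergence (fun t => ‖m t‖) ?_ hm.norm ?_ ?_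
      · intro n
        have : Continuous fun t => ((step α n t - step β n t : ℝ) : ℂ) := by
          unfold step
          have := Real.smoothTransition.continuous
          fun_prop
        exact this.aestronglyMeasurable.mul hm.aestronglyMeasurable
      · intro n
        refine ae_of_all _ fun t => ?_
        rw [norm_mul, Complex.norm_real, Real.norm_eq_abs]
        refine mul_le_of_le_one_left (norm_nonneg _) ?_
        have a1 := Real.smoothTransition.nonneg ((t - α) * n)
        have a2 := Real.smoothTransition.nonneg ((t - β) * n)
        have a3 := Real.smoothTransition.le_one ((t - α) * n)
        have a4 := Real.smoothTransition.le_one ((t - β) * n)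
        unfold step
        rw [abs_le]
        constructor <;> linarith
      · refine ae_of_all _ fun t => ?_
        have ev : ∀ γ < t, ∀ᶠ n : ℕ in atTop, step γ n t = 1 := fun γ hγ => by
          have := (tendsto_natCast_atTop_atTop (R := ℝ)).eventually_ge_atTop (1 / (t - γ))
          filter_upwards [this] with n hn
          rw [div_le_iff₀ (by linarith)] at hn
          exact Real.smoothTransition.one_of_one_le (by linarith)
        have ev0 : ∀ γ, t ≤ γ → ∀ n : ℕ, step γ n t = 0 := fun γ hγ n =>
          Real.smoothTransition.zero_of_nonpos
            (mul_nonpos_of_nonpos_of_nonneg (by linarith) (Nat.cast_nonneg n))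
        refine tendsto_const_nhds.congr' ?_
        rcases le_or_gt t α with h1 | h1
        · rw [indicator_of_notMem (fun h => absurd h.1 (not_lt.2 h1))]
          refine Eventually.of_forall fun n => ?_
          change (0 : ℂ) = ((step α n t - step β n t : ℝ) : ℂ) * m t
          rw [ev0 α h1, ev0 β (h1.trans hαβ.le)]; simp
        · rcases le_or_gt t β with h2 | h2
          · rw [indicator_of_mem (show t ∈ Ioc α β from ⟨h1, h2⟩)]
            filter_upwards [ev α h1] with n hn
            rw [hn, ev0 β h2]; simp
          · rw [indicator_of_notMem (fun h => absurd h.2 (not_le.2 h2))]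
            filter_upwards [ev α h1, ev β h2] with n hn hn'
            rw [hn, hn']; simp
    have e2 : ∫ t in Ioo t₀ t₁, (Ioc α β).indicator m t = ∫ s in α..β, m s := by
      have hsub : Ioc α β ⊆ Ioo t₀ t₁ := fun t ht => ⟨hα.1.trans ht.1, ht.2.trans_lt hβ.2⟩
      rw [intervalIntegral.integral_of_le hαβ.le, setIntegral_indicator measurableSet_Ioc,
        inter_eq_right.2 hsub]
    have l3 := l1.add l2
    have hz : ∀ᶠ n : ℕ in atTop, (∫ t in Ioo t₀ t₁,
        ((deriv Real.smoothTransition ((t - α) * n) * n : ℝ) : ℂ) * q t) - (∫ t in Ioo t₀ t₁,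
        ((deriv Real.smoothTransition ((t - β) * n) * n : ℝ) : ℂ) * q t)
        + ∫ t in Ioo t₀ t₁, ((step α n t - step β n t : ℝ) : ℂ) * m t = 0 := by
      have hβ1 : 0 < t₁ - β := by linarith [hβ.2]
      have := (tendsto_natCast_atTop_atTop (R := ℝ)).eventually_ge_atTop (2 / (t₁ - β))
      filter_upwards [this] with n hn
      have hn0 : (0 : ℝ) < n := (by positivity : 0 < 2 / (t₁ - β)).trans_le hn
      rw [div_le_iff₀ hβ1] at hn
      have hsub : tsupport (fun t => step α n t - step β n t) ⊆ Icc α (β + 1 / n) := by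
        refine closure_minimal (fun t htn => ?_) isClosed_Icc
        by_contra hcon
        refine htn ?_
        rw [mem_Icc, not_and_or, not_le, not_le] at hcon
        rcases hcon with h1 | h1
        · simp only [step]
          rw [Real.smoothTransition.zero_of_nonpos (by nlinarith),
            Real.smoothTransition.zero_of_nonpos (by nlinarith), sub_zero]
        · have h2 : 1 / (n : ℝ) < t - β := by linarith
          rw [div_lt_iff₀ hn0] at h2
          simp only [step]
          rw [Real.smoothTransition.one_of_one_le (by nlinarith),
            Real.smoothTransition.one_of_one_le (by nlinarith), sub_self]
      have hsub' : Icc α (β + 1 / n) ⊆ Ioo t₀ t₁ := by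
        have : 1 / (n : ℝ) < t₁ - β := by rw [div_lt_iff₀ hn0]; linarith
        exact Icc_subset_Ioo hα.1 (by linarith)
      have hη := h (fun t => step α n t - step β n t)
        (by
          unfold step
          exact (Real.smoothTransition.contDiff.comp (by fun_prop)).sub
            (Real.smoothTransition.contDiff.comp (by fun_prop)))
        (isCompact_Icc.of_isClosed_subset isClosed_closure hsub) (hsub.trans hsub')
      have hd : ∀ t, deriv (fun t => step α n t - step β n t) t =
          deriv Real.smoothTransition ((t - α) * n) * n - deriv Real.smoothTransition ((t - β) * n) * n :=
        fun t => ((hasDerivAt_step α n t).sub (hasDerivAt_step β n t)).deriv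
      have i1 : ∀ γ, IntegrableOn (fun t =>
          ((deriv Real.smoothTransition ((t - γ) * n) * n : ℝ) : ℂ) * q t) (Ioo t₀ t₁) := fun γ =>
        (((Complex.continuous_ofReal.comp (continuous_deriv_step γ n)).continuousOn.mul
          hq).integrableOn_compact isCompact_Icc).mono_set Ioo_subset_Icc_self
      have i2 : IntegrableOn (fun t => ((step α n t - step β n t : ℝ) : ℂ) * m t) (Ioo t₀ t₁) := by
        have hc : Continuous fun t => ((step α n t - step β n t : ℝ) : ℂ) := by
          unfold step
          have := Real.smoothTransition.continuous
          fun_prop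
        refine hm.bdd_mul (c := 1) hc.aestronglyMeasurable (ae_of_all _ fun t => ?_)
        rw [Complex.norm_real, Real.norm_eq_abs]
        have a1 := Real.smoothTransition.nonneg ((t - α) * n)
        have a2 := Real.smoothTransition.nonneg ((t - β) * n)
        have a3 := Real.smoothTransition.le_one ((t - α) * n)
        have a4 := Real.smoothTransition.le_one ((t - β) * n)
        unfold step
        rw [abs_le]
        constructor <;> linarith
      have e3 := integral_add ((i1 α).sub (i1 β)) i2
      simp only [Pi.sub_apply] at e3
      rw [← integral_sub (i1 α) (i1 β), ← e3, ← hη]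
      refine integral_congr_ae (ae_of_all _ fun t => ?_)
      simp only [hd]
      push_cast
      ring
    have l4 := tendsto_nhds_unique (l3.congr' (hz.mono fun n hn => hn)) tendsto_const_nhds
    rw [e2] at l4
    linear_combination -l4
  -- This difference is constant in the open interval by `key`, and up to the endpoints by
  -- continuity.
  set p : ℝ → ℂ := fun t => q t - ∫ s in t₀..t, m s with hp
  have hpc : ContinuousOn p (Icc t₀ t₁) := by
    refine hq.sub ?_
    have := intervalIntegral.continuousOn_primitive_interval' hmI left_mem_uIcc
    rwa [uIcc_of_le ht.le] at this
  set c := (t₀ + t₁) / 2 with hc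
  have hcI : c ∈ Ioo t₀ t₁ := ⟨by linarith, by linarith⟩
  have hpe : EqOn p (fun _ => p c) (Ioo t₀ t₁) := by
    have hlt : ∀ α ∈ Ioo t₀ t₁, ∀ β ∈ Ioo t₀ t₁, α < β → p β = p α := fun α hα β hβ hαβ => by
      have h0 : t₀ ∈ Icc t₀ t₁ := ⟨le_rfl, ht.le⟩
      have := intervalIntegral.integral_add_adjacent_intervals
        (hsubI t₀ h0 α (Ioo_subset_Icc_self hα))
        (hsubI α (Ioo_subset_Icc_self hα) β (Ioo_subset_Icc_self hβ))
      have k := key α hα β hβ hαβ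
      simp only [hp]
      linear_combination k + this
    intro t ht'
    rcases lt_trichotomy t c with h1 | h1 | h1
    · exact (hlt t ht' c hcI h1).symm
    · rw [h1]
    · exact hlt c hcI t ht' h1
  have hpe' : EqOn p (fun _ => p c) (Icc t₀ t₁) :=
    hpe.of_subset_closure hpc continuousOn_const Ioo_subset_Icc_self
      (by rw [closure_Ioo ht.ne])
  intro t ht'
  have h1 := hpe' ht'
  have h2 := hpe' (⟨le_rfl, ht.le⟩ : t₀ ∈ Icc t₀ t₁)
  simp only [hp, intervalIntegral.integral_same, sub_zero] at h1 h2
  linear_combination h1 - h2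

/-! ### Weak solutions and the equations of their sine coefficients -/

theorem lintegral_norm_sq_L2I (v : L2I) :
    ∫⁻ x, ENNReal.ofReal (‖v x‖ ^ 2) ∂muI = ENNReal.ofReal (‖v‖ ^ 2) := by
  rw [norm_sq_L2I, ofReal_integral_eq_lintegral_ofReal _ (ae_of_all _ fun x => by positivity)]
  exact (memLp_two_iff_integrable_sq_norm (Lp.aestronglyMeasurable v)).1 (Lp.memLp v)

/-- Fubini puts almost every slice in `L²`. Strong measurability of the slice map comes from its
sine series: the coefficients are partial integrals of a measurable function, and the partial sums
converge at every time. -/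
theorem exists_L2_section {t₀ t₁ : ℝ} {f : ℝ × ℝ → ℂ}
    (hf : AEStronglyMeasurable f (rectMeasure t₀ t₁))
    (hfin : ∫⁻ t in Ioo t₀ t₁, ∫⁻ x in Ioo (-1 : ℝ) 1, ENNReal.ofReal (‖f (t, x)‖ ^ 2) ≠ ⊤) :
    ∃ F : ℝ → L2I, MemLp F 2 (volume.restrict (Ioo t₀ t₁)) ∧
      ∀ᵐ t ∂volume.restrict (Ioo t₀ t₁), F t =ᵐ[muI] fun x => f (t, x) := by
  classical
  have hm : AEMeasurable (fun q => ENNReal.ofReal (‖f q‖ ^ 2)) (rectMeasure t₀ t₁) :=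
    (hf.norm.pow 2).aemeasurable.ennreal_ofReal
  have hL2 : ∀ᵐ t ∂volume.restrict (Ioo t₀ t₁), MemLp (fun x => f (t, x)) 2 muI := by
    filter_upwards [hf.prodMk_left, ae_lt_top' hm.lintegral_prod_right' hfin] with t h1 h2
    rw [memLp_two_iff_integrable_sq_norm h1]
    refine ⟨h1.norm.pow 2, ?_⟩
    rw [hasFiniteIntegral_iff_ofReal (ae_of_all _ fun x => by positivity)]
    exact h2
  let F : ℝ → L2I := fun t => if h : MemLp (fun x => f (t, x)) 2 muI then h.toLp _ else 0
  have hF : ∀ᵐ t ∂volume.restrict (Ioo t₀ t₁), F t =ᵐ[muI] fun x => f (t, x) := by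
    filter_upwards [hL2] with t h
    simp only [F, dif_pos h]
    exact h.coeFn_toLp
  have hcoef : ∀ k, AEStronglyMeasurable (fun t => inner ℂ (sinL k) (F t))
      (volume.restrict (Ioo t₀ t₁)) := fun k => by
    have h1 : AEStronglyMeasurable (fun q : ℝ × ℝ => (sinF k q.2 : ℂ) * f q) (rectMeasure t₀ t₁) := by
      refine AEStronglyMeasurable.mul ?_ hf
      exact (by fun_prop : Continuous fun q : ℝ × ℝ => (sinF k q.2 : ℂ)).aestronglyMeasurable
    refine h1.integral_prod_right'.congr ?_
    filter_upwards [hF] with t h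
    rw [inner_sinL]
    exact integral_congr_ae (by filter_upwards [h] with x hx; rw [hx])
  have hmeas : AEStronglyMeasurable F (volume.restrict (Ioo t₀ t₁)) := by
    refine aestronglyMeasurable_of_tendsto_ae atTop (f := fun N t => sinProj (N + 1) (F t))
      (fun N => ?_) (ae_of_all _ fun t => tendsto_sinProj (F t))
    unfold sinProj
    exact Finset.aestronglyMeasurable_fun_sum _ fun k _ => (hcoef k).smul_const _
  refine ⟨F, ?_, hF⟩
  rw [memLp_two_iff_integrable_sq_norm hmeas]
  refine ⟨hmeas.norm.pow 2, ?_⟩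
  rw [hasFiniteIntegral_iff_ofReal (ae_of_all _ fun x => by positivity)]
  refine lt_of_le_of_lt (le_of_eq ?_) (lt_top_iff_ne_top.2 hfin)
  refine lintegral_congr_ae ?_
  filter_upwards [hF] with t h
  rw [← lintegral_norm_sq_L2I]
  exact lintegral_congr_ae (by filter_upwards [h] with x hx; rw [hx])

theorem memLp_mul_L2I {V : ℝ → ℝ} (hV : Continuous V) {B : ℝ}
    (hB : ∀ x ∈ Icc (-1 : ℝ) 1, ‖V x‖ ≤ B) (u : L2I) :
    MemLp (fun x => (V x : ℂ) * u x) 2 muI := by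
  refine (Lp.memLp u).of_le_mul (c := B)
    ((Complex.continuous_ofReal.comp hV).aestronglyMeasurable.mul (Lp.aestronglyMeasurable u)) ?_
  filter_upwards [ae_restrict_mem measurableSet_Ioo] with x hx
  rw [norm_mul, Complex.norm_real]
  exact mul_le_mul_of_nonneg_right (hB x (Ioo_subset_Icc_self hx)) (norm_nonneg _)

theorem exists_mulL {V : ℝ → ℝ} (hV : Continuous V) :
    ∃ L : L2I →L[ℂ] L2I, ∀ u, L u =ᵐ[muI] fun x => (V x : ℂ) * u x := by
  obtain ⟨B, hB⟩ := (isCompact_Icc (a := (-1 : ℝ)) (b := 1)).exists_bound_of_continuousOn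
    hV.continuousOn
  let L : L2I →ₗ[ℂ] L2I :=
    { toFun := fun u => ((memLp_mul_L2I hV hB u).toLp _)
      map_add' := fun u v => by
        apply Lp.ext
        filter_upwards [(memLp_mul_L2I hV hB (u + v)).coeFn_toLp, (memLp_mul_L2I hV hB u).coeFn_toLp,
          (memLp_mul_L2I hV hB v).coeFn_toLp, Lp.coeFn_add u v, Lp.coeFn_add
            ((memLp_mul_L2I hV hB u).toLp _) ((memLp_mul_L2I hV hB v).toLp _)] with x h1 h2 h3 h4 h5
        rw [h1, h5, Pi.add_apply, h2, h3, h4, Pi.add_apply, mul_add]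
      map_smul' := fun c u => by
        apply Lp.ext
        filter_upwards [(memLp_mul_L2I hV hB (c • u)).coeFn_toLp, (memLp_mul_L2I hV hB u).coeFn_toLp,
          Lp.coeFn_smul c u, Lp.coeFn_smul c ((memLp_mul_L2I hV hB u).toLp _)] with x h1 h2 h3 h4
        simp only [RingHom.id_apply]
        rw [h1, h4, Pi.smul_apply, h2, h3, Pi.smul_apply, smul_eq_mul, smul_eq_mul]
        ring }
  refine ⟨L.mkContinuous B fun u => ?_, fun u => (memLp_mul_L2I hV hB u).coeFn_toLp⟩
  refine Lp.norm_le_mul_norm_of_ae_le_mul ?_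
  filter_upwards [(memLp_mul_L2I hV hB u).coeFn_toLp, ae_restrict_mem measurableSet_Ioo] with x h hx
  change ‖((memLp_mul_L2I hV hB u).toLp _) x‖ ≤ _
  rw [h, norm_mul, Complex.norm_real]
  exact mul_le_mul_of_nonneg_right (hB x (Ioo_subset_Icc_self hx)) (norm_nonneg _)

/-- A weak identity tested against smooth functions extends to `H¹₀(-1,1)`. -/
theorem integral_pairing_eq_zero {μ : Measure ℝ} {A B : ℝ → L2I} (hA : Integrable A μ)
    (hB : Integrable B μ)
    (h : ∀ q ∈ testPairs, ∫ t, (inner ℂ q.1 (A t) + inner ℂ q.2 (B t)) ∂μ = 0) {u v : L2I}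
    (huv : HasH10Deriv u v) : ∫ t, (inner ℂ u (A t) + inner ℂ v (B t)) ∂μ = 0 := by
  have e : ∀ q : L2I × L2I, ∫ t, (inner ℂ q.1 (A t) + inner ℂ q.2 (B t)) ∂μ =
      inner ℂ q.1 (∫ t, A t ∂μ) + inner ℂ q.2 (∫ t, B t ∂μ) := fun q => by
    rw [integral_add (hA.const_inner _) (hB.const_inner _), integral_inner hA, integral_inner hB]
  have hcl : IsClosed {q : L2I × L2I |
      inner ℂ q.1 (∫ t, A t ∂μ) + inner ℂ q.2 (∫ t, B t ∂μ) = 0} :=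
    isClosed_eq ((continuous_fst.inner continuous_const).add (continuous_snd.inner continuous_const))
      continuous_const
  have := closure_minimal (fun q hq => by rw [mem_ofPred_eq, ← e q]; exact h q hq) hcl huv
  rw [e (u, v)]
  exact this

/-- Integration by parts against a smooth function for elements of `H¹₀(-1,1)`. -/
theorem HasH10Deriv.integral_mul_deriv {u v : L2I} (h : HasH10Deriv u v) {ψ ψ' : ℝ → ℂ}
    (hψ : ∀ x, HasDerivAt ψ (ψ' x) x) (hψ' : Continuous ψ') :
    ∫ x, u x * ψ' x ∂muI = -∫ x, v x * ψ x ∂muI := by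
  have hψc : Continuous ψ := continuous_iff_continuousAt.2 fun x => (hψ x).continuousAt
  have e : ∀ {χ : ℝ → ℂ} (hχ : Continuous χ) (w : L2I), ∫ x, w x * χ x ∂muI =
      inner ℂ (toL2 (fun x => (starRingEnd ℂ) (χ x)) (Complex.continuous_conj.comp hχ)) w := by
    intro χ hχ w
    rw [L2.inner_def]
    refine integral_congr_ae ?_
    filter_upwards [coeFn_toL2 (Complex.continuous_conj.comp hχ)] with x hx
    have hx' : toL2 (fun x => (starRingEnd ℂ) (χ x)) (Complex.continuous_conj.comp hχ) x
      = (starRingEnd ℂ) (χ x) := hx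
    rw [hx', RCLike.inner_apply, Complex.conj_conj]
  have hcl : IsClosed {q : L2I × L2I | ∫ x, q.1 x * ψ' x ∂muI = -∫ x, q.2 x * ψ x ∂muI} := by
    simp only [e hψc, e hψ']
    exact isClosed_eq (continuous_const.inner continuous_fst) (continuous_const.inner continuous_snd).neg
  refine closure_minimal ?_ hcl h
  rintro ⟨u, v⟩ ⟨φ, hu, hv⟩
  simp only [mem_ofPred_eq]
  have hφC : ContDiff ℝ 1 φ := φ.contDiff.of_le (by exact_mod_cast le_top)
  have hφd : ∀ x, HasDerivAt φ (deriv φ x) x := fun x =>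
    (hφC.differentiable (by norm_num) x).hasDerivAt
  have hφ'c : Continuous (deriv φ) := hφC.continuous_deriv le_rfl
  have hφc := hφC.continuous
  have hz : ∀ x ∉ Ioo (-1 : ℝ) 1, φ x = 0 := fun x hx =>
    image_eq_zero_of_notMem_tsupport fun h => hx (φ.tsupport_subset h)
  have e1 : ∫ x, v x * ψ x ∂muI = ∫ x, deriv φ x * ψ x ∂muI :=
    integral_congr_ae (by filter_upwards [hv] with x hx; rw [hx])
  have e2 : ∫ x, u x * ψ' x ∂muI = ∫ x, φ x * ψ' x ∂muI :=
    integral_congr_ae (by filter_upwards [hu] with x hx; rw [hx])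
  rw [e1, e2, eq_neg_iff_add_eq_zero, ← integral_add
    (integrable_muI (by fun_prop)) (integrable_muI (by fun_prop))]
  rw [integral_Ioo_eq_sub (f := fun x => φ x * ψ x) (by norm_num)]
  · rw [hz 1 (by simp), hz (-1) (by simp)]; simp
  · intro x _
    refine ((hφd x).mul (hψ x)).congr_deriv ?_
    ring
  · fun_prop

/-- The tensor product of two test functions. -/
def tensorTest {T t₀ t₁ : ℝ} (h0 : 0 ≤ t₀) (h1 : t₁ ≤ T) {η : ℝ → ℝ} (hη : ContDiff ℝ ∞ η)
    (hηc : HasCompactSupport η) (hηs : tsupport η ⊆ Ioo t₀ t₁) (ψ : TestFunction openI ℂ ⊤) :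
    TestFunction (openRect T) ℂ ⊤ :=
  have hsub : tsupport (fun q : ℝ × ℝ => (η q.1 : ℂ) * (starRingEnd ℂ) (ψ q.2)) ⊆
      tsupport η ×ˢ tsupport ψ := by
    refine closure_minimal (fun q hq => ⟨subset_closure fun h => hq ?_, subset_closure fun h => hq ?_⟩)
      (isClosed_closure.prod isClosed_closure)
    · simp [h]
    · simp [h]
  -- The weak formulation is bilinear whereas the inner product is conjugate-linear on the left; the
  -- conjugate reconciles them.
  { toFun := fun q => (η q.1 : ℂ) * (starRingEnd ℂ) (ψ q.2)
    contDiff' := (Complex.ofRealCLM.contDiff.comp (hη.comp contDiff_fst)).mul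
      (Complex.conjCLE.contDiff.comp (ψ.contDiff.comp contDiff_snd))
    hasCompactSupport' := (hηc.prod ψ.hasCompactSupport).of_isClosed_subset isClosed_closure hsub
    tsupport_subset' := hsub.trans (prod_mono
      (hηs.trans (Ioo_subset_Ioo h0 h1)) ψ.tsupport_subset) }

theorem inner_eq_integral_conj {φ : ℝ → ℂ} {q : L2I} (hq : q =ᵐ[muI] φ) {v : L2I} {f : ℝ → ℂ}
    (hv : v =ᵐ[muI] f) : inner ℂ q v = ∫ x, f x * (starRingEnd ℂ) (φ x) ∂muI := by
  rw [L2.inner_def]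
  refine integral_congr_ae ?_
  filter_upwards [hq, hv] with x h1 h2
  rw [h1, h2, RCLike.inner_apply]

theorem integrable_L2I_mul (v : L2I) {φ : ℝ → ℂ} (hφ : Continuous φ) :
    Integrable (fun x => v x * φ x) muI := by
  simpa only [mul_comm] using integrable_continuous_mul (integrable_L2I v) hφ

/-- The weak formulation tested with a tensor product. -/
theorem IsParabolic.tensor {T : ℝ} {n : ℤ} {p : ℝ} {g gx : ℝ → L2I} {f : ℝ × ℝ → ℂ}
    (hg : MemL2H10 T g gx) (hf : IsParabolic T n p g f) {t₀ t₁ : ℝ} (h0 : 0 ≤ t₀) (h1 : t₁ ≤ T)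
    {F : ℝ → L2I}
    (hF : ∀ᵐ t ∂volume.restrict (Ioo t₀ t₁), F t =ᵐ[muI] fun x => f (t, x))
    {L : L2I →L[ℂ] L2I} (hL : ∀ u, L u =ᵐ[muI] fun x => (((p * x + n) ^ 2 : ℝ) : ℂ) * u x)
    {η : ℝ → ℝ} (hη : ContDiff ℝ ∞ η)
    (hηc : HasCompactSupport η) (hηs : tsupport η ⊆ Ioo t₀ t₁) {q : L2I × L2I}
    (hq : q ∈ testPairs) :
    ∫ t in Ioo t₀ t₁, (-((deriv η t : ℝ) : ℂ) * inner ℂ q.1 (g t) + (η t : ℂ) * inner ℂ q.2 (gx t)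
      + (η t : ℂ) * inner ℂ q.1 (L (g t))) = ∫ t in Ioo t₀ t₁, (η t : ℂ) * inner ℂ q.1 (F t) := by
  obtain ⟨ψ, hq1, hq2⟩ := hq
  have hw := hf.weak (tensorTest h0 h1 hη hηc hηs ψ)
  have happ : ∀ t x, tensorTest h0 h1 hη hηc hηs ψ (t, x) = (η t : ℂ) * (starRingEnd ℂ) (ψ x) :=
    fun t x => rfl
  simp only [happ] at hw
  have hsub : Ioo t₀ t₁ ⊆ Ioo (0 : ℝ) T := Ioo_subset_Ioo h0 h1
  have hη0 : ∀ t ∉ Ioo t₀ t₁, η t = 0 := fun t ht =>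
    image_eq_zero_of_notMem_tsupport fun h => ht (hηs h)
  have hη'0 : ∀ t ∉ Ioo t₀ t₁, deriv η t = 0 := fun t ht =>
    image_eq_zero_of_notMem_tsupport fun h => ht (hηs
      (closure_minimal support_deriv_subset isClosed_closure h))
  have hψC : ContDiff ℝ (1 + 1 : ℕ∞) ψ := ψ.contDiff.of_le (by exact_mod_cast le_top)
  have hψ1 : ∀ x, HasDerivAt ψ (deriv ψ x) x := fun x =>
    (hψC.differentiable (by norm_num) x).hasDerivAt
  have hψC1 : ContDiff ℝ (1 : ℕ∞) (deriv ψ) :=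
    (contDiff_succ_iff_deriv.1 (by exact_mod_cast hψC)).2.2
  have hψ2 : ∀ x, HasDerivAt (deriv ψ) (deriv (deriv ψ) x) x := fun x =>
    (hψC1.differentiable (by norm_num) x).hasDerivAt
  have hψ2c : Continuous (deriv (deriv ψ)) := hψC1.continuous_deriv (by norm_num)
  have hψ1c : Continuous (deriv ψ) := hψC1.continuous
  have hψ0c : Continuous ψ := hψC.continuous
  have hconj : ∀ {φ φ' : ℝ → ℂ}, (∀ x, HasDerivAt φ (φ' x) x) →
      ∀ x, HasDerivAt (fun x => (starRingEnd ℂ) (φ x)) ((starRingEnd ℂ) (φ' x)) x := fun h x =>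
    (Complex.conjCLE.toContinuousLinearMap.hasFDerivAt.comp_hasDerivAt x (h x))
  have hdt : ∀ t x, deriv (fun s : ℝ => (η s : ℂ) * (starRingEnd ℂ) (ψ x)) t =
      ((deriv η t : ℝ) : ℂ) * (starRingEnd ℂ) (ψ x) := fun t x =>
    (((hη.differentiable (by norm_num) t).hasDerivAt.ofReal_comp).mul_const _).deriv
  have hdx : ∀ t x, iteratedDeriv 2 (fun y : ℝ => (η t : ℂ) * (starRingEnd ℂ) (ψ y)) x =
      (η t : ℂ) * (starRingEnd ℂ) (deriv (deriv ψ) x) := fun t x => by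
    rw [iteratedDeriv_succ, iteratedDeriv_one]
    have : deriv (fun y : ℝ => (η t : ℂ) * (starRingEnd ℂ) (ψ y)) =
        fun y => (η t : ℂ) * (starRingEnd ℂ) (deriv ψ y) :=
      funext fun y => ((hconj hψ1 y).const_mul _).deriv
    rw [this]
    exact ((hconj hψ2 x).const_mul _).deriv
  simp only [hdt, hdx] at hw
  have hc : Continuous fun x => (starRingEnd ℂ) (ψ x) := Complex.continuous_conj.comp hψ0c
  have hc2 : Continuous fun x => (starRingEnd ℂ) (deriv (deriv ψ) x) :=
    Complex.continuous_conj.comp hψ2c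
  have hV : Continuous fun x : ℝ => (((p * x + n) ^ 2 : ℝ) : ℂ) := by fun_prop
  have hl : ∀ᵐ t ∂volume.restrict (Ioo (0 : ℝ) T), ∫ x in Ioo (-1 : ℝ) 1,
      g t x * (-(((deriv η t : ℝ) : ℂ) * (starRingEnd ℂ) (ψ x))
        - (η t : ℂ) * (starRingEnd ℂ) (deriv (deriv ψ) x)
        + (((p * x + n) ^ 2 : ℝ) : ℂ) * ((η t : ℂ) * (starRingEnd ℂ) (ψ x))) =
      -((deriv η t : ℝ) : ℂ) * inner ℂ q.1 (g t) + (η t : ℂ) * inner ℂ q.2 (gx t)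
      + (η t : ℂ) * inner ℂ q.1 (L (g t)) := by
    filter_upwards [hg.hasDeriv] with t ht
    have i1 := integrable_L2I_mul (g t) hc
    have i2 := integrable_L2I_mul (g t) hc2
    have i3 : Integrable (fun x => (((p * x + n) ^ 2 : ℝ) : ℂ) * g t x * (starRingEnd ℂ) (ψ x)) muI := by
      simpa only [mul_assoc] using integrable_continuous_mul i1 hV
    rw [inner_eq_integral_conj hq1 (ae_eq_refl (g t)), inner_eq_integral_conj hq2 (ae_eq_refl (gx t)),
      inner_eq_integral_conj hq1 (hL (g t))]
    -- One of the two space derivatives moves back from the test function to `g`. The identity then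
    -- involves the test function only through its `H¹` pair, which prepares the density argument.
    have ibp := ht.integral_mul_deriv (hconj hψ2) hc2
    rw [eq_neg_iff_add_eq_zero, add_comm, ← eq_neg_iff_add_eq_zero] at ibp
    have e3 := integral_add ((i1.const_mul (-((deriv η t : ℝ) : ℂ))).sub (i2.const_mul (η t : ℂ)))
      (i3.const_mul (η t : ℂ))
    simp only [Pi.sub_apply] at e3
    rw [ibp, mul_neg, ← integral_const_mul, ← integral_const_mul, ← integral_const_mul,
      ← sub_eq_add_neg, ← integral_sub (i1.const_mul _) (i2.const_mul _), ← e3]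
    refine integral_congr_ae (ae_of_all _ fun x => ?_)
    simp only
    ring
  rw [integral_congr_ae hl] at hw
  rw [setIntegral_eq_of_subset_of_forall_sdiff_eq_zero measurableSet_Ioo hsub
    (fun t ht => by simp only [hη0 t ht.2, hη'0 t ht.2]; simp),
    setIntegral_eq_of_subset_of_forall_sdiff_eq_zero measurableSet_Ioo hsub
    (fun t ht => by simp only [hη0 t ht.2]; simp)] at hw
  rw [hw]
  refine integral_congr_ae ?_
  filter_upwards [hF] with t ht
  rw [inner_eq_integral_conj hq1 ht, ← integral_const_mul]
  refine integral_congr_ae (ae_of_all _ fun x => ?_)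
  simp only
  ring

/-- The ordinary differential equation satisfied by the sine coefficients of a weak solution. -/
theorem IsParabolic.coefficient_ode {T : ℝ} {n : ℤ} {p : ℝ} {g gx : ℝ → L2I} {f : ℝ × ℝ → ℂ}
    (hgc : ContinuousOn g (Icc 0 T))
    (hg : MemL2H10 T g gx) (hf : IsParabolic T n p g f) {t₀ t₁ : ℝ} (h0 : 0 ≤ t₀) (h01 : t₀ < t₁)
    (h1 : t₁ ≤ T) {F : ℝ → L2I} (hF2 : MemLp F 2 (volume.restrict (Ioo t₀ t₁)))
    (hF : ∀ᵐ t ∂volume.restrict (Ioo t₀ t₁), F t =ᵐ[muI] fun x => f (t, x))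
    {L : L2I →L[ℂ] L2I} (hL : ∀ u, L u =ᵐ[muI] fun x => (((p * x + n) ^ 2 : ℝ) : ℂ) * u x)
    (k : ℕ) : ∀ t ∈ Icc t₀ t₁, inner ℂ (sinL k) (g t) = inner ℂ (sinL k) (g t₀)
      + ∫ s in t₀..t, (inner ℂ (sinL k) (F s - L (g s)) - freq k ^ 2 * inner ℂ (sinL k) (g s)) := by
  have hsub : Icc t₀ t₁ ⊆ Icc 0 T := Icc_subset_Icc h0 h1
  have hgc' : ContinuousOn g (Icc t₀ t₁) := hgc.mono hsub
  have hgi : IntegrableOn g (Ioo t₀ t₁) :=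
    (hgc'.integrableOn_compact isCompact_Icc).mono_set Ioo_subset_Icc_self
  have hLi : IntegrableOn (fun t => L (g t)) (Ioo t₀ t₁) := L.integrable_comp hgi
  have hFi : IntegrableOn F (Ioo t₀ t₁) := hF2.integrable (by norm_num)
  have hgxi : IntegrableOn gx (Ioo t₀ t₁) :=
    ((hg.memLp_deriv.mono_measure (Measure.restrict_mono (Ioo_subset_Ioo h0 h1) le_rfl))).integrable
      (by norm_num)
  have hc : ContinuousOn (fun t => inner ℂ (sinL k) (g t)) (Icc t₀ t₁) :=
    continuousOn_const.inner hgc'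
  have hci : IntegrableOn (fun t => inner ℂ (sinL k) (g t)) (Ioo t₀ t₁) := hgi.const_inner _
  refine eq_add_integral_of_weak_deriv h01 hc
    (((hFi.sub hLi).const_inner _).sub (hci.const_mul _)) fun η hη hηc hηs => ?_
  have hbdd : ∀ φ : ℝ → ℝ, Continuous φ → ∀ G : ℝ → L2I, IntegrableOn G (Ioo t₀ t₁) →
      IntegrableOn (fun t => (φ t : ℂ) • G t) (Ioo t₀ t₁) := fun φ hφ G hG => by
    obtain ⟨B, hB⟩ := (isCompact_Icc (a := t₀) (b := t₁)).exists_bound_of_continuousOn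
      hφ.continuousOn
    refine hG.bdd_smul B (Complex.continuous_ofReal.comp hφ).aestronglyMeasurable
      ((ae_restrict_iff' measurableSet_Ioo).2 (ae_of_all _ fun t ht => ?_))
    simpa using hB t (Ioo_subset_Icc_self ht)
  have hη' : Continuous (deriv η) := hη.continuous_deriv (by norm_num)
  -- The sine functions do not have compact support in `(-1,1)`. The identity extends to them
  -- because both sides are continuous for the `H¹` norm and the sines lie in `H¹₀`.
  have hpair := integral_pairing_eq_zero (μ := volume.restrict (Ioo t₀ t₁))
    (A := fun t => -(((deriv η t : ℝ) : ℂ) • g t) + (η t : ℂ) • L (g t) - (η t : ℂ) • F t)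
    (B := fun t => (η t : ℂ) • gx t)
    (((hbdd _ hη' _ hgi).neg.add (hbdd _ hη.continuous _ hLi)).sub (hbdd _ hη.continuous _ hFi))
    (hbdd _ hη.continuous _ hgxi) (fun q hq => by
      have e := hf.tensor hg h0 h1 hF hL hη hηc hηs hq
      have iF : IntegrableOn (fun t => (η t : ℂ) * inner ℂ q.1 (F t)) (Ioo t₀ t₁) := by
        have h := (hbdd _ hη.continuous _ hFi).const_inner (𝕜 := ℂ) q.1
        simp only [inner_smul_right] at h
        exact h
      have iL : IntegrableOn (fun t => (η t : ℂ) * inner ℂ q.1 (L (g t))) (Ioo t₀ t₁) := by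
        have h := (hbdd _ hη.continuous _ hLi).const_inner (𝕜 := ℂ) q.1
        simp only [inner_smul_right] at h
        exact h
      have ix : IntegrableOn (fun t => (η t : ℂ) * inner ℂ q.2 (gx t)) (Ioo t₀ t₁) := by
        have h := (hbdd _ hη.continuous _ hgxi).const_inner (𝕜 := ℂ) q.2
        simp only [inner_smul_right] at h
        exact h
      have ig : IntegrableOn (fun t => -((deriv η t : ℝ) : ℂ) * inner ℂ q.1 (g t)) (Ioo t₀ t₁) := by
        have h := (hbdd _ hη' _ hgi).const_inner (𝕜 := ℂ) q.1
        simp only [inner_smul_right] at h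
        simp only [neg_mul]
        exact h.neg
      have e3 := integral_sub ((ig.add ix).add iL) iF
      simp only [Pi.add_apply] at e3
      rw [← sub_eq_zero, ← e3] at e
      rw [← e]
      refine integral_congr_ae (ae_of_all _ fun t => ?_)
      simp only [inner_sub_right, inner_add_right, inner_neg_right, inner_smul_right]
      ring)
    (hasH10Deriv_sinL k)
  -- Integration by parts of `gₓ` against the cosine produces the second factor `freq k`, hence the
  -- eigenvalue `freq k ^ 2`.
  have hneg : ∫ t in Ioo t₀ t₁, (((deriv η t : ℝ) : ℂ) * inner ℂ (sinL k) (g t) + (η t : ℂ) *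
      (inner ℂ (sinL k) (F t - L (g t)) - freq k ^ 2 * inner ℂ (sinL k) (g t))) =
      -∫ t in Ioo t₀ t₁, (inner ℂ (sinL k)
        (-(((deriv η t : ℝ) : ℂ) • g t) + (η t : ℂ) • L (g t) - (η t : ℂ) • F t)
        + inner ℂ ((freq k : ℂ) • cosL k) ((η t : ℂ) • gx t)) := by
    rw [← integral_neg]
    refine integral_congr_ae ?_
    filter_upwards [ae_restrict_of_ae_restrict_of_subset (Ioo_subset_Ioo h0 h1) hg.hasDeriv] with t ht
    simp only [inner_sub_right, inner_add_right, inner_neg_right, inner_smul_right, inner_smul_left,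
      ht.inner_cosL, Complex.conj_ofReal]
    ring
  exact hneg.trans (by rw [hpair, neg_zero])

/-! ### Approximation of weak solutions by regular sine sums -/

/-- Dominated convergence with bound `(2 ‖v‖)²`. It turns convergence of the partial sums at each
time into convergence in `L²` of time. -/
theorem tendsto_eLpNorm_sub_of_contraction {μ : Measure ℝ} {E : Type*} [NormedAddCommGroup E]
    {P : ℕ → E → E} (hPc : ∀ N, Continuous (P N)) (hP : ∀ N v, ‖P N v‖ ≤ ‖v‖) {v : ℝ → E}
    (hv : MemLp v 2 μ) (hlim : ∀ᵐ t ∂μ, Tendsto (fun N => P N (v t)) atTop (𝓝 (v t))) :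
    Tendsto (fun N => eLpNorm (fun t => P N (v t) - v t) 2 μ) atTop (𝓝 0) := by
  have h1 : Tendsto (fun N => ∫⁻ t, ‖P N (v t) - v t‖ₑ ^ (2 : ℝ) ∂μ) atTop (𝓝 (∫⁻ _, 0 ∂μ)) := by
    refine tendsto_lintegral_of_dominated_convergence' (fun t => (2 * ‖v t‖ₑ) ^ (2 : ℝ)) ?_ ?_ ?_ ?_
    · intro N
      exact (((hPc N).comp_aestronglyMeasurable hv.1).sub hv.1).enorm.pow_const _
    · intro N
      refine ae_of_all _ fun t => ENNReal.rpow_le_rpow ?_ (by norm_num)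
      refine (enorm_sub_le).trans ?_
      rw [two_mul]
      exact add_le_add (enorm_le_iff_norm_le.2 (hP N _)) le_rfl
    · have h2 := hv.2
      rw [eLpNorm_lt_top_iff_lintegral_rpow_enorm_lt_top (by norm_num) (by norm_num)] at h2
      simp only [ENNReal.mul_rpow_of_nonneg _ _ (by norm_num : (0 : ℝ) ≤ 2)]
      rw [lintegral_const_mul'' _ (hv.1.enorm.pow_const _)]
      exact ENNReal.mul_ne_top (by norm_num) (by simpa using h2.ne)
    · filter_upwards [hlim] with t ht
      have h3 : Tendsto (fun N => ‖P N (v t) - v t‖ₑ) atTop (𝓝 0) := by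
        have := (ht.sub_const (v t)).enorm
        simpa using this
      have := (ENNReal.continuous_rpow_const (y := 2)).tendsto 0 |>.comp h3
      rw [ENNReal.zero_rpow_of_pos (by norm_num)] at this
      exact this
  rw [lintegral_zero] at h1
  have h4 := ((ENNReal.continuous_rpow_const (y := 1 / 2)).tendsto 0).comp h1
  simp only [eLpNorm_eq_lintegral_rpow_enorm_toReal (p := 2) (by norm_num) (by norm_num)]
  simpa [Function.comp_def] using h4

/-- Approximation of an absolutely continuous function with square integrable derivative by
continuously differentiable functions. -/
theorem exists_C1_approx {t₀ t₁ : ℝ} (ht : t₀ < t₁) {c d : ℝ → ℂ}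
    (hd : MemLp d 2 (volume.restrict (Ioo t₀ t₁)))
    (hc : ∀ t ∈ Icc t₀ t₁, c t = c t₀ + ∫ s in t₀..t, d s) {δ : ℝ≥0∞} (hδ : δ ≠ 0) :
    ∃ c' d' : ℝ → ℂ, Continuous d' ∧ (∀ t, HasDerivAt c' (d' t) t) ∧ c' t₀ = c t₀ ∧
      eLpNorm (fun t => d' t - d t) 2 (volume.restrict (Ioo t₀ t₁)) ≤ δ ∧
      eLpNorm (fun t => c' t - c t) 2 (volume.restrict (Ioo t₀ t₁)) ≤ δ ∧
      (∀ t ∈ Icc t₀ t₁, ‖c' t - c t‖ₑ ≤ δ) := by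
  set μ := volume.restrict (Ioo t₀ t₁)
  set A : ℝ≥0∞ := μ univ ^ (1 / 2 : ℝ) + 1 with hA
  have hAtop : A ≠ ⊤ := by
    refine ENNReal.add_ne_top.2 ⟨ENNReal.rpow_ne_top_of_nonneg (by norm_num) (measure_ne_top μ _),
      ENNReal.one_ne_top⟩
  have hA1 : 1 ≤ A := le_add_self
  obtain ⟨φ, hφ, hφ2⟩ := hd.exists_boundedContinuous_eLpNorm_sub_le (by norm_num)
    -- One factor `A` is spent by Cauchy–Schwarz, from the `L²` error of the derivative to a uniform
    -- error of the primitive; the other returns from the uniform error to `L²`. The `+ 1` in `A`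
    -- makes both divisions harmless.
    (ε := δ / A / A)
    (ENNReal.div_ne_zero.2 ⟨ENNReal.div_ne_zero.2 ⟨hδ, hAtop⟩, hAtop⟩)
  have hφ' : eLpNorm (fun t => φ t - d t) 2 μ ≤ δ / A / A := by
    rw [← eLpNorm_neg]
    refine le_of_eq_of_le (congrArg (fun f => eLpNorm f 2 μ) ?_) hφ
    ext t
    simp
  have hi : ∀ t, HasDerivAt (fun τ => c t₀ + ∫ s in t₀..τ, φ s) (φ t) t := fun t =>
    (φ.continuous.integral_hasStrictDerivAt t₀ t).hasDerivAt.const_add _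
  have hAA : ∀ x : ℝ≥0∞, x / A * A = x := fun x => ENNReal.div_mul_cancel (by positivity) hAtop
  have hle : ∀ x : ℝ≥0∞, x / A ≤ x := fun x =>
    ENNReal.div_le_of_le_mul (le_mul_of_one_le_right' hA1)
  have key : ∀ t ∈ Icc t₀ t₁, ‖c t₀ + (∫ s in t₀..t, φ s) - c t‖ₑ ≤ δ / A := ?_
  · refine ⟨fun τ => c t₀ + ∫ s in t₀..τ, φ s, φ, φ.continuous, hi, by simp,
      hφ'.trans ((hle _).trans (hle _)), ?_, fun t htm => (key t htm).trans (hle _)⟩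
    refine (eLpNorm_le_of_ae_enorm_bound ((ae_restrict_iff' measurableSet_Ioo).2
      (ae_of_all _ fun t h => key t (Ioo_subset_Icc_self h)))).trans ?_
    refine le_trans ?_ (hAA δ).le
    rw [smul_eq_mul]
    refine mul_le_mul' le_rfl (le_trans (le_of_eq ?_) (le_self_add (b := 1)))
    rw [ENNReal.toReal_ofNat, one_div]
  intro t htm
  have hdi : IntegrableOn d (Ioo t₀ t₁) := hd.integrable (by norm_num)
  have hdI : IntervalIntegrable d volume t₀ t :=
    ((intervalIntegrable_iff_integrableOn_Ioo_of_le ht.le).2 hdi).mono_set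
      (by rw [uIcc_of_le ht.le, uIcc_of_le htm.1]; exact Icc_subset_Icc_right htm.2)
  have e : c t₀ + (∫ s in t₀..t, φ s) - c t = ∫ s in Ioo t₀ t, (φ s - d s) := by
    rw [hc t htm, add_sub_add_left_eq_sub, ← intervalIntegral.integral_sub
      (φ.continuous.intervalIntegrable _ _) hdI, intervalIntegral.integral_of_le htm.1,
      integral_Ioc_eq_integral_Ioo]
  rw [e]
  calc ‖∫ s in Ioo t₀ t, (φ s - d s)‖ₑ ≤ ∫⁻ s in Ioo t₀ t, ‖φ s - d s‖ₑ :=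
        enorm_integral_le_lintegral_enorm _
    _ ≤ ∫⁻ s, ‖φ s - d s‖ₑ ∂μ := lintegral_mono_set (Ioo_subset_Ioo_right htm.2)
    _ = eLpNorm (fun s => φ s - d s) 1 μ := eLpNorm_one_eq_lintegral_enorm.symm
    _ ≤ eLpNorm (fun s => φ s - d s) 2 μ * μ univ ^ (1 / 2 : ℝ) := by
        refine (eLpNorm_le_eLpNorm_mul_rpow_measure_univ (p := 1) (q := 2) (by norm_num)
          (φ.continuous.aestronglyMeasurable.sub hd.1)).trans_eq ?_
        norm_num
        rfl
    _ ≤ δ / A / A * A := mul_le_mul' hφ' le_self_add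
    _ = δ / A := hAA _

theorem eLpNorm_sum_smul_le {μ : Measure ℝ} {E : ℕ → ℝ → ℂ} {e : ℕ → L2I} {N : ℕ} {δ : ℝ≥0∞}
    (hE : ∀ k, AEStronglyMeasurable (E k) μ) (hδ : ∀ k, eLpNorm (E k) 2 μ ≤ δ) :
    eLpNorm (fun t => ∑ k ∈ Finset.range N, E k t • e k) 2 μ ≤
      (∑ k ∈ Finset.range N, ‖e k‖ₑ) * δ := by
  have h1 : (fun t => ∑ k ∈ Finset.range N, E k t • e k) =
      ∑ k ∈ Finset.range N, fun t => E k t • e k := by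
    ext1 t; rw [Finset.sum_apply]
  rw [h1, Finset.sum_mul]
  refine (eLpNorm_sum_le (fun k _ => (hE k).smul_const _) (by norm_num)).trans
    (Finset.sum_le_sum fun k _ => ?_)
  refine (eLpNorm_le_nnreal_smul_eLpNorm_of_ae_le_mul (c := ‖e k‖₊) (g := E k)
    (ae_of_all _ fun t => ?_) 2).trans ?_
  · rw [nnnorm_smul, mul_comm]
  · exact mul_le_mul' le_rfl (hδ k)

/-- The class of a finite sine sum. -/
def sineL (N : ℕ) (c : ℕ → ℂ) : L2I := ∑ k ∈ Finset.range N, c k • sinL k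

/-- The class of the derivative of a finite sine sum. -/
def cosineL (N : ℕ) (c : ℕ → ℂ) : L2I := ∑ k ∈ Finset.range N, c k • ((freq k : ℂ) • cosL k)

theorem coeFn_sum_smul (N : ℕ) (c : ℕ → ℂ) {e : ℕ → L2I} {f : ℕ → ℝ → ℂ}
    (h : ∀ k, e k =ᵐ[muI] f k) : (∑ k ∈ Finset.range N, c k • e k : L2I) =ᵐ[muI]
      fun x => ∑ k ∈ Finset.range N, c k * f k x := by
  induction N with
  | zero =>
    simp only [Finset.range_zero, Finset.sum_empty]
    exact Lp.coeFn_zero ℂ 2 muI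
  | succ N ih =>
    rw [Finset.sum_range_succ]
    filter_upwards [Lp.coeFn_add (∑ k ∈ Finset.range N, c k • e k) (c N • e N),
      Lp.coeFn_smul (c N) (e N), ih, h N] with x h1 h2 h3 h4
    rw [h1, Pi.add_apply, h2, h3, Pi.smul_apply, h4, Finset.sum_range_succ, smul_eq_mul]

theorem coeFn_sineL (N : ℕ) (c : ℕ → ℂ) : sineL N c =ᵐ[muI] sineSum N c :=
  coeFn_sum_smul N c fun _ => coeFn_toL2 _

theorem coeFn_cosineL (N : ℕ) (c : ℕ → ℂ) : cosineL N c =ᵐ[muI] cosineSum N c := by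
  refine coeFn_sum_smul N c (f := fun k x => ((freq k * cosF k x : ℝ) : ℂ)) fun k => ?_
  filter_upwards [Lp.coeFn_smul (freq k : ℂ) (cosL k),
    coeFn_toL2 (φ := fun x => (cosF k x : ℂ)) (by fun_prop)] with x h1 h2
  rw [h1, Pi.smul_apply, cosL, h2]
  push_cast
  rfl

/-- Differentiating the truncated sine series of `u` gives the truncated cosine series of `v`, so
that convergence of the gradients reduces to completeness of the cosines. -/
theorem HasH10Deriv.cosineL_eq {u v : L2I} (h : HasH10Deriv u v) (N : ℕ) :
    cosineL (N + 1) (fun k => inner ℂ (sinL k) u) = cosProj N v := by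
  rw [cosineL, Finset.sum_range_succ', cosProj]
  have : freq 0 = 0 := by simp [freq]
  rw [this, Complex.ofReal_zero, zero_smul, smul_zero, add_zero]
  refine Finset.sum_congr rfl fun k _ => ?_
  rw [h.inner_cosL, smul_smul, mul_comm]

theorem HasH10Deriv.tendsto_cosProj {u v : L2I} (h : HasH10Deriv u v) :
    Tendsto (fun N => cosProj N v) atTop (𝓝 v) :=
  HeatCarleman.tendsto_cosProj (by rw [h.inner_cosL]; simp [freq])

theorem continuous_sinProj (N : ℕ) : Continuous (sinProj N) := by
  unfold sinProj; fun_prop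

theorem continuous_cosProj (N : ℕ) : Continuous (cosProj N) := by
  unfold cosProj; fun_prop

/-- Approximation of a weak solution by finite sine sums. -/
theorem exists_sine_approx {t₀ t₁ : ℝ} (ht : t₀ < t₁) {g gx F : ℝ → L2I}
    (hg : ContinuousOn g (Icc t₀ t₁)) (hgx : MemLp gx 2 (volume.restrict (Ioo t₀ t₁)))
    (hd : ∀ᵐ t ∂volume.restrict (Ioo t₀ t₁), HasH10Deriv (g t) (gx t))
    (hF : MemLp F 2 (volume.restrict (Ioo t₀ t₁))) (hd0 : HasH10Deriv (g t₀) (gx t₀))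
    (L : L2I →L[ℂ] L2I)
    (hode : ∀ k, ∀ t ∈ Icc t₀ t₁, inner ℂ (sinL k) (g t) = inner ℂ (sinL k) (g t₀)
      + ∫ s in t₀..t, (inner ℂ (sinL k) (F s - L (g s)) - freq k ^ 2 * inner ℂ (sinL k) (g s)))
    {ε : ℝ≥0∞} (hε : ε ≠ 0) :
    ∃ (N : ℕ) (c c' : ℝ → ℕ → ℂ), (∀ k t, HasDerivAt (fun τ => c τ k) (c' t k) t) ∧
      (∀ k, Continuous fun t => c' t k) ∧
      eLpNorm (fun t => sineL N (c t) - g t) 2 (volume.restrict (Ioo t₀ t₁)) ≤ ε ∧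
      eLpNorm (fun t => cosineL N (c t) - gx t) 2 (volume.restrict (Ioo t₀ t₁)) ≤ ε ∧
      eLpNorm (fun t => sineL N (fun k => c' t k + freq k ^ 2 * c t k) + L (sineL N (c t)) - F t) 2
        (volume.restrict (Ioo t₀ t₁)) ≤ ε ∧
      ‖sineL N (c t₀)‖ ≤ ‖g t₀‖ ∧ ‖cosineL N (c t₀)‖ ≤ ‖gx t₀‖ ∧
      ‖sineL N (c t₁)‖ₑ ≤ ‖g t₁‖ₑ + ε := by
  set μ := volume.restrict (Ioo t₀ t₁) with hμ
  have hgm : MemLp g 2 μ := by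
    obtain ⟨B, hB⟩ := isCompact_Icc.exists_bound_of_continuousOn hg
    exact MemLp.of_bound ((hg.mono Ioo_subset_Icc_self).aestronglyMeasurable measurableSet_Ioo) B
      ((ae_restrict_iff' measurableSet_Ioo).2 (ae_of_all _ fun t h => hB t (Ioo_subset_Icc_self h)))
  have hLg : MemLp (fun t => L (g t)) 2 μ := L.comp_memLp' hgm
  set h : ℝ → L2I := fun t => F t - L (g t) with hh
  have hhm : MemLp h 2 μ := hF.sub hLg
  set q : ℕ → ℝ → ℂ := fun k t => inner ℂ (sinL k) (g t) with hq
  set d : ℕ → ℝ → ℂ := fun k t => inner ℂ (sinL k) (h t) - freq k ^ 2 * q k t with hdd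
  have hqm : ∀ k, MemLp (q k) 2 μ := fun k => hgm.const_inner _
  have hdm : ∀ k, MemLp (d k) 2 μ := fun k => (hhm.const_inner _).sub ((hqm k).const_mul _)
  -- The error on the right-hand side will be at most `η + η + ‖L‖ (2 η)`, and the other errors at
  -- most `2 η`.
  set Λ : ℝ≥0∞ := 3 + 2 * ‖L‖ₑ with hΛ
  have hΛtop : Λ ≠ ⊤ := by simp [hΛ, ENNReal.mul_eq_top]
  set η : ℝ≥0∞ := ε / Λ with hη
  have hη0 : η ≠ 0 := ENNReal.div_ne_zero.2 ⟨hε, hΛtop⟩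
  have hηε : Λ * η = ε := ENNReal.mul_div_cancel (by simp [hΛ]) hΛtop
  have e1 := (tendsto_eLpNorm_sub_of_contraction (P := fun N => sinProj (N + 1))
    (fun N => continuous_sinProj _) norm_sinProj_le hgm
    (ae_of_all _ fun t => tendsto_sinProj _)).eventually_le_const (pos_iff_ne_zero.2 hη0)
  have e2 := (tendsto_eLpNorm_sub_of_contraction (P := fun N => sinProj (N + 1))
    (fun N => continuous_sinProj _) norm_sinProj_le hhm
    (ae_of_all _ fun t => tendsto_sinProj _)).eventually_le_const (pos_iff_ne_zero.2 hη0)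
  have e3 := (tendsto_eLpNorm_sub_of_contraction continuous_cosProj norm_cosProj_le hgx
    (hd.mono fun t ht => ht.tendsto_cosProj)).eventually_le_const (pos_iff_ne_zero.2 hη0)
  obtain ⟨N, h1, h2, h3⟩ := (e1.and (e2.and e3)).exists
  set S1 := ∑ k ∈ Finset.range (N + 1), ‖sinL k‖ₑ with hS1
  set S2 := ∑ k ∈ Finset.range (N + 1), ‖(freq k : ℂ) • cosL k‖ₑ with hS2
  set S3 := ∑ k ∈ Finset.range (N + 1), ‖((freq k : ℂ) ^ 2) • sinL k‖ₑ with hS3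
  set K := S1 + S2 + S3 + 1 with hK
  have hKtop : K ≠ ⊤ := by
    simp only [hK, hS1, hS2, hS3, ne_eq, ENNReal.add_eq_top, ENNReal.sum_eq_top, enorm_ne_top,
      and_false, exists_false, or_self, ENNReal.one_ne_top, not_false_eq_true]
  -- The smoothing tolerance is chosen after the truncation order `N`, since it must beat the total
  -- size of the modes, including the eigenvalues in `S3`.
  obtain ⟨δ, hδ0, hδ⟩ : ∃ δ : ℝ≥0∞, δ ≠ 0 ∧ K * δ = η :=
    ⟨η / K, ENNReal.div_ne_zero.2 ⟨hη0, hKtop⟩, ENNReal.mul_div_cancel (by simp [hK]) hKtop⟩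
  have hS1K : S1 * δ ≤ η := hδ ▸ mul_le_mul' (by
    rw [hK, add_assoc, add_assoc]; exact le_self_add) le_rfl
  have hS2K : S2 * δ ≤ η := hδ ▸ mul_le_mul' (by
    rw [hK, add_comm S1, add_assoc, add_assoc]; exact le_self_add) le_rfl
  have hS13K : S1 * δ + S3 * δ ≤ η := by
    rw [← hδ, ← add_mul]
    refine mul_le_mul' ?_ le_rfl
    rw [hK, add_right_comm S1 S2 S3, add_assoc (S1 + S3)]
    exact le_self_add
  choose γ γ' hd'c hd' hc0 hdδ hcE hcδ using fun k => exists_C1_approx ht (hdm k) (hode k) hδ0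
  have hcc : ∀ k, Continuous (γ k) := fun k =>
    continuous_iff_continuousAt.2 fun t => (hd' k t).continuousAt
  set E : ℕ → ℝ → ℂ := fun k t => γ k t - q k t with hE
  set D : ℕ → ℝ → ℂ := fun k t => γ' k t - d k t with hD
  have hEm : ∀ k, AEStronglyMeasurable (E k) μ := fun k =>
    (hcc k).aestronglyMeasurable.sub (hqm k).1
  have hDm : ∀ k, AEStronglyMeasurable (D k) μ := fun k =>
    (hd'c k).aestronglyMeasurable.sub (hdm k).1
  have hsq : ∀ t, sinProj (N + 1) (g t) = sineL (N + 1) (fun k => q k t) := fun t => rfl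
  have hsum : ∀ t, sineL (N + 1) (fun k => γ k t) - g t =
      (∑ k ∈ Finset.range (N + 1), E k t • sinL k) + (sinProj (N + 1) (g t) - g t) := fun t => by
    rw [hsq, sineL, sineL, ← add_sub_assoc, ← Finset.sum_add_distrib]
    simp only [hE, ← add_smul, sub_add_cancel]
  have hUm : AEStronglyMeasurable (fun t => sineL (N + 1) (fun k => γ k t) - g t) μ := by
    refine AEStronglyMeasurable.sub ?_ hgm.1
    unfold sineL
    exact Continuous.aestronglyMeasurable (by fun_prop)
  have hU : eLpNorm (fun t => sineL (N + 1) (fun k => γ k t) - g t) 2 μ ≤ 2 * η := by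
    simp only [hsum]
    rw [two_mul]
    exact (eLpNorm_add_le (Finset.aestronglyMeasurable_fun_sum _ fun k _ => (hEm k).smul_const _)
      (((continuous_sinProj _).comp_aestronglyMeasurable hgm.1).sub hgm.1) (by norm_num)).trans
      (add_le_add ((eLpNorm_sum_smul_le hEm hcE).trans hS1K) h1)
  refine ⟨N + 1, fun t k => γ k t, fun t k => γ' k t, fun k t => hd' k t, hd'c, ?_, ?_, ?_, ?_, ?_, ?_⟩
  · refine hU.trans ?_
    rw [← hηε]
    refine mul_le_mul' ?_ le_rfl
    rw [hΛ]
    exact le_add_right (by norm_num)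
  · have : eLpNorm (fun t => cosineL (N + 1) (fun k => γ k t) - gx t) 2 μ ≤ 2 * η := by
      have hae : (fun t => cosineL (N + 1) (fun k => γ k t) - gx t) =ᵐ[μ] fun t =>
          (∑ k ∈ Finset.range (N + 1), E k t • ((freq k : ℂ) • cosL k)) + (cosProj N (gx t) - gx t) := by
        filter_upwards [hd] with t ht
        rw [← ht.cosineL_eq N, cosineL, cosineL, ← add_sub_assoc, ← Finset.sum_add_distrib]
        simp only [hE, hq, ← add_smul, sub_add_cancel]
      rw [eLpNorm_congr_ae hae, two_mul]
      exact (eLpNorm_add_le (Finset.aestronglyMeasurable_fun_sum _ fun k _ => (hEm k).smul_const _)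
        (((continuous_cosProj _).comp_aestronglyMeasurable hgx.1).sub hgx.1) (by norm_num)).trans
        (add_le_add ((eLpNorm_sum_smul_le hEm hcE).trans hS2K) h3)
    refine this.trans ?_
    rw [← hηε]
    refine mul_le_mul' ?_ le_rfl
    rw [hΛ]
    exact le_add_right (by norm_num)
  -- Four errors: smoothing of the derivatives, smoothing of the coefficients times the eigenvalues,
  -- truncation of `F - L g`, and the error on `g` seen through the potential.
  · have hPeq : ∀ t, sineL (N + 1) (fun k => γ' k t + freq k ^ 2 * γ k t)
        + L (sineL (N + 1) (fun k => γ k t)) - F t =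
        ((∑ k ∈ Finset.range (N + 1), D k t • sinL k)
          + ∑ k ∈ Finset.range (N + 1), E k t • ((freq k : ℂ) ^ 2 • sinL k))
        + (sinProj (N + 1) (h t) - h t) + L (sineL (N + 1) (fun k => γ k t) - g t) := fun t => by
      have e : sineL (N + 1) (fun k => γ' k t + freq k ^ 2 * γ k t) =
          (∑ k ∈ Finset.range (N + 1), D k t • sinL k)
          + (∑ k ∈ Finset.range (N + 1), E k t • ((freq k : ℂ) ^ 2 • sinL k))
          + sinProj (N + 1) (h t) := by
        rw [sineL, sinProj, ← Finset.sum_add_distrib, ← Finset.sum_add_distrib]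
        refine Finset.sum_congr rfl fun k _ => ?_
        rw [smul_smul, ← add_smul, ← add_smul]
        congr 1
        simp only [hE, hD, hdd]
        ring
      rw [e, map_sub]
      simp only [hh]
      abel
    simp only [hPeq]
    have m1 := Finset.aestronglyMeasurable_fun_sum (μ := μ) (Finset.range (N + 1))
      fun k _ => (hDm k).smul_const (sinL k)
    have m2 := Finset.aestronglyMeasurable_fun_sum (μ := μ) (Finset.range (N + 1))
      fun k _ => (hEm k).smul_const ((freq k : ℂ) ^ 2 • sinL k)
    have m3 : AEStronglyMeasurable (fun t => sinProj (N + 1) (h t) - h t) μ :=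
      ((continuous_sinProj _).comp_aestronglyMeasurable hhm.1).sub hhm.1
    have m4 := L.continuous.comp_aestronglyMeasurable hUm
    have b4 : eLpNorm (fun t => L (sineL (N + 1) (fun k => γ k t) - g t)) 2 μ ≤ ‖L‖ₑ * (2 * η) :=
      (eLpNorm_le_nnreal_smul_eLpNorm_of_ae_le_mul (c := ‖L‖₊)
        (ae_of_all _ fun t => L.le_opNNNorm _) 2).trans (mul_le_mul' le_rfl hU)
    calc _ ≤ _ := eLpNorm_add_le ((m1.add m2).add m3) m4 (by norm_num)
      _ ≤ _ := add_le_add ((eLpNorm_add_le (m1.add m2) m3 (by norm_num)).trans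
          (add_le_add (eLpNorm_add_le m1 m2 (by norm_num)) le_rfl)) le_rfl
      _ ≤ (S1 * δ + S3 * δ) + η + ‖L‖ₑ * (2 * η) := by
          gcongr
          · exact eLpNorm_sum_smul_le hDm hdδ
          · exact eLpNorm_sum_smul_le hEm hcE
      _ ≤ η + η + ‖L‖ₑ * (2 * η) := by gcongr
      _ ≤ Λ * η := by
          rw [hΛ, add_mul, ← mul_assoc, mul_comm ‖L‖ₑ]
          refine add_le_add ?_ le_rfl
          rw [← two_mul]
          exact mul_le_mul' (by norm_num) le_rfl
      _ = ε := hηε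
  · have : sineL (N + 1) (fun k => γ k t₀) = sinProj (N + 1) (g t₀) := by
      rw [hsq]; simp only [hc0, hq]
    rw [this]
    exact norm_sinProj_le N _
  -- The smoothed coefficients agree exactly with the original ones at `t₀`, so that the gradient
  -- there is a genuine projection and does not exceed `gₓ(t₀)` in norm.
  · have : cosineL (N + 1) (fun k => γ k t₀) = cosProj N (gx t₀) := by
      rw [← hd0.cosineL_eq]; simp only [hc0]
    rw [this]
    exact norm_cosProj_le N _
  · have e : sineL (N + 1) (fun k => γ k t₁) =
        (∑ k ∈ Finset.range (N + 1), E k t₁ • sinL k) + sinProj (N + 1) (g t₁) := by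
      rw [hsq, sineL, sineL, ← Finset.sum_add_distrib]
      simp only [hE, ← add_smul, sub_add_cancel]
    rw [e, add_comm]
    refine (enorm_add_le _ _).trans (add_le_add (enorm_le_iff_norm_le.2 (norm_sinProj_le N _)) ?_)
    refine (enorm_sum_le _ _).trans ?_
    calc ∑ k ∈ Finset.range (N + 1), ‖E k t₁ • sinL k‖ₑ ≤ S1 * δ := by
          rw [hS1, Finset.sum_mul]
          refine Finset.sum_le_sum fun k _ => ?_
          rw [enorm_smul, mul_comm]
          exact mul_le_mul' le_rfl (hcδ k t₁ ⟨ht.le, le_rfl⟩)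
      _ ≤ η := hS1K
      _ ≤ Λ * η := le_mul_of_one_le_left' (by rw [hΛ]; exact le_add_right (by norm_num))
      _ = ε := hηε

/-! ### The estimate on a strip for weak solutions -/

/-- Losing a factor `2` at each comparison replaces a passage to the limit in the weighted
integrals. -/
theorem norm_sq_le_two_mul (x y : ℂ) : ‖x‖ ^ 2 ≤ 2 * ‖y‖ ^ 2 + 2 * ‖y - x‖ ^ 2 := by
  have h : ‖x‖ ≤ ‖y‖ + ‖y - x‖ := by
    calc ‖x‖ = ‖y - (y - x)‖ := by rw [sub_sub_cancel]
      _ ≤ _ := norm_sub_le _ _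
  nlinarith [norm_nonneg x, sq_nonneg (‖y‖ - ‖y - x‖)]

theorem lintegral_ofReal_norm_sq_le {S : Set ℝ} (hS : S ⊆ Ioo (-1) 1) (v : L2I) :
    ∫⁻ x in S, ENNReal.ofReal (‖v x‖ ^ 2) ≤ ‖v‖ₑ ^ 2 := by
  refine (lintegral_mono_set hS).trans ?_
  rw [lintegral_norm_sq_L2I, ENNReal.ofReal_pow (norm_nonneg _), ofReal_norm]

theorem lintegral_enorm_sq_eq {μ : Measure ℝ} (v : ℝ → L2I) :
    ∫⁻ t, ‖v t‖ₑ ^ 2 ∂μ = eLpNorm v 2 μ ^ 2 := by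
  rw [eLpNorm_eq_lintegral_rpow_enorm_toReal (by norm_num) (by norm_num), ← ENNReal.rpow_natCast,
    ← ENNReal.rpow_mul]
  norm_num

theorem integral_norm_sq_congr {v : L2I} {f : ℝ → ℂ} (h : v =ᵐ[muI] f) :
    ‖v‖ ^ 2 = ∫ x, ‖f x‖ ^ 2 ∂muI := by
  rw [norm_sq_L2I]
  refine integral_congr_ae ?_
  filter_upwards [h] with x hx
  rw [hx]

theorem two_mul_ofReal (y : ℝ) : 2 * ENNReal.ofReal y = ENNReal.ofReal (2 * y) := by
  rw [ENNReal.ofReal_mul (by norm_num), ENNReal.ofReal_ofNat]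

/-- Comparison of weighted integrals of functions close to each other in `L²`. -/
theorem lintegral_weighted_le {t₀ t₁ A : ℝ} (hA : 0 ≤ A) {S : Set ℝ} (hS : S ⊆ Ioo (-1) 1)
    (hSm : MeasurableSet S) {W₁ W₂ : ℝ → ℝ → ℝ}
    (h1 : ∀ t ∈ Ioo t₀ t₁, ∀ x ∈ S, 0 ≤ W₁ t x ∧ W₁ t x ≤ A)
    (h2 : ∀ t ∈ Ioo t₀ t₁, ∀ x ∈ S, 0 ≤ W₂ t x ∧ W₂ t x ≤ A)
    {u₁ u₂ v₁ v₂ : ℝ → L2I}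
    (hm₁ : AEStronglyMeasurable (fun t => v₁ t - u₁ t) (volume.restrict (Ioo t₀ t₁)))
    (hm₂ : AEStronglyMeasurable (fun t => v₂ t - u₂ t) (volume.restrict (Ioo t₀ t₁)))
    {ε : ℝ≥0∞} (he₁ : eLpNorm (fun t => v₁ t - u₁ t) 2 (volume.restrict (Ioo t₀ t₁)) ≤ ε)
    (he₂ : eLpNorm (fun t => v₂ t - u₂ t) 2 (volume.restrict (Ioo t₀ t₁)) ≤ ε) :
    ∫⁻ t in Ioo t₀ t₁, ∫⁻ x in S, ENNReal.ofReal (W₁ t x * ‖u₁ t x‖ ^ 2 + W₂ t x * ‖u₂ t x‖ ^ 2) ≤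
      2 * (∫⁻ t in Ioo t₀ t₁, ∫⁻ x in S,
        ENNReal.ofReal (W₁ t x * ‖v₁ t x‖ ^ 2 + W₂ t x * ‖v₂ t x‖ ^ 2))
      + ENNReal.ofReal (4 * A) * ε ^ 2 := by
  have hA2 : (0 : ℝ) ≤ 2 * A := by positivity
  have key : ∀ t ∈ Ioo t₀ t₁, ∫⁻ x in S,
      ENNReal.ofReal (W₁ t x * ‖u₁ t x‖ ^ 2 + W₂ t x * ‖u₂ t x‖ ^ 2) ≤
      2 * (∫⁻ x in S, ENNReal.ofReal (W₁ t x * ‖v₁ t x‖ ^ 2 + W₂ t x * ‖v₂ t x‖ ^ 2))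
      + ENNReal.ofReal (2 * A) * (‖v₁ t - u₁ t‖ₑ ^ 2 + ‖v₂ t - u₂ t‖ₑ ^ 2) := by
    intro t ht
    have hsub : ∀ u v : L2I, ∀ᵐ x ∂volume.restrict S, (v - u) x = v x - u x := fun u v =>
      ae_restrict_of_ae_restrict_of_subset hS (Lp.coeFn_sub v u)
    have hmeas : ∀ v : L2I, Measurable fun x => ENNReal.ofReal (‖v x‖ ^ 2) := fun v =>
      ((Lp.stronglyMeasurable v).norm.measurable.pow_const 2).ennreal_ofReal
    calc _ ≤ ∫⁻ x in S, (2 * ENNReal.ofReal (W₁ t x * ‖v₁ t x‖ ^ 2 + W₂ t x * ‖v₂ t x‖ ^ 2)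
          + ENNReal.ofReal (2 * A) * (ENNReal.ofReal (‖(v₁ t - u₁ t) x‖ ^ 2)
            + ENNReal.ofReal (‖(v₂ t - u₂ t) x‖ ^ 2))) := by
          refine lintegral_mono_ae ?_
          filter_upwards [hsub (u₁ t) (v₁ t), hsub (u₂ t) (v₂ t), ae_restrict_mem hSm] with x e1 e2 hx
          obtain ⟨p1, q1⟩ := h1 t ht x hx
          obtain ⟨p2, q2⟩ := h2 t ht x hx
          rw [e1, e2, ← ENNReal.ofReal_add (by positivity) (by positivity),
            ← ENNReal.ofReal_mul hA2, two_mul_ofReal,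
            ← ENNReal.ofReal_add (by positivity) (by positivity)]
          refine ENNReal.ofReal_le_ofReal ?_
          have b1 := mul_le_mul_of_nonneg_left (norm_sq_le_two_mul (u₁ t x) (v₁ t x)) p1
          have b2 := mul_le_mul_of_nonneg_left (norm_sq_le_two_mul (u₂ t x) (v₂ t x)) p2
          have c1 := mul_le_mul_of_nonneg_right q1 (sq_nonneg ‖v₁ t x - u₁ t x‖)
          have c2 := mul_le_mul_of_nonneg_right q2 (sq_nonneg ‖v₂ t x - u₂ t x‖)
          nlinarith
      _ = 2 * (∫⁻ x in S, ENNReal.ofReal (W₁ t x * ‖v₁ t x‖ ^ 2 + W₂ t x * ‖v₂ t x‖ ^ 2))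
          + ENNReal.ofReal (2 * A) * ((∫⁻ x in S, ENNReal.ofReal (‖(v₁ t - u₁ t) x‖ ^ 2))
            + ∫⁻ x in S, ENNReal.ofReal (‖(v₂ t - u₂ t) x‖ ^ 2)) := by
          have hm : Measurable fun x => ENNReal.ofReal (2 * A) *
              (ENNReal.ofReal (‖(v₁ t - u₁ t) x‖ ^ 2) + ENNReal.ofReal (‖(v₂ t - u₂ t) x‖ ^ 2)) :=
            ((hmeas _).add (hmeas _)).const_mul _
          rw [lintegral_add_right _ hm,
            lintegral_const_mul' _ _ (by norm_num), lintegral_const_mul' _ _ ENNReal.ofReal_ne_top,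
            lintegral_add_right _ (hmeas _)]
      _ ≤ _ := by
          gcongr
          · exact lintegral_ofReal_norm_sq_le hS _
          · exact lintegral_ofReal_norm_sq_le hS _
  have hm : AEMeasurable (fun t => ENNReal.ofReal (2 * A) *
      (‖v₁ t - u₁ t‖ₑ ^ 2 + ‖v₂ t - u₂ t‖ₑ ^ 2)) (volume.restrict (Ioo t₀ t₁)) :=
    ((hm₁.enorm.pow_const 2).add (hm₂.enorm.pow_const 2)).const_mul _
  refine (setLIntegral_mono_ae' measurableSet_Ioo (ae_of_all _ key)).trans ?_
  rw [lintegral_add_right' _ hm, lintegral_const_mul' _ _ (by norm_num),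
    lintegral_const_mul' _ _ ENNReal.ofReal_ne_top, lintegral_add_right' _ (hm₂.enorm.pow_const 2),
    lintegral_enorm_sq_eq, lintegral_enorm_sq_eq]
  refine add_le_add le_rfl ?_
  rw [show (4 : ℝ) * A = 2 * A * 2 by ring, ENNReal.ofReal_mul hA2, mul_assoc, ENNReal.ofReal_ofNat,
    two_mul (ε ^ 2)]
  gcongr

theorem le_of_forall_le_add_mul_sq {X Y K : ℝ≥0∞} (hK : K ≠ ⊤)
    (h : ∀ ε ∈ Ioc (0 : ℝ≥0∞) 1, X ≤ Y + K * ε ^ 2) : X ≤ Y := by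
  have hlim : Tendsto (fun ε : ℝ≥0∞ => Y + K * ε ^ 2) (𝓝[>] 0) (𝓝 (Y + K * 0 ^ 2)) :=
    ((continuous_const.add ((ENNReal.continuous_const_mul hK).comp
      (ENNReal.continuous_pow 2))).tendsto 0).mono_left nhdsWithin_le_nhds
  rw [zero_pow two_ne_zero, mul_zero, add_zero] at hlim
  refine ge_of_tendsto hlim ?_
  filter_upwards [Ioc_mem_nhdsGT zero_lt_one] with ε hε using h ε hε

/-- Carleman estimate on a strip with boundary terms in time, for weak solutions. -/
theorem weak_carleman {a b : ℝ} (ha : -1 ≤ a) (hb : b ≤ 1) (w : CarlemanWeight a b) {C t₀ t₁ : ℝ}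
    (P : StripParam C t₀ t₁) (hC : 24 * w.B ^ 2 / w.κ ≤ C) (ht : t₀ < t₁) {g gx F : ℝ → L2I}
    (hg : ContinuousOn g (Icc t₀ t₁)) (hgx : MemLp gx 2 (volume.restrict (Ioo t₀ t₁)))
    (hd : ∀ᵐ t ∂volume.restrict (Ioo t₀ t₁), HasH10Deriv (g t) (gx t))
    (hF : MemLp F 2 (volume.restrict (Ioo t₀ t₁))) (hd0 : HasH10Deriv (g t₀) (gx t₀))
    {L : L2I →L[ℂ] L2I} (hL : ∀ u, L u =ᵐ[muI] fun x => (P.V x : ℂ) * u x)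
    (hode : ∀ k, ∀ t ∈ Icc t₀ t₁, inner ℂ (sinL k) (g t) = inner ℂ (sinL k) (g t₀)
      + ∫ s in t₀..t, (inner ℂ (sinL k) (F s - L (g s)) - freq k ^ 2 * inner ℂ (sinL k) (g s))) :
    ENNReal.ofReal (w.κ / (4 * (1 + w.B ^ 2))) *
      ∫⁻ t in Ioo t₀ t₁, ∫⁻ x in Ioo (-1 : ℝ) 1, ENNReal.ofReal
        ((P.s t * ‖gx t x‖ ^ 2 + P.s t ^ 3 * ‖g t x‖ ^ 2) * Real.exp (-(P.s t * w.β x))) ≤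
      2 * (ENNReal.ofReal (1 + w.K) * (2 * ∫⁻ t in Ioo t₀ t₁, ∫⁻ x in Ioo (-1 : ℝ) 1, ENNReal.ofReal
        (‖F t x‖ ^ 2 * Real.exp (-(P.s t * w.β x))))
      + ENNReal.ofReal (8 * w.K * w.B ^ 3) * (2 * ∫⁻ t in Ioo t₀ t₁, ∫⁻ x in Ioo a b, ENNReal.ofReal
        (P.s t ^ 3 * ‖g t x‖ ^ 2 * Real.exp (-(P.s t * w.β x))))
      + ENNReal.ofReal (w.D * (P.s t₀ ^ 3 * Real.exp (-(P.s t₀ * w.m))) * (‖gx t₀‖ ^ 2 + ‖g t₀‖ ^ 2))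
      + ENNReal.ofReal (w.D * (P.s t₁ ^ 3 * Real.exp (-(P.s t₁ * w.m))) * (‖g t₁‖ + 1) ^ 2)) := by
  have hsc : ContinuousOn P.s (Icc t₀ t₁) := fun t h => (P.hs t h).continuousAt.continuousWithinAt
  obtain ⟨S, hS⟩ := isCompact_Icc.exists_bound_of_continuousOn hsc
  have hs1 : ∀ t ∈ Icc t₀ t₁, 1 ≤ P.s t := fun t h => by
    have := P.bounds t h 0 (by norm_num)
    exact this.one_le.trans this.le_s
  have hsS : ∀ t ∈ Icc t₀ t₁, P.s t ≤ S := fun t h => (le_abs_self _).trans (hS t h)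
  have hS1 : 1 ≤ S := (hs1 t₀ ⟨le_rfl, ht.le⟩).trans (hsS t₀ ⟨le_rfl, ht.le⟩)
  have hexp : ∀ t ∈ Icc t₀ t₁, ∀ x ∈ Icc (-1 : ℝ) 1, Real.exp (-(P.s t * w.β x)) ≤ 1 :=
    fun t h x hx => by
      rw [Real.exp_le_one_iff, neg_nonpos]
      exact mul_nonneg (zero_le_one.trans (hs1 t h)) (w.m_pos.le.trans (w.m_le x hx))
  -- In a strip away from the singular times the weights are bounded, so that unweighted `L²`
  -- approximation is enough.
  have hwt : ∀ j ≤ 3, ∀ t ∈ Icc t₀ t₁, ∀ x ∈ Icc (-1 : ℝ) 1,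
      0 ≤ P.s t ^ j * Real.exp (-(P.s t * w.β x)) ∧
        P.s t ^ j * Real.exp (-(P.s t * w.β x)) ≤ S ^ 3 := fun j hj t h x hx => by
    have h0 : 0 ≤ P.s t := zero_le_one.trans (hs1 t h)
    refine ⟨by positivity, (mul_le_of_le_one_right (by positivity) (hexp t h x hx)).trans ?_⟩
    exact (pow_le_pow_left₀ h0 (hsS t h) j).trans (pow_le_pow_right₀ hS1 hj)
  have hA : 0 ≤ S ^ 3 := by positivity
  have hD : 0 ≤ w.D := by
    have := w.one_le_B
    have := w.K_nonneg
    unfold CarlemanWeight.D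
    positivity
  have hab : Ioo a b ⊆ Ioo (-1 : ℝ) 1 := Ioo_subset_Ioo ha hb
  have htI : Ioo t₀ t₁ ⊆ Icc t₀ t₁ := Ioo_subset_Icc_self
  have hxI : Ioo (-1 : ℝ) 1 ⊆ Icc (-1) 1 := Ioo_subset_Icc_self
  have hgm : AEStronglyMeasurable g (volume.restrict (Ioo t₀ t₁)) :=
    (hg.mono htI).aestronglyMeasurable measurableSet_Ioo
  set κ₀ := ENNReal.ofReal (w.κ / (4 * (1 + w.B ^ 2)))
  set κ₁ := ENNReal.ofReal (1 + w.K)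
  set κ₂ := ENNReal.ofReal (8 * w.K * w.B ^ 3)
  refine le_of_forall_le_add_mul_sq
    (K := (κ₀ + 2 * κ₁ + 2 * κ₂) * ENNReal.ofReal (4 * S ^ 3)) (by finiteness) ?_
  rintro ε ⟨hε0, hε1⟩
  obtain ⟨N, c, c', hc, hc', h1, h2, h3, h4, h5, h6⟩ :=
    exists_sine_approx ht hg hgx hd hF hd0 L hode hε0.ne'
  have hcc : ∀ k, Continuous fun t => c t k := fun k =>
    continuous_iff_continuousAt.2 fun t => (hc k t).continuousAt
  have hUm : AEStronglyMeasurable (fun t => sineL N (c t)) (volume.restrict (Ioo t₀ t₁)) := by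
    unfold sineL
    exact Continuous.aestronglyMeasurable (by fun_prop)
  have hUxm : AEStronglyMeasurable (fun t => cosineL N (c t)) (volume.restrict (Ioo t₀ t₁)) := by
    unfold cosineL
    exact Continuous.aestronglyMeasurable (by fun_prop)
  have hPm : AEStronglyMeasurable (fun t => sineL N (fun k => c' t k + freq k ^ 2 * c t k)
      + L (sineL N (c t))) (volume.restrict (Ioo t₀ t₁)) := by
    unfold sineL
    exact Continuous.aestronglyMeasurable (by fun_prop)
  have hsw : ∀ {u v : ℝ → L2I},
      eLpNorm (fun t => u t - v t) 2 (volume.restrict (Ioo t₀ t₁)) ≤ ε →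
      eLpNorm (fun t => v t - u t) 2 (volume.restrict (Ioo t₀ t₁)) ≤ ε := fun {u v} h =>
    le_of_eq_of_le (eLpNorm_sub_comm v u 2 _) h
  have est := sineSum_carleman w P hC ht.le N c c' hc hc'
  have q1 := lintegral_weighted_le (t₀ := t₀) (t₁ := t₁) hA (le_refl (Ioo (-1 : ℝ) 1))
    measurableSet_Ioo
    (W₁ := fun t x => P.s t ^ 1 * Real.exp (-(P.s t * w.β x)))
    (W₂ := fun t x => P.s t ^ 3 * Real.exp (-(P.s t * w.β x)))
    (fun t h x hx => hwt 1 (by norm_num) t (htI h) x (hxI hx))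
    (fun t h x hx => hwt 3 le_rfl t (htI h) x (hxI hx))
    (hUxm.sub hgx.1) (hUm.sub hgm) h2 h1
  -- A single function is compared here and in `q3`; the other slot receives the weight zero.
  have q2 := lintegral_weighted_le (t₀ := t₀) (t₁ := t₁) hA (le_refl (Ioo (-1 : ℝ) 1))
    measurableSet_Ioo
    (W₁ := fun _ _ => 0)
    (W₂ := fun t x => P.s t ^ 0 * Real.exp (-(P.s t * w.β x)))
    (fun t h x hx => ⟨le_rfl, hA⟩)
    (fun t h x hx => hwt 0 (by norm_num) t (htI h) x (hxI hx))
    (hF.1.sub hPm) (hF.1.sub hPm) (hsw h3)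
    (hsw h3)
  have q3 := lintegral_weighted_le (t₀ := t₀) (t₁ := t₁) hA hab measurableSet_Ioo
    (W₁ := fun _ _ => 0)
    (W₂ := fun t x => P.s t ^ 3 * Real.exp (-(P.s t * w.β x)))
    (fun t h x hx => ⟨le_rfl, hA⟩)
    (fun t h x hx => hwt 3 le_rfl t (htI h) x (hxI (hab hx)))
    (hgm.sub hUm) (hgm.sub hUm) (hsw h1)
    (hsw h1)
  simp only [zero_mul, zero_add, pow_zero, one_mul, pow_one, mul_right_comm _ (Real.exp _),
    ← add_mul] at q1 q2 q3
  have e1 : ∀ t, ∫⁻ x in Ioo (-1 : ℝ) 1, ENNReal.ofReal ((P.s t * ‖cosineL N (c t) x‖ ^ 2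
      + P.s t ^ 3 * ‖sineL N (c t) x‖ ^ 2) * Real.exp (-(P.s t * w.β x))) =
      ∫⁻ x in Ioo (-1 : ℝ) 1, ENNReal.ofReal ((P.s t * ‖cosineSum N (c t) x‖ ^ 2
      + P.s t ^ 3 * ‖sineSum N (c t) x‖ ^ 2) * Real.exp (-(P.s t * w.β x))) := fun t => by
    refine lintegral_congr_ae ?_
    filter_upwards [coeFn_sineL N (c t), coeFn_cosineL N (c t)] with x y1 y2
    rw [y1, y2]
  have e2 : ∀ t, ∫⁻ x in Ioo (-1 : ℝ) 1, ENNReal.ofReal (Real.exp (-(P.s t * w.β x)) *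
      ‖(sineL N (fun k => c' t k + freq k ^ 2 * c t k) + L (sineL N (c t)) : L2I) x‖ ^ 2) =
      ∫⁻ x in Ioo (-1 : ℝ) 1, ENNReal.ofReal (‖sineSum N (fun k => c' t k + freq k ^ 2 * c t k) x
        + P.V x * sineSum N (c t) x‖ ^ 2 * Real.exp (-(P.s t * w.β x))) := fun t => by
    refine lintegral_congr_ae ?_
    filter_upwards [coeFn_sineL N (c t), coeFn_sineL N (fun k => c' t k + freq k ^ 2 * c t k),
      hL (sineL N (c t)), Lp.coeFn_add (sineL N (fun k => c' t k + freq k ^ 2 * c t k))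
        (L (sineL N (c t)))] with x y1 y2 y3 y4
    rw [y4, Pi.add_apply, y2, y3, y1, mul_comm]
  have e3 : ∀ t, ∫⁻ x in Ioo a b, ENNReal.ofReal (P.s t ^ 3 * ‖sineL N (c t) x‖ ^ 2 *
      Real.exp (-(P.s t * w.β x))) = ∫⁻ x in Ioo a b, ENNReal.ofReal (P.s t ^ 3 *
      ‖sineSum N (c t) x‖ ^ 2 * Real.exp (-(P.s t * w.β x))) := fun t => by
    refine lintegral_congr_ae ?_
    filter_upwards [ae_restrict_of_ae_restrict_of_subset hab (coeFn_sineL N (c t))] with x y1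
    rw [y1]
  simp only [e1] at q1
  simp only [e2] at q2
  simp only [e3] at q3
  have hb0 : ENNReal.ofReal (w.D * (P.s t₀ ^ 3 * Real.exp (-(P.s t₀ * w.m))) *
      ∫ x, (‖cosineSum N (c t₀) x‖ ^ 2 + ‖sineSum N (c t₀) x‖ ^ 2) ∂muI) ≤ ENNReal.ofReal
      (w.D * (P.s t₀ ^ 3 * Real.exp (-(P.s t₀ * w.m))) * (‖gx t₀‖ ^ 2 + ‖g t₀‖ ^ 2)) := by
    have h0 : 0 ≤ P.s t₀ := zero_le_one.trans (hs1 t₀ ⟨le_rfl, ht.le⟩)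
    refine ENNReal.ofReal_le_ofReal (mul_le_mul_of_nonneg_left ?_ (by positivity))
    rw [integral_add]
    · rw [← integral_norm_sq_congr (coeFn_cosineL N (c t₀)), ← integral_norm_sq_congr (coeFn_sineL N (c t₀))]
      gcongr
    · exact integrable_muI (by unfold cosineSum; fun_prop)
    · exact integrable_muI (by unfold sineSum; fun_prop)
  have hb1 : ENNReal.ofReal (w.D * (P.s t₁ ^ 3 * Real.exp (-(P.s t₁ * w.m))) *
      ∫ x, ‖sineSum N (c t₁) x‖ ^ 2 ∂muI) ≤ ENNReal.ofReal
      (w.D * (P.s t₁ ^ 3 * Real.exp (-(P.s t₁ * w.m))) * (‖g t₁‖ + 1) ^ 2) := by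
    have h0 : 0 ≤ P.s t₁ := zero_le_one.trans (hs1 t₁ ⟨ht.le, le_rfl⟩)
    refine ENNReal.ofReal_le_ofReal (mul_le_mul_of_nonneg_left ?_ (by positivity))
    rw [← integral_norm_sq_congr (coeFn_sineL N (c t₁))]
    -- At the final time the approximation is only close, not a projection. The tolerance is at most
    -- `1`, and a crude bound suffices because this term will tend to zero anyway.
    have : ‖sineL N (c t₁)‖ₑ ≤ ENNReal.ofReal (‖g t₁‖ + 1) := by
      rw [ENNReal.ofReal_add (norm_nonneg _) zero_le_one, ofReal_norm, ENNReal.ofReal_one]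
      exact h6.trans (add_le_add le_rfl hε1)
    rw [← ofReal_norm, ENNReal.ofReal_le_ofReal_iff (by positivity)] at this
    gcongr
  set E := ENNReal.ofReal (4 * S ^ 3) * ε ^ 2 with hE
  calc _ ≤ _ := mul_le_mul' le_rfl q1
    _ = _ := by rw [mul_add, mul_left_comm]
    _ ≤ _ := add_le_add (mul_le_mul' le_rfl (est.trans (add_le_add (add_le_add (add_le_add
        (mul_le_mul' le_rfl q2) (mul_le_mul' le_rfl q3)) hb0) hb1))) le_rfl
    _ = _ := by
      simp only [mul_comm (Real.exp _)]
      rw [mul_assoc _ (ENNReal.ofReal (4 * S ^ 3)), ← hE]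
      ring

/-! ### The singular weight in time and the removal of the boundary terms -/

/-- Each of the three lower bounds on `M` has its role: `C T` controls the derivatives of `s`, while
`C T²` and `C N T²` give `s ≥ C` and `s ≥ C N`, since `t (T - t) ≤ T² / 4`. -/
theorem paramBounds_of_le {C M T N n p t x : ℝ} (hC : 1 ≤ C) (hT : 0 < T) (h1 : C * T ≤ M)
    (h2 : C * T ^ 2 ≤ M) (h3 : C * (N * T ^ 2) ≤ M) (hp : 0 < p) (hN : N = |n| + p)
    (ht : t ∈ Ioo 0 T) (hx : x ∈ Icc (-1 : ℝ) 1) :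
    ParamBounds C N (M / (t * (T - t))) (-(M * (T - 2 * t)) / (t * (T - t)) ^ 2)
      (2 * M * (T - 2 * t) ^ 2 / (t * (T - t)) ^ 3 + 2 * M / (t * (T - t)) ^ 2)
      ((p * x + n) ^ 2) (2 * p * (p * x + n)) := by
  obtain ⟨ht0, htT⟩ := ht
  have hC0 : 0 < C := by linarith
  have hτ : 0 < t * (T - t) := mul_pos ht0 (by linarith)
  have hτT : t * (T - t) ≤ T ^ 2 / 4 := by nlinarith [sq_nonneg (T - 2 * t)]
  set τ := t * (T - t)
  have hM : 0 < M := lt_of_lt_of_le (by positivity) h1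
  have hd : |T - 2 * t| ≤ T := abs_le.2 ⟨by linarith, by linarith⟩
  have hd2 : (T - 2 * t) ^ 2 ≤ T ^ 2 := sq_le_sq' (by linarith) (by linarith)
  have hN0 : 0 ≤ N := by rw [hN]; positivity
  have hlin : |p * x + n| ≤ N := by
    refine (abs_add_le _ _).trans ?_
    rw [abs_mul, abs_of_pos hp, hN]
    have := abs_le.2 hx
    nlinarith
  refine ⟨hC, ?_, ?_, ?_, hN0, ?_, sq_nonneg _, ?_, ?_⟩
  · rw [le_div_iff₀ hτ]; nlinarith
  · rw [abs_div, abs_neg, abs_mul, abs_of_pos hM, abs_of_pos (by positivity : 0 < τ ^ 2), div_pow,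
      div_div, div_le_div_iff₀ (by positivity) (by positivity)]
    have : M * |T - 2 * t| * C ≤ M ^ 2 := by nlinarith [mul_le_mul_of_nonneg_left hd hC0.le]
    nlinarith [mul_le_mul_of_nonneg_right this (sq_nonneg τ)]
  · rw [abs_of_nonneg (by positivity)]
    have e : 2 * M * (T - 2 * t) ^ 2 / τ ^ 3 + 2 * M / τ ^ 2 =
        (2 * M * (T - 2 * t) ^ 2 + 2 * M * τ) / τ ^ 3 := by field_simp
    rw [e, div_pow, mul_div_assoc', div_div, div_le_div_iff₀ (by positivity) (by positivity)]
    have h4 : (C * T) ^ 2 ≤ M ^ 2 := pow_le_pow_left₀ (by positivity) h1 2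
    have h5 : (2 * M * (T - 2 * t) ^ 2 + 2 * M * τ) * C ^ 2 ≤ 3 * M ^ 3 := by
      have : 2 * (T - 2 * t) ^ 2 + 2 * τ ≤ 3 * T ^ 2 := by linarith
      calc _ = M * ((2 * (T - 2 * t) ^ 2 + 2 * τ) * C ^ 2) := by ring
        _ ≤ M * (3 * T ^ 2 * C ^ 2) := by gcongr
        _ = 3 * M * (C * T) ^ 2 := by ring
        _ ≤ 3 * M * M ^ 2 := by gcongr
        _ = _ := by ring
    nlinarith [mul_le_mul_of_nonneg_right h5 (pow_nonneg hτ.le 3)]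
  · rw [div_div, le_div_iff₀ (by positivity)]
    nlinarith [mul_nonneg hC0.le (mul_nonneg hN0 (by linarith : 0 ≤ T ^ 2 - τ))]
  · exact sq_le_sq.2 (by rwa [abs_of_nonneg hN0])
  · rw [abs_mul, abs_of_pos (by positivity)]
    have : p ≤ N := by rw [hN]; linarith [abs_nonneg n]
    nlinarith [mul_le_mul this hlin (abs_nonneg _) hN0]

/-- The parameters of the Carleman estimate for the weight `exp (-M β / (t (T - t)))`. -/
def stripParam {C M T N n p t₀ t₁ : ℝ} (hC : 1 ≤ C) (hT : 0 < T) (h1 : C * T ≤ M)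
    (h2 : C * T ^ 2 ≤ M) (h3 : C * (N * T ^ 2) ≤ M) (hp : 0 < p) (hN : N = |n| + p)
    (ht₀ : 0 < t₀) (ht₁ : t₁ < T) : StripParam C t₀ t₁ where
  s t := M / (t * (T - t))
  s1 t := -(M * (T - 2 * t)) / (t * (T - t)) ^ 2
  s2 t := 2 * M * (T - 2 * t) ^ 2 / (t * (T - t)) ^ 3 + 2 * M / (t * (T - t)) ^ 2
  V x := (p * x + n) ^ 2
  V1 x := 2 * p * (p * x + n)
  N := N
  hs t ht := by
    have hτ : t * (T - t) ≠ 0 := (mul_pos (by linarith [ht.1]) (by linarith [ht.2])).ne'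
    have h := ((hasDerivAt_id t).mul ((hasDerivAt_id t).const_sub T))
    refine ((hasDerivAt_const t M).div h hτ).congr_deriv ?_
    simp
    ring
  hs1 t ht := by
    have hτ0 : 0 < t * (T - t) := mul_pos (by linarith [ht.1]) (by linarith [ht.2])
    have hτ : (t * (T - t)) ^ 2 ≠ 0 := by positivity
    have h := ((hasDerivAt_id t).mul ((hasDerivAt_id t).const_sub T))
    refine (((((hasDerivAt_id t).const_mul 2).const_sub T).const_mul M).neg.div (h.pow 2) hτ).congr_deriv ?_
    simp
    field_simp
    ring
  hs2 := by
    have hτ : ∀ t ∈ Icc t₀ t₁, t * (T - t) ≠ 0 := fun t ht =>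
      (mul_pos (by linarith [ht.1]) (by linarith [ht.2])).ne'
    refine ContinuousOn.add (ContinuousOn.div (by fun_prop) (by fun_prop) fun t ht => ?_)
      (ContinuousOn.div (by fun_prop) (by fun_prop) fun t ht => ?_)
    · exact pow_ne_zero _ (hτ t ht)
    · exact pow_ne_zero _ (hτ t ht)
  hV x := by
    refine ((((hasDerivAt_id x).const_mul p).add_const n).pow 2).congr_deriv ?_
    simp
    ring
  hV1 := by fun_prop
  bounds t ht x hx := paramBounds_of_le hC hT h1 h2 h3 hp hN
    ⟨by linarith [ht.1], by linarith [ht.2]⟩ hx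

/-- The fourth power in the exponential series leaves a spare factor `1 / s`, that is, a multiple of
`t (T - t)`, vanishing linearly at both ends. -/
theorem cube_mul_exp_le {s m : ℝ} (hs : 0 < s) (hm : 0 < m) :
    s ^ 3 * Real.exp (-(s * m)) ≤ 24 / m ^ 4 / s := by
  have h := Real.pow_div_factorial_le_exp (s * m) (by positivity) 4
  rw [show Nat.factorial 4 = 24 from rfl, div_le_iff₀ (by norm_num)] at h
  rw [Real.exp_neg, ← div_eq_mul_inv, div_div, div_le_div_iff₀ (by positivity) (by positivity)]
  calc s ^ 3 * (m ^ 4 * s) = (s * m) ^ 4 := by ring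
    _ ≤ _ := h
    _ = _ := by push_cast; ring

/-- Arbitrarily small times at which `t (‖gₓ‖² + ‖g‖²)` is arbitrarily small. -/
theorem MemL2H10.exists_time {T : ℝ} (hT : 0 < T) {g gx : ℝ → L2I} (hgc : ContinuousOn g (Icc 0 T))
    (hg : MemL2H10 T g gx) {η α : ℝ} (hη : 0 < η) (hα : 0 < α) :
    ∃ t ∈ Ioo 0 (min α T), HasH10Deriv (g t) (gx t) ∧ t * (‖gx t‖ ^ 2 + ‖g t‖ ^ 2) ≤ η := by
  obtain ⟨G, hG⟩ := isCompact_Icc.exists_bound_of_continuousOn hgc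
  set r := min (min α T) (η / (2 * (G ^ 2 + 1))) with hr
  have hr0 : 0 < r := lt_min (lt_min hα hT) (by positivity)
  have hrT : r ≤ T := (min_le_left _ _).trans (min_le_right _ _)
  by_contra! hcon
  -- If no such time existed, `1 / t` would be dominated near `0` by a multiple of the integrable
  -- function `‖gₓ‖²`. The radius `r` makes `t ‖g‖²` at most `η / 2`, so that the other half falls
  -- on the gradient.
  have hae : ∀ᵐ t ∂volume.restrict (Ioo 0 r), ‖t⁻¹‖ ≤ 2 / η * ‖gx t‖ ^ 2 := by
    filter_upwards [ae_restrict_of_ae_restrict_of_subset (Ioo_subset_Ioo_right hrT) hg.hasDeriv,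
      ae_restrict_mem measurableSet_Ioo] with t ht htm
    have h1 := hcon t ⟨htm.1, htm.2.trans_le (min_le_left _ _)⟩ ht
    have h2 : t * ‖g t‖ ^ 2 ≤ η / 2 := by
      have h3 : ‖g t‖ ^ 2 ≤ G ^ 2 + 1 := by
        have := pow_le_pow_left₀ (norm_nonneg _) (hG t ⟨htm.1.le, htm.2.le.trans hrT⟩) 2
        linarith
      calc t * ‖g t‖ ^ 2 ≤ η / (2 * (G ^ 2 + 1)) * (G ^ 2 + 1) := by
            gcongr
            exact htm.2.le.trans (min_le_right _ _)
        _ = η / 2 := by field_simp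
    have ht0 : 0 < t := htm.1
    rw [Real.norm_of_nonneg (by positivity), inv_le_iff_one_le_mul₀ ht0, div_mul_eq_mul_div,
      div_mul_eq_mul_div, le_div_iff₀ hη]
    nlinarith
  have hint : IntegrableOn (fun t => 2 / η * ‖gx t‖ ^ 2) (Ioo 0 r) := by
    refine Integrable.const_mul ?_ _
    exact ((memLp_two_iff_integrable_sq_norm hg.memLp_deriv.1).1 hg.memLp_deriv).mono_measure
      (Measure.restrict_mono (Ioo_subset_Ioo_right hrT) le_rfl)
  have hinv : IntegrableOn (fun t : ℝ => t⁻¹) (Ioo 0 r) :=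
    Integrable.mono' hint measurable_inv.aestronglyMeasurable hae
  have := intervalIntegrable_inv_iff.1
    ((intervalIntegrable_iff_integrableOn_Ioo_of_le hr0.le).2 hinv)
  rcases this with h | h
  · exact hr0.ne h
  · exact h (by rw [uIcc_of_le hr0.le]; exact ⟨le_rfl, hr0.le⟩)

theorem setLIntegral_le_of_forall_Ioo {T : ℝ} {f : ℝ → ℝ≥0∞} {Y : ℝ≥0∞}
    (h : ∀ α ∈ Ioo 0 (T / 2), ∫⁻ t in Ioo α (T - α), f t ≤ Y) (hT : 0 < T) :
    ∫⁻ t in Ioo 0 T, f t ≤ Y := by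
  -- The shift by `3` keeps the left endpoint below `T / 2` from the start.
  set s : ℕ → Set ℝ := fun n => Ioo (T / (n + 3)) (T - T / (n + 3)) with hs
  have hanti : ∀ i j : ℕ, i ≤ j → T / ((j : ℝ) + 3) ≤ T / (i + 3) := fun i j hij => by
    gcongr
  have hmono : Monotone s := fun i j hij =>
    Ioo_subset_Ioo (hanti i j hij) (by linarith [hanti i j hij])
  have hU : Ioo 0 T = ⋃ n, s n := by
    ext t
    simp only [hs, mem_iUnion, mem_Ioo]
    constructor
    · rintro ⟨h1, h2⟩
      have hpos : 0 < min t (T - t) := lt_min h1 (by linarith)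
      obtain ⟨n, hn⟩ := exists_nat_gt (T / min t (T - t))
      have h3 : T / ((n : ℝ) + 3) < min t (T - t) := by
        rw [div_lt_iff₀ hpos] at hn
        rw [div_lt_iff₀ (by positivity)]
        nlinarith
      exact ⟨n, h3.trans_le (min_le_left _ _), by linarith [h3.trans_le (min_le_right _ _)]⟩
    · rintro ⟨n, h1, h2⟩
      have : 0 < T / ((n : ℝ) + 3) := by positivity
      constructor <;> linarith
  rw [hU, setLIntegral_iUnion_of_directed _ hmono.directed_le]
  refine iSup_le fun n => h _ ⟨by positivity, ?_⟩
  gcongr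
  linarith [(Nat.cast_nonneg n : (0 : ℝ) ≤ n)]

/-- The multiplicative constant of the Carleman estimate. -/
def CarlemanWeight.Q {a b : ℝ} (w : CarlemanWeight a b) : ℝ := 4 * (1 + w.K) + 32 * w.K * w.B ^ 3

/-- The strip estimate is applied between times closer to `0` and `T` than `α`, chosen so that the
two boundary terms contribute at most `η`. -/
theorem carleman_Ioo {a b : ℝ} (ha : -1 ≤ a) (hb : b ≤ 1) (w : CarlemanWeight a b) {C M T p : ℝ}
    {n : ℤ} (hC1 : 1 ≤ C) (hC : 24 * w.B ^ 2 / w.κ ≤ C) (hT : 0 < T) (h1 : C * T ≤ M)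
    (h2 : C * T ^ 2 ≤ M) (h3 : C * ((|(n : ℝ)| + p) * T ^ 2) ≤ M) (hp : 0 < p)
    {g gx : ℝ → L2I} (hgc : ContinuousOn g (Icc 0 T)) (hg : MemL2H10 T g gx) {f : ℝ × ℝ → ℂ}
    (hf : IsParabolic T n p g f)
    (hfin : ∫⁻ t in Ioo 0 T, ∫⁻ x in Ioo (-1 : ℝ) 1, ENNReal.ofReal
      (‖f (t, x)‖ ^ 2 * Real.exp (-(M / (t * (T - t)) * w.β x))) ≠ ⊤)
    {α : ℝ} (hα : α ∈ Ioo 0 (T / 2)) {η : ℝ} (hη : 0 < η) :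
    ENNReal.ofReal (w.κ / (4 * (1 + w.B ^ 2))) *
      ∫⁻ t in Ioo α (T - α), ∫⁻ x in Ioo (-1 : ℝ) 1, ENNReal.ofReal
        ((M / (t * (T - t)) * ‖gx t x‖ ^ 2 + (M / (t * (T - t))) ^ 3 * ‖g t x‖ ^ 2)
          * Real.exp (-(M / (t * (T - t)) * w.β x))) ≤
      ENNReal.ofReal w.Q * ((∫⁻ t in Ioo 0 T, ∫⁻ x in Ioo (-1 : ℝ) 1, ENNReal.ofReal
        (‖f (t, x)‖ ^ 2 * Real.exp (-(M / (t * (T - t)) * w.β x))))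
      + ∫⁻ t in Ioo 0 T, ∫⁻ x in Ioo a b, ENNReal.ofReal
        ((M / (t * (T - t))) ^ 3 * ‖g t x‖ ^ 2 * Real.exp (-(M / (t * (T - t)) * w.β x))))
      + ENNReal.ofReal η := by
  have hB := w.one_le_B
  have hK := w.K_nonneg
  have hm := w.m_pos
  have hM : 0 < M := lt_of_lt_of_le (by positivity) h1
  have hD : 0 ≤ w.D := by unfold CarlemanWeight.D; positivity
  obtain ⟨G, hG⟩ := isCompact_Icc.exists_bound_of_continuousOn hgc
  have hG0 : 0 ≤ G := (norm_nonneg _).trans (hG 0 ⟨le_rfl, hT.le⟩)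
  set K₀ := w.D * (24 * T / (w.m ^ 4 * M)) with hK₀
  have hK₀0 : 0 ≤ K₀ := by positivity
  -- A constant independent of the strip, so that it can be fixed before the end times are selected.
  have hbd : ∀ t ∈ Ioo 0 T, w.D * ((M / (t * (T - t))) ^ 3 *
      Real.exp (-(M / (t * (T - t)) * w.m))) ≤ K₀ * min t (T - t) := fun t ht => by
    have h4 : 0 < t := ht.1
    have h5 : 0 < T - t := by linarith [ht.2]
    rw [hK₀, mul_assoc]
    refine mul_le_mul_of_nonneg_left ((cube_mul_exp_le (by positivity) hm).trans ?_) hD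
    have h6 : t * (T - t) ≤ T * min t (T - t) := by
      rcases min_cases t (T - t) with ⟨e, _⟩ | ⟨e, _⟩ <;> rw [e] <;> nlinarith
    calc 24 / w.m ^ 4 / (M / (t * (T - t))) = 24 / (w.m ^ 4 * M) * (t * (T - t)) := by field_simp
      _ ≤ 24 / (w.m ^ 4 * M) * (T * min t (T - t)) := by gcongr
      _ = _ := by ring
  obtain ⟨t₀, ht₀, hd0, hb0⟩ := hg.exists_time hT hgc (η := η / (4 * (K₀ + 1))) (by positivity) hα.1
  obtain ⟨ht₀0, ht₀α⟩ := ht₀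
  set r := min α (η / (4 * (K₀ + 1) * (G + 1) ^ 2)) with hr
  have hr0 : 0 < r := lt_min hα.1 (by positivity)
  have hrα : r ≤ α := min_le_left _ _
  have ht₀α' : t₀ < α := ht₀α.trans_le (min_le_left _ _)
  have hαT : α < T / 2 := hα.2
  have ht : t₀ < T - r := by linarith
  have hbdry0 : w.D * ((M / (t₀ * (T - t₀))) ^ 3 * Real.exp (-(M / (t₀ * (T - t₀)) * w.m))) *
      (‖gx t₀‖ ^ 2 + ‖g t₀‖ ^ 2) ≤ η / 4 := by
    calc _ ≤ K₀ * t₀ * (‖gx t₀‖ ^ 2 + ‖g t₀‖ ^ 2) := by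
          refine mul_le_mul_of_nonneg_right ((hbd t₀ ⟨ht₀0, by linarith⟩).trans ?_) (by positivity)
          exact mul_le_mul_of_nonneg_left (min_le_left _ _) hK₀0
      _ = K₀ * (t₀ * (‖gx t₀‖ ^ 2 + ‖g t₀‖ ^ 2)) := by ring
      _ ≤ (K₀ + 1) * (η / (4 * (K₀ + 1))) := by gcongr; linarith
      _ = η / 4 := by field_simp
  have hbdry1 : w.D * ((M / ((T - r) * (T - (T - r)))) ^ 3 *
      Real.exp (-(M / ((T - r) * (T - (T - r))) * w.m))) * (‖g (T - r)‖ + 1) ^ 2 ≤ η / 4 := by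
    calc _ ≤ K₀ * r * (G + 1) ^ 2 := by
          refine mul_le_mul ((hbd (T - r) ⟨by linarith, by linarith⟩).trans ?_) ?_ (by positivity)
            (by positivity)
          · refine mul_le_mul_of_nonneg_left ((min_le_right _ _).trans (by linarith)) hK₀0
          · have := hG (T - r) ⟨by linarith, by linarith⟩
            gcongr
      _ ≤ (K₀ + 1) * (η / (4 * (K₀ + 1) * (G + 1) ^ 2)) * (G + 1) ^ 2 := by
          gcongr
          · linarith
          · exact min_le_right _ _
      _ = η / 4 := by field_simp
  set t₁ := T - r with ht₁
  let P : StripParam C t₀ t₁ := stripParam (n := n) hC1 hT h1 h2 h3 hp rfl ht₀0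
    (show t₁ < T by linarith)
  have hsub : Ioo t₀ t₁ ⊆ Ioo 0 T := Ioo_subset_Ioo ht₀0.le (by linarith)
  have hfm : AEStronglyMeasurable f (rectMeasure t₀ t₁) := by
    rw [rectMeasure, muI, Measure.prod_restrict, ← Measure.volume_eq_prod]
    exact hf.locallyIntegrableOn.aestronglyMeasurable.mono_measure
      (Measure.restrict_mono (prod_mono hsub le_rfl) le_rfl)
  -- On the strip the weight is bounded below by `exp (-S B)`, so that finiteness of the weighted
  -- integral gives `f` in plain `L²` there.
  have hf2 : ∫⁻ t in Ioo t₀ t₁, ∫⁻ x in Ioo (-1 : ℝ) 1, ENNReal.ofReal (‖f (t, x)‖ ^ 2) ≠ ⊤ := by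
    have hsc : ContinuousOn P.s (Icc t₀ t₁) := fun t h => (P.hs t h).continuousAt.continuousWithinAt
    obtain ⟨S, hS⟩ := isCompact_Icc.exists_bound_of_continuousOn hsc
    refine ne_top_of_le_ne_top (ENNReal.mul_ne_top (ENNReal.ofReal_ne_top (r := Real.exp (S * w.B)))
      (ne_top_of_le_ne_top hfin (lintegral_mono_set hsub))) ?_
    rw [← lintegral_const_mul' _ _ ENNReal.ofReal_ne_top]
    refine setLIntegral_mono_ae' measurableSet_Ioo (ae_of_all _ fun t htm => ?_)
    rw [← lintegral_const_mul' _ _ ENNReal.ofReal_ne_top]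
    refine setLIntegral_mono_ae' measurableSet_Ioo (ae_of_all _ fun x hxm => ?_)
    rw [← ENNReal.ofReal_mul (Real.exp_pos _).le]
    refine ENNReal.ofReal_le_ofReal ?_
    have hS' : P.s t ≤ S := (le_abs_self _).trans (hS t (Ioo_subset_Icc_self htm))
    have hs0 : 0 ≤ P.s t := by
      have := P.bounds t (Ioo_subset_Icc_self htm) 0 (by norm_num)
      linarith [this.one_le, this.le_s]
    have hβ : w.β x ≤ w.B := (le_abs_self _).trans (w.bound x (Ioo_subset_Icc_self hxm)).1
    have h4 : P.s t * w.β x ≤ S * w.B :=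
      mul_le_mul hS' hβ (w.m_pos.le.trans (w.m_le x (Ioo_subset_Icc_self hxm))) (hs0.trans hS')
    calc ‖f (t, x)‖ ^ 2 ≤ ‖f (t, x)‖ ^ 2 * Real.exp (S * w.B + -(P.s t * w.β x)) :=
          le_mul_of_one_le_right (by positivity) (Real.one_le_exp (by linarith))
      _ = Real.exp (S * w.B) * (‖f (t, x)‖ ^ 2 * Real.exp (-(P.s t * w.β x))) := by
          rw [Real.exp_add]; ring
  obtain ⟨F, hF, hFf⟩ := exists_L2_section hfm hf2
  obtain ⟨L, hL⟩ := exists_mulL (V := fun x : ℝ => (p * x + n) ^ 2) (by fun_prop)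
  have hode := hf.coefficient_ode hgc hg ht₀0.le ht (by linarith) hF hFf hL
  have est := weak_carleman ha hb w P hC ht (hgc.mono (Icc_subset_Icc ht₀0.le (by linarith)))
    (hg.memLp_deriv.mono_measure (Measure.restrict_mono hsub le_rfl))
    (ae_restrict_of_ae_restrict_of_subset hsub hg.hasDeriv) hF hd0 hL hode
  have hR1 : ∫⁻ t in Ioo t₀ t₁, ∫⁻ x in Ioo (-1 : ℝ) 1, ENNReal.ofReal
      (‖F t x‖ ^ 2 * Real.exp (-(P.s t * w.β x))) ≤ ∫⁻ t in Ioo 0 T, ∫⁻ x in Ioo (-1 : ℝ) 1,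
      ENNReal.ofReal (‖f (t, x)‖ ^ 2 * Real.exp (-(M / (t * (T - t)) * w.β x))) := by
    refine le_of_eq_of_le (lintegral_congr_ae ?_) (lintegral_mono_set hsub)
    filter_upwards [hFf] with t h4
    refine lintegral_congr_ae ?_
    filter_upwards [h4] with x h5
    rw [h5]
    rfl
  have hQ1 : ENNReal.ofReal (1 + w.K) * 4 ≤ ENNReal.ofReal w.Q := by
    rw [← ENNReal.ofReal_ofNat 4, ← ENNReal.ofReal_mul (by positivity)]
    refine ENNReal.ofReal_le_ofReal ?_
    have : 0 ≤ 32 * w.K * w.B ^ 3 := by positivity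
    unfold CarlemanWeight.Q; linarith
  have hQ2 : ENNReal.ofReal (8 * w.K * w.B ^ 3) * 4 ≤ ENNReal.ofReal w.Q := by
    rw [← ENNReal.ofReal_ofNat 4, ← ENNReal.ofReal_mul (by positivity)]
    refine ENNReal.ofReal_le_ofReal ?_
    unfold CarlemanWeight.Q; linarith
  have hη2 : (2 : ℝ≥0∞) * (ENNReal.ofReal (η / 4) + ENNReal.ofReal (η / 4)) = ENNReal.ofReal η := by
    rw [← ENNReal.ofReal_add (by positivity) (by positivity), two_mul_ofReal]
    congr 1; ring
  -- The factor `4` is the product of the two losses of `2`, one on each side of the approximation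
  -- argument; `w.Q` is the sum of the two resulting constants.
  have fin : ∀ X Y k₁ k₂ e q : ℝ≥0∞, k₁ * 4 ≤ q → k₂ * 4 ≤ q →
      2 * (k₁ * (2 * X) + k₂ * (2 * Y) + e + e) ≤ q * (X + Y) + 2 * (e + e) := by
    intro X Y k₁ k₂ e q h4 h5
    calc _ = k₁ * 4 * X + k₂ * 4 * Y + 2 * (e + e) := by ring
      _ ≤ q * X + q * Y + 2 * (e + e) := by gcongr
      _ = _ := by ring
  calc _ ≤ _ := mul_le_mul' le_rfl (lintegral_mono_set (Ioo_subset_Ioo ht₀α'.le (by linarith)))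
    _ ≤ _ := est
    _ ≤ _ := mul_le_mul' le_rfl (add_le_add (add_le_add (add_le_add
        (mul_le_mul' le_rfl (mul_le_mul' le_rfl hR1))
        (mul_le_mul' le_rfl (mul_le_mul' le_rfl (lintegral_mono_set hsub))))
        (ENNReal.ofReal_le_ofReal hbdry0)) (ENNReal.ofReal_le_ofReal hbdry1))
    _ ≤ _ := by
      rw [← hη2]
      exact fin _ _ _ _ _ _ hQ1 hQ2

theorem CarlemanWeight.contDiff {a b : ℝ} (w : CarlemanWeight a b) : ContDiff ℝ 3 w.β := by
  have d : ∀ {h h' : ℝ → ℝ}, (∀ x, HasDerivAt h (h' x) x) → ∀ {n : ℕ}, ContDiff ℝ n h' →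
      ContDiff ℝ (n + 1 : ℕ) h := fun {h h'} hh n hn => by
    have : ContDiff ℝ ((n : ℕ∞ω) + 1) h := by
      rw [contDiff_succ_iff_deriv]
      refine ⟨fun x => (hh x).differentiableAt, by simp, ?_⟩
      rwa [show deriv h = h' from funext fun x => (hh x).deriv]
    exact_mod_cast this
  have h0 : ContDiff ℝ (0 : ℕ) w.β3 := by
    exact_mod_cast contDiff_zero.2 w.continuous.2.2.2.1
  exact_mod_cast d w.hβ (d w.hβ1 (d w.hβ2 h0))

end HeatCarleman

end

/-! ### Conclusion -/

theorem mainTheorem6 (a b : ℝ) (ha : -1 ≤ a) (hab : a < b) (hb : b ≤ 1) :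
    ∃ β : ℝ → ℝ, ContDiffOn ℝ 3 β (Icc (-1) 1) ∧ (∀ x ∈ Icc (-1 : ℝ) 1, 0 < β x) ∧
    ∃ C₁ C₂ : ℝ, 0 < C₁ ∧ 0 < C₂ ∧
    ∀ (n : ℤ) (p : ℝ), 0 < p → ∀ T : ℝ, 0 < T →
    ∀ g gx : ℝ → HeatCarleman.L2I, ContinuousOn g (Icc 0 T) → HeatCarleman.MemL2H10 T g gx →
    ∀ f : ℝ × ℝ → ℂ, HeatCarleman.IsParabolic T n p g f →
    ∀ M : ℝ, M = HeatCarleman.carlemanM C₂ T n p →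
      ENNReal.ofReal C₁ * ∫⁻ t in Ioo (0 : ℝ) T, ∫⁻ x in Ioo (-1 : ℝ) 1,
          ENNReal.ofReal ((M / (t * (T - t)) * ‖gx t x‖ ^ 2
            + M ^ 3 / (t * (T - t)) ^ 3 * ‖g t x‖ ^ 2) * HeatCarleman.weight β M T t x)
        ≤ (∫⁻ t in Ioo (0 : ℝ) T, ∫⁻ x in Ioo (-1 : ℝ) 1,
            ENNReal.ofReal (‖f (t, x)‖ ^ 2 * HeatCarleman.weight β M T t x))
          + ∫⁻ t in Ioo (0 : ℝ) T, ∫⁻ x in Ioo a b,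
            ENNReal.ofReal (M ^ 3 / (t * (T - t)) ^ 3 * ‖g t x‖ ^ 2
              * HeatCarleman.weight β M T t x) := by
  obtain ⟨w⟩ := HeatCarleman.exists_carlemanWeight ha hab hb
  have hB := w.one_le_B
  have hK := w.K_nonneg
  have hκ := w.κ_pos
  have hQ : 0 < w.Q := by unfold HeatCarleman.CarlemanWeight.Q; positivity
  -- It depends on `a` and `b` only, through the weight; it becomes the constant in front of the
  -- maximum defining `M`.
  set C := max 1 (24 * w.B ^ 2 / w.κ) with hC
  have hC1 : 1 ≤ C := le_max_left _ _
  have hC0 : 0 < C := by linarith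
  refine ⟨w.β, w.contDiff.contDiffOn, fun x hx => w.m_pos.trans_le (w.m_le x hx),
    w.κ / (4 * (1 + w.B ^ 2)) / w.Q, C, by positivity, hC0, ?_⟩
  intro n p hp T hT g gx hgc hg f hf M hM
  have hM' : M = C * max (T + T ^ 2) ((|(n : ℝ)| + p) * T ^ 2) := hM
  have h1 : C * T ≤ M := by
    rw [hM']
    exact mul_le_mul_of_nonneg_left ((by nlinarith : T ≤ T + T ^ 2).trans (le_max_left _ _)) hC0.le
  have h2 : C * T ^ 2 ≤ M := by
    rw [hM']
    exact mul_le_mul_of_nonneg_left ((by linarith : T ^ 2 ≤ T + T ^ 2).trans (le_max_left _ _)) hC0.le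
  have h3 : C * ((|(n : ℝ)| + p) * T ^ 2) ≤ M := by
    rw [hM']
    exact mul_le_mul_of_nonneg_left (le_max_right _ _) hC0.le
  have hw : ∀ t x, HeatCarleman.weight w.β M T t x =
      Real.exp (-(M / (t * (T - t)) * w.β x)) := fun t x => by
    rw [HeatCarleman.weight, div_mul_eq_mul_div]
  simp only [hw, ← div_pow]
  -- An infinite right-hand side leaves nothing to prove. Otherwise `f` is square integrable on
  -- inner strips, which the reduction to sine coefficients requires.
  by_cases hfin : ∫⁻ t in Ioo 0 T, ∫⁻ x in Ioo (-1 : ℝ) 1, ENNReal.ofReal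
      (‖f (t, x)‖ ^ 2 * Real.exp (-(M / (t * (T - t)) * w.β x))) = ⊤
  · rw [hfin, top_add]
    exact le_top
  set c := w.κ / (4 * (1 + w.B ^ 2)) with hc
  have hc0 : 0 < c := by positivity
  rw [div_eq_inv_mul, ENNReal.ofReal_mul (by positivity), mul_assoc, ENNReal.ofReal_inv_of_pos hQ,
    ENNReal.inv_mul_le_iff (by simpa using hQ) ENNReal.ofReal_ne_top,
    mul_comm, ← ENNReal.le_div_iff_mul_le (Or.inl (by simpa using hc0)) (Or.inl ENNReal.ofReal_ne_top)]
  -- The right-hand side already lives on all of `(0,T)`. It remains to exhaust the left-hand side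
  -- by inner intervals and to let the boundary contribution `η` tend to zero.
  refine HeatCarleman.setLIntegral_le_of_forall_Ioo (fun α hα => ?_) hT
  rw [ENNReal.le_div_iff_mul_le (Or.inl (by simpa using hc0)) (Or.inl ENNReal.ofReal_ne_top),
    mul_comm]
  refine ENNReal.le_of_forall_pos_le_add fun η hη _ => ?_
  have := HeatCarleman.carleman_Ioo ha hb w hC1 (le_max_right _ _) hT h1 h2 h3 hp hgc hg hf hfin hα
    (η := η) hη
  rwa [ENNReal.ofReal_coe_nnreal] at this
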